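/- **Tropical covers.** A tropical curve $C$ is a connected metric graph all of whose vertices are 3-valent (inner vertices) or 1-valent (leaves), with at least one inner vertex; edges at leaves are called ends and have infinite length, all other edges are called inner edges and have finite length. A tropical cover $\varphi:C\to\mathbb R\cup\{\pm\infty\}$ is a continuous map which sends inner vertices to $\mathbb R$ and leaves to $\pm\infty$, is affine linear on each edge $E$ with a positive integer slope $\omega(E)$ (its weight), and is balanced: if the edges are oriented in the direction in which $\varphi$ increases, then at each inner vertex the incoming and the outgoing weights have the same sum. Ends whose leaf lies over $-\infty$ (over $+\infty$) are called inward (outward). An edge is called even or odd according to its weight. Isomorphisms are isometries commuting with the maps. Let $w_1<\dots<w_{2s+t}$ be real numbers, let $x_i=(w_{2i-1},w_{2i})$ for $1\le i\le s$ and $y_j=w_{2s+j}$ for $1\le j\le t$. The cover has type $(g,\lambda,\mu;s,t)$ if $C$ has first Betti number $g$, the weights of the inward (outward) ends form the partition $\lambda$ ($\mu$), and the image of the set of inner vertices is $\{w_1,\dots,w_{2s+t}\}$. A symmetric cycle (fork) is a pair of inner edges (of ends) with the same weight and the same endpoints (with the same weight and attached to the same inner vertex). The cover is *resolving* if for each $i$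 there are inner vertices $v,v'$ over $w_{2i-1},w_{2i}$, joined by at least one edge, such that one of the following holds: * two edges forming a symmetric fork or cycle merge at $v$ into an edge from $v$ to $v'$, where it merges with a third edge; or the mirror image of this: an edge splits at $v$ into an edge from $v$ to $v'$ and another edge, and the former splits at $v'$ into two edges forming a symmetric fork or cycle; * an edge splits at $v$ into an edge from $v$ to $v'$ and an edge not ending at $v'$, and the former merges at $v'$ with another edge; * an edge splits at $v$ into two edges, not both odd, both of which end at $v'$, where they merge. All edges from $v$ to $v'$ are called contractible. A *zigzag subgraph* of a resolving cover is a closed connected subgraph $S\subset C$ which contains an inner vertex and all contractible edges, whose other edges are all odd, which contains no edge of a symmetric cycle or fork that neither contains a contractible edge nor is adjacent to one, and such that every connected component of $C\setminus S$ is a tail of the following form, flowing into $S$ or out of $S$: for some $k\ge1$, starting from $S$, it is a chain of one or more edges of weight $2k$, consecutive ones separated by a symmetric cycle with edges of weight $k$, and it ends in a leaf or in a symmetric fork with ends of weight $k$; if $k$ is even, there are no symmetric cycles in the chain. A resolving cover with a zigzag subgraph is called a generalized zigzag cover. **Proper zigzag numbers.** A generalized zigzag cover is *properly mixed* if for some zigzag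 subgraph $S$ there is an odd inner edge $E_c\subset S$, directed from $v_1$ to $v_2$, such that 1. removing the interior of $E_c$ from $C$ leaves exactly two components; the inner vertices of one have image $\{w_1,\dots,w_{2s}\}$ and those of the other have image $\{w_{2s+1},\dots,w_{2s+t}\}$; 2. for some inner vertex $v_1'$ the pair $(v_1',v_1)$ is mapped to $x_1$; at $v_1'$ an odd inward end splits into an even edge from $v_1'$ to $v_1$ and an odd edge which does not end at $v_1$; at $v_1$ the even edge merges with another inward end, of the same odd weight as the first one; 3. $\varphi(v_2)=w_{2s+t}$, and two odd edges flow into $v_2$. $Z_g(\lambda,\mu;s,t)$ is the number of isomorphism classes of properly mixed generalized zigzag covers of type $(g,\lambda,\mu;s,t)$; it does not depend on the choice of $w_1<\dots<w_{2s+t}$. **The numbers $z_{\lambda,\mu}(g,h,m)$.** For a partition $\lambda$ let $l(\lambda)$ be the number of its parts, $|\lambda|$ their sum, and $\lambda_e$ the partition consisting of the even integers that occur an odd number of times in $\lambda$, each taken once. Let $\lambda,\mu$ be partitions with $|\lambda|=|\mu|$ and let $o$ be an odd integer occurring at least twice in $\lambda$. Put $\lambda'=\lambda\setminus(\lambda_e,o,o)$,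 $\mu'=\mu\setminus\mu_e$, $c=\tfrac12\bigl||\lambda_e|+2o-|\mu_e|\bigr|$, $$s(h)=\tfrac12\bigl(l(\lambda')+l(\mu')\bigr)+c+h,\qquad t(m)=l(\lambda_e)+l(\mu_e)+2g-2+4m+2c,$$ $$z_{\lambda,\mu}(g,h,m)=Z_g\bigl((\lambda,1^{2c+h+2m-1}),(\mu,1^{2c+h+2m-1});s(h),t(m)\bigr),$$ where $(\lambda,1^r)$ is $\lambda$ with $r$ further parts equal to $1$. **Theorem 1.1.** Let $\lambda,\mu$ be partitions with $|\lambda|=|\mu|$. Suppose that an odd integer $o\ne1$ occurs at least twice in $\lambda$ and that $\mu$ contains an even integer $e\ge 2o$. Then, with $z_{\lambda,\mu}$ formed with this $o$, $$\liminf_{g,h,m\to\infty}\ \frac{\ln z_{\lambda,\mu}(g,h,m)}{\frac h3\ln h+2g\ln m+4m\ln m}\ \ge\ 1,$$ where $g,h,m$ tend to infinity jointly and independently of each other. -/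

import Mathlib

open Filter

/-- An `(s,t)`-distribution: `s` disjoint pairs of real numbers, in increasing order, and `t` further
real numbers in increasing order, none of which lies between the two members of a pair. -/
structure PointDistribution (s t : ℕ) where
  x : Fin s → ℝ × ℝ
  y : Fin t → ℝ
  fst_lt_snd : ∀ i, (x i).1 < (x i).2
  snd_lt_fst : ∀ i j, i < j → (x i).2 < (x j).1
  y_strictMono : StrictMono y
  y_notMem : ∀ i j, y j ∉ Set.Icc (x i).1 (x i).2

namespace PointDistribution

/-- The members of the pairs. -/
def pairPoints {s t : ℕ} (z : PointDistribution s t) : Set ℝ :=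
  Set.range (fun i => (z.x i).1) ∪ Set.range (fun i => (z.x i).2)

/-- The unpaired points. -/
def simplePoints {s t : ℕ} (z : PointDistribution s t) : Set ℝ := Set.range z.y

/-- All points. -/
def points {s t : ℕ} (z : PointDistribution s t) : Set ℝ := z.pairPoints ∪ z.simplePoints

/-- The trivial `(s,t)`-distribution on the points `w 0 < w 1 < ⋯ < w (2s+t-1)`: the first `2s` points
are paired consecutively, the last `t` points are unpaired. -/
def trivial (s t : ℕ) (w : ℕ → ℝ) (hw : StrictMono w) : PointDistribution s t where
  x i := (w (2 * i), w (2 * i + 1))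
  y j := w (2 * s + j)
  fst_lt_snd i := hw (by omega)
  snd_lt_fst i j hij := hw (by have : (i : ℕ) < j := hij; omega)
  y_strictMono i j hij := hw (by have : (i : ℕ) < j := hij; omega)
  y_notMem i j h := by
    have h1 : w (2 * i + 1) < w (2 * s + j) := hw (by have := i.isLt; omega)
    exact absurd h.2 (not_le.mpr h1)

end PointDistribution

/-- A tropical curve `C` (a connected metric graph with only 1-valent and 3-valent vertices, at least
one of them 3-valent) together with a tropical map `φ : C → Tℙ¹ = ℝ ∪ {±∞}`.

`Vert` is the set of inner (3-valent) vertices. Leaves are not listed: each end has exactly one, so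
it is recorded by the value `none`. Since `φ` has positive integer slope on each edge, it orients the
edge in the direction in which it increases; `src e` and `tgt e` are the start and the end of `e`
for this orientation. So `src e = none` says that `e` is an end whose leaf is mapped to `-∞`, and
`tgt e = none` says that `e` is an end whose leaf is mapped to `+∞`. The map `φ` is determined by its
values `pos` at inner vertices and by its slopes `wt` on the edges. -/
structure TropicalCover where
  Vert : Type
  Edge : Type
  [fintypeVert : Fintype Vert]
  [fintypeEdge : Fintype Edge]
  [decEqVert : DecidableEq Vert]
  src : Edge → Option Vert
  tgt : Edge → Option Vert
  /-- the length of an edge -/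
  len : Edge → ENNReal
  /-- the weight of an edge, i.e. the slope of `φ` on it -/
  wt : Edge → ℕ
  /-- the value of `φ` at an inner vertex -/
  pos : Vert → ℝ
  wt_pos : ∀ e, 0 < wt e
  /-- no edge joins two leaves -/
  src_or_tgt : ∀ e, src e ≠ none ∨ tgt e ≠ none
  /-- ends have infinite length -/
  len_end : ∀ e, src e = none ∨ tgt e = none → len e = ⊤
  /-- inner edges have finite positive length -/
  len_inner : ∀ e, src e ≠ none → tgt e ≠ none → 0 < len e ∧ len e < ⊤
  /-- `φ` is affine linear with slope `wt e` on each inner edge `e` -/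
  affine : ∀ e u v, src e = some u → tgt e = some v → pos v = pos u + wt e * (len e).toReal
  /-- inner vertices are 3-valent -/
  trivalent : ∀ v, (Finset.univ.filter fun e => src e = some v).card
      + (Finset.univ.filter fun e => tgt e = some v).card = 3
  /-- the balancing condition -/
  balanced : ∀ v, ∑ e with tgt e = some v, wt e = ∑ e with src e = some v, wt e
  /-- `C` is connected -/
  connected : (SimpleGraph.fromRel fun u v => ∃ e, src e = some u ∧ tgt e = some v).Connected

namespace TropicalCover

attribute [instance] fintypeVert fintypeEdge decEqVert

variable (C : TropicalCover)

/-- The inner edges. -/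
def IsInner (e : C.Edge) : Prop := C.src e ≠ none ∧ C.tgt e ≠ none

/-- `v` is an endpoint of `e`. -/
def Incident (e : C.Edge) (v : C.Vert) : Prop := C.src e = some v ∨ C.tgt e = some v

/-- The graph on the inner vertices of `C` in which two of them are joined whenever an edge
of `C` that belongs to `A` joins them. -/
def graphOn (A : Set C.Edge) : SimpleGraph C.Vert :=
  SimpleGraph.fromRel fun u v => ∃ e ∈ A, C.src e = some u ∧ C.tgt e = some v

/-- `φ` is a tropical cover of type `(g,λ,μ,z)`. As `C` is connected, its first Betti number is
one plus the number of inner edges minus the number of inner vertices. -/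
structure HasType (g : ℕ) (lam mu : Multiset ℕ) {s t : ℕ} (z : PointDistribution s t) : Prop where
  genus : Nat.card {e // C.IsInner e} + 1 = Nat.card C.Vert + g
  image : Set.range C.pos = z.points
  inward : (Finset.univ.filter fun e => C.src e = none).val.map C.wt = lam
  outward : (Finset.univ.filter fun e => C.tgt e = none).val.map C.wt = mu

/-- Two edges form a symmetric cycle (if they are inner edges) or a symmetric fork (if they
are ends): they have the same weight and the same endpoints. -/
def IsSymPair (e f : C.Edge) : Prop :=
  e ≠ f ∧ C.wt e = C.wt f ∧ C.src e = C.src f ∧ C.tgt e = C.tgt f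

/-- The admissible local pictures at two vertices `v₁`, `v₂` joined by an edge `c` directed from
`v₁` to `v₂`. By trivalence and balancing, the edges not mentioned exist and have the direction
and the weight they should have.
* `mergeMerge`: two edges of the same weight `k` flow into `v₁`, the edge `c` (of weight `2k`) flows
  to `v₂`, where it is joined by another edge; the two edges of weight `k` are a symmetric
  fork or a symmetric cycle.
* `splitSplit`: the mirror image of this.
* `splitMerge`: one edge flows into `v₁` and splits into `c` and an edge which does not go to `v₂`;
  `c` is joined at `v₂` by another edge. All combinations of parities are allowed.
* `cycle`: one edge flows into `v₁` and splits into two edges, not both odd, which merge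
  at `v₂`. -/
inductive LocalPicture (v₁ v₂ : C.Vert) : Prop
  | mergeMerge (c a a' d : C.Edge) (hc : C.src c = some v₁ ∧ C.tgt c = some v₂)
      (ha : C.tgt a = some v₁) (ha' : C.tgt a' = some v₁) (hsym : C.IsSymPair a a')
      (hd : C.tgt d = some v₂) (hdc : d ≠ c)
  | splitSplit (c a a' d : C.Edge) (hc : C.src c = some v₁ ∧ C.tgt c = some v₂)
      (ha : C.src a = some v₂) (ha' : C.src a' = some v₂) (hsym : C.IsSymPair a a')
      (hd : C.src d = some v₁) (hdc : d ≠ c)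
  | splitMerge (c b d : C.Edge) (hc : C.src c = some v₁ ∧ C.tgt c = some v₂)
      (hb : C.src b = some v₁) (hb' : C.tgt b ≠ some v₂)
      (hd : C.tgt d = some v₂) (hdc : d ≠ c)
  | cycle (c c' : C.Edge) (hc : C.src c = some v₁ ∧ C.tgt c = some v₂)
      (hc' : C.src c' = some v₁ ∧ C.tgt c' = some v₂) (hne : c ≠ c')
      (heven : ¬ (Odd (C.wt c) ∧ Odd (C.wt c')))

/-- `φ` is a resolving tropical cover: over each pair of `z` there are two adjacent
vertices with one of the admissible local pictures. -/
def IsResolving {s t : ℕ} (z : PointDistribution s t) : Prop :=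
  ∀ i, ∃ v₁ v₂, C.pos v₁ = (z.x i).1 ∧ C.pos v₂ = (z.x i).2 ∧ C.LocalPicture v₁ v₂

/-- The contractible edges: those joining the two vertices over a pair of `z`. -/
def IsContractible {s t : ℕ} (z : PointDistribution s t) (e : C.Edge) : Prop :=
  ∃ i v₁ v₂, C.pos v₁ = (z.x i).1 ∧ C.pos v₂ = (z.x i).2 ∧
    C.src e = some v₁ ∧ C.tgt e = some v₂

/-- `e` belongs to an element of `Sym₂(φ)`, i.e. to a symmetric cycle or fork which
contains no contractible edge and is not adjacent to a contractible edge. -/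
def InSymTwo {s t : ℕ} (z : PointDistribution s t) (e : C.Edge) : Prop :=
  ∃ f, C.IsSymPair e f ∧ ¬ C.IsContractible z e ∧ ¬ C.IsContractible z f ∧
    ∀ c v, C.IsContractible z c → C.Incident c v → ¬ C.Incident e v

/-- A closed subgraph of `C`. (A leaf belongs to it when its end does.) -/
structure Subgraph where
  verts : Set C.Vert
  edges : Set C.Edge
  closed : ∀ e ∈ edges, ∀ v, C.Incident e v → v ∈ verts

namespace Subgraph

variable {C} (S : C.Subgraph)

/-- `S` has an inner vertex and is connected. -/
def Connected : Prop :=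
  S.verts.Nonempty ∧ ∀ u ∈ S.verts, ∀ v ∈ S.verts, (C.graphOn S.edges).Reachable u v

/-- Two edges, the second not in `S`, share a vertex outside `S`. -/
def Linked (e f : C.Edge) : Prop :=
  f ∉ S.edges ∧ ∃ v, v ∉ S.verts ∧ C.Incident e v ∧ C.Incident f v

/-- The set of edges of the connected component of `C ∖ S` which contains the edge `e ∉ S`. -/
def component (e : C.Edge) : Set C.Edge := {f | Relation.ReflTransGen S.Linked e f}

end Subgraph

/-- `T` is the set of edges of a tail beginning with the edge `a`. Here `near f` and `far f` are
the endpoints of `f` on the side of `S` and on the other side. The tail consists of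
even edges of weight `2k`, consecutive ones being separated by symmetric cycles `(k,k)`, and it ends
in a leaf or in a symmetric fork `(k,k)`. There may be any number of cycles if `k` is odd, and there
is none if `k` is even. -/
inductive IsTail (near far : C.Edge → Option C.Vert) (k : ℕ) : C.Edge → Set C.Edge → Prop
  | leaf (a : C.Edge) (ha : C.wt a = 2 * k) (hfar : far a = none) : IsTail near far k a {a}
  | fork (a b b' : C.Edge) (v : C.Vert) (ha : C.wt a = 2 * k) (hfar : far a = some v)
      (hne : b ≠ b') (hb : near b = some v ∧ far b = none ∧ C.wt b = k)
      (hb' : near b' = some v ∧ far b' = none ∧ C.wt b' = k) : IsTail near far k a {a, b, b'}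
  | cycle (a b b' a' : C.Edge) (u v : C.Vert) (T : Set C.Edge) (hk : Odd k)
      (ha : C.wt a = 2 * k) (hfar : far a = some u)
      (hne : b ≠ b') (hb : near b = some u ∧ far b = some v ∧ C.wt b = k)
      (hb' : near b' = some u ∧ far b' = some v ∧ C.wt b' = k)
      (ha' : near a' = some v) (hT : IsTail near far k a' T) : IsTail near far k a ({a, b, b'} ∪ T)

/-- The connected component of `C ∖ S` containing `e` is a tail attached to `S`, inward
(flowing towards `S`) or outward (flowing away from `S`). -/
def IsTailComponent (S : C.Subgraph) (e : C.Edge) : Prop :=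
  ∃ k a, (∃ v ∈ S.verts, C.tgt a = some v ∧ C.IsTail C.tgt C.src k a (S.component e)) ∨
    (∃ v ∈ S.verts, C.src a = some v ∧ C.IsTail C.src C.tgt k a (S.component e))

/-- The conditions on the subgraph `S` in the definition of a generalized zigzag cover. -/
structure IsZigzagSubgraph {s t : ℕ} (z : PointDistribution s t) (S : C.Subgraph) : Prop where
  connected : S.Connected
  disjoint_symTwo : ∀ e ∈ S.edges, ¬ C.InSymTwo z e
  contractible_mem : ∀ e, C.IsContractible z e → e ∈ S.edges
  odd_of_mem : ∀ e ∈ S.edges, ¬ C.IsContractible z e → Odd (C.wt e)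
  tails : ∀ e, e ∉ S.edges → C.IsTailComponent S e

/-- The inner edge `e` is a characteristic edge (with respect to the subgraph `S`), for the trivial
`(s,t)`-distribution on `w 0 < w 1 < ⋯ < w (2s+t-1)`. -/
structure IsCharacteristicEdge (s t : ℕ) (w : ℕ → ℝ) (hw : StrictMono w) (S : C.Subgraph)
    (e : C.Edge) : Prop where
  inner : C.IsInner e
  odd : Odd (C.wt e)
  mem : e ∈ S.edges
  /-- removing the interior of `e` leaves exactly two components; the vertices of one lie over the
  pairs and those of the other lie over the unpaired points -/
  separates : ∃ K₁ K₂ : (C.graphOn {e}ᶜ).ConnectedComponent, K₁ ≠ K₂ ∧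
    (∀ K, K = K₁ ∨ K = K₂) ∧
    C.pos '' K₁.supp = (PointDistribution.trivial s t w hw).pairPoints ∧
    C.pos '' K₂.supp = (PointDistribution.trivial s t w hw).simplePoints
  /-- the start `v₁` of `e` and some vertex `v₁'` lie over the first pair; an odd inward end `a`
  splits at `v₁'` into an odd edge `b` and an even edge `c`, and at `v₁` the edge `c` is joined
  by an inward end `d` of the same odd weight as `a` -/
  start : ∃ (i : Fin s) (v₁' v₁ : C.Vert) (a b c d : C.Edge), (i : ℕ) = 0 ∧
    C.src e = some v₁ ∧
    C.pos v₁' = ((PointDistribution.trivial s t w hw).x i).1 ∧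
    C.pos v₁ = ((PointDistribution.trivial s t w hw).x i).2 ∧
    (C.src a = none ∧ C.tgt a = some v₁' ∧ Odd (C.wt a)) ∧
    (C.src b = some v₁' ∧ C.tgt b ≠ some v₁ ∧ Odd (C.wt b)) ∧
    (C.src c = some v₁' ∧ C.tgt c = some v₁ ∧ Even (C.wt c)) ∧
    (C.src d = none ∧ C.tgt d = some v₁ ∧ Odd (C.wt d)) ∧ C.wt a = C.wt d
  /-- the target of `e` lies over the last point, and two odd edges flow into it -/
  finish : ∃ (v₂ : C.Vert) (f f' : C.Edge), C.tgt e = some v₂ ∧ C.pos v₂ = w (2 * s + t - 1) ∧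
    f ≠ f' ∧ C.tgt f = some v₂ ∧ C.tgt f' = some v₂ ∧ Odd (C.wt f) ∧ Odd (C.wt f')

/-- Properly mixed generalized zigzag covers of type `(g,λ,μ,z)`, where `z` is the trivial
`(s,t)`-distribution on `w 0 < w 1 < ⋯ < w (2s+t-1)`: the resolving tropical covers of this type
which have a subgraph `S` as required for a generalized zigzag cover, and a characteristic
edge in `S`. -/
def IsProperlyMixed (g : ℕ) (lam mu : Multiset ℕ) (s t : ℕ) (w : ℕ → ℝ) (hw : StrictMono w) :
    Prop :=
  C.HasType g lam mu (PointDistribution.trivial s t w hw) ∧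
  C.IsResolving (PointDistribution.trivial s t w hw) ∧
  ∃ S, C.IsZigzagSubgraph (PointDistribution.trivial s t w hw) S ∧
    ∃ e, C.IsCharacteristicEdge s t w hw S e

variable {C}

/-- An isomorphism of tropical covers: an isometry of the underlying tropical curves which
commutes with the maps to `Tℙ¹`. -/
structure Iso (C D : TropicalCover) where
  onVert : C.Vert ≃ D.Vert
  onEdge : C.Edge ≃ D.Edge
  src_eq : ∀ e, D.src (onEdge e) = (C.src e).map onVert
  tgt_eq : ∀ e, D.tgt (onEdge e) = (C.tgt e).map onVert
  len_eq : ∀ e, D.len (onEdge e) = C.len e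
  wt_eq : ∀ e, D.wt (onEdge e) = C.wt e
  pos_eq : ∀ v, D.pos (onVert v) = C.pos v

/-- The identity. -/
def Iso.refl (C : TropicalCover) : Iso C C where
  onVert := Equiv.refl _
  onEdge := Equiv.refl _
  src_eq e := by simp
  tgt_eq e := by simp
  len_eq _ := rfl
  wt_eq _ := rfl
  pos_eq _ := rfl

/-- The inverse of an isomorphism. -/
def Iso.symm {C D : TropicalCover} (f : Iso C D) : Iso D C where
  onVert := f.onVert.symm
  onEdge := f.onEdge.symm
  src_eq e := by
    have h := f.src_eq (f.onEdge.symm e)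
    rw [Equiv.apply_symm_apply] at h
    simp [h, Option.map_map]
  tgt_eq e := by
    have h := f.tgt_eq (f.onEdge.symm e)
    rw [Equiv.apply_symm_apply] at h
    simp [h, Option.map_map]
  len_eq e := by simpa using (f.len_eq (f.onEdge.symm e)).symm
  wt_eq e := by simpa using (f.wt_eq (f.onEdge.symm e)).symm
  pos_eq v := by simpa using (f.pos_eq (f.onVert.symm v)).symm

/-- The composition of two isomorphisms. -/
def Iso.trans {C D E : TropicalCover} (f : Iso C D) (h : Iso D E) : Iso C E where
  onVert := f.onVert.trans h.onVert
  onEdge := f.onEdge.trans h.onEdge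
  src_eq e := by simp [h.src_eq, f.src_eq, Option.map_map]
  tgt_eq e := by simp [h.tgt_eq, f.tgt_eq, Option.map_map]
  len_eq e := by simp [h.len_eq, f.len_eq]
  wt_eq e := by simp [h.wt_eq, f.wt_eq]
  pos_eq v := by simp [h.pos_eq, f.pos_eq]

/-- Isomorphism as an equivalence relation. -/
def isoSetoid : Setoid TropicalCover where
  r C D := Nonempty (Iso C D)
  iseqv := ⟨fun C => ⟨Iso.refl C⟩, fun ⟨f⟩ => ⟨f.symm⟩, fun ⟨f⟩ ⟨h⟩ => ⟨f.trans h⟩⟩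

end TropicalCover

/-- The proper zigzag number `Z_g(λ,μ;s,t)`: the number of isomorphism classes of properly mixed
generalized zigzag covers, counted for the trivial `(s,t)`-distribution on
`w 0 < w 1 < ⋯ < w (2s+t-1)`. -/
noncomputable def properZigzagNumber (g : ℕ) (lam mu : Multiset ℕ) (s t : ℕ) (w : ℕ → ℝ)
    (hw : StrictMono w) : ℕ :=
  Nat.card (Quotient (TropicalCover.isoSetoid.comap
    (Subtype.val : {C : TropicalCover // C.IsProperlyMixed g lam mu s t w hw} → TropicalCover)))

/-- The part `λ_e` of the tail decomposition `λ = (λ_{o,o}², λ_{e,e}², λ_o, λ_e)`: the even integers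
that occur an odd number of times in `λ`, each taken once. -/
def tailEven (p : Multiset ℕ) : Multiset ℕ :=
  (p.toFinset.filter fun a => Even a ∧ Odd (p.count a)).val

/-- `λ' = λ ∖ (λ_e, o, o)`. -/
def lamPrime (lam : Multiset ℕ) (o : ℕ) : Multiset ℕ := lam - (tailEven lam + {o, o})

/-- `μ' = μ ∖ μ_e`. -/
def muPrime (mu : Multiset ℕ) : Multiset ℕ := mu - tailEven mu

/-- The constant `c`, given by `2c = | |λ_e| + 2o - |μ_e| |` (an even number). -/
def zigzagC (lam mu : Multiset ℕ) (o : ℕ) : ℕ :=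
  (((tailEven lam).sum : ℤ) + 2 * o - (tailEven mu).sum).natAbs / 2

/-- The number `s(h)` of triple branch points (the division is exact when `|λ| = |μ|` and `o` is an
odd integer occurring twice in `λ`). -/
def zigzagS (lam mu : Multiset ℕ) (o h : ℕ) : ℕ :=
  ((lamPrime lam o).card + (muPrime mu).card) / 2 + zigzagC lam mu o + h

/-- The number `t(m)` of simple branch points. -/
def zigzagT (lam mu : Multiset ℕ) (o g m : ℕ) : ℕ :=
  (tailEven lam).card + (tailEven mu).card + 2 * g + 4 * m + 2 * zigzagC lam mu o - 2

/-- The number `z_{λ,μ}(g,h,m)`. -/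
noncomputable def zigzagZ (lam mu : Multiset ℕ) (o g h m : ℕ) (w : ℕ → ℝ) (hw : StrictMono w) : ℕ :=
  properZigzagNumber g
    (lam + Multiset.replicate (2 * zigzagC lam mu o + h + 2 * m - 1) 1)
    (mu + Multiset.replicate (2 * zigzagC lam mu o + h + 2 * m - 1) 1)
    (zigzagS lam mu o h) (zigzagT lam mu o g m) w hw

/-! The bound comes from one explicit family of covers, counted by the orders in which their
vertices can lie over the real line. The underlying graph is a caterpillar: a path, the spine, with
a pendant at each vertex. A balanced integral flow on it is determined by the flows in the pendants
and the initial value -1 on the spine. Absolute values of the flow are the weights, signs are the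
orientations, and every height function that increases along the flow turns the graph into a
tropical cover (`Caterpillar.cover`).

Over the pairs, each spine vertex is paired with the root of its pendant, and all pendants
contribute even numbers, so the spine stays odd and negative. Then two ends of weight `o` raise the
flow from -1 to `o - 1` and to `2 * o - 1`; the even edge between them is contractible, and the edge
after them is the characteristic edge. It ends at the peak, where an outward end of weight `e ≥ 2 *
o` makes the flow negative again. The remaining even ends and some forks bring the flow to -1, and
the spine finishes as a zigzag with flow alternating between -1 and 1, where `u` inward tails
alternate with `v` outward ones. The zigzag subgraph consists of the spine and of the pendants over
the pairs without their even ends.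

The freedom is in the heights. A pendant of shape `birth` contains, besides the pair at the spine, a
second pair, and these second pairs can be permuted among the births: this gives `n!`. A birth and
the outward fork that compensates its flow use three pairs and three extra ends of weight 1 on each
side, hence `n` is about `h / 3`. In the zigzag, vertices at the same level of different tails are
incomparable, so each layer can be permuted. The genus `g = q * u + r` is realised by symmetric
cycles, distributed evenly over the inward tails: there are `2 * q + 2` layers of length `u` and two
of length `r`, besides two layers of length `v` from the outward tails. So there are `n! * v! ^ 2 *
u! ^ (2 * q + 2) * r! ^ 2` covers (`Config.factorial_le`), where `u` and `v` are close to `m`, and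
Stirling's lower bound gives the denominator of the theorem.

Different choices give non-isomorphic covers, because an isomorphism has to fix the caterpillar
vertex by vertex (`Config.fixed`): heights identify a starting point, and parities of weights
separate the spine from the pendants. Heights then determine the order in each layer. Finiteness of
the set of classes is proved as well, since `Nat.card` would otherwise be 0. What remains is
arithmetic: `exists_parameters` splits the ends of weight 1 among births, forks and tails so that
all prescribed numbers are met. -/

/-! ### Caterpillars and the tropical covers they carry -/

/-- Codes of edges of a caterpillar: the edges of the spine, the main edges and the secondary edges
of the pendants. -/
abbrev EdgeCode := ℕ ⊕ ((ℕ × ℕ) ⊕ (ℕ × ℕ))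

namespace EdgeCode

/-- The `k`-th edge of the spine. -/
abbrev spine (k : ℕ) : EdgeCode := Sum.inl k
/-- The main edge leaving `x` away from the spine. -/
abbrev main (x : ℕ × ℕ) : EdgeCode := Sum.inr (Sum.inl x)
/-- The secondary edge leaving `x` away from the spine. -/
abbrev sec (x : ℕ × ℕ) : EdgeCode := Sum.inr (Sum.inr x)

end EdgeCode

open EdgeCode

/-- A trivalent graph with a balanced integral flow: a path (the spine) with a pendant at each
of its vertices. The vertex `(k, 0)` is the `k`-th vertex of the spine and the vertices `(k, i)`, `i ≤ p k`,
form the pendant at it. The `k`-th edge of the spine joins `(k - 1, 0)` to `(k, 0)`, the main edge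
at `(k, i)` leads to `(k, i + 1)`, or to a leaf if `i = p k`, and the secondary edge at `(k, i)`, if there
is one, is either parallel to the main edge or leads to a leaf. The flow on the spine is
positive if it is directed to larger `k`, the flow in the pendants is positive if it is directed to the
spine. -/
structure Caterpillar where
  M : ℕ
  M_pos : 0 < M
  p : ℕ → ℕ
  s : ℕ → ℤ
  fm : ℕ × ℕ → ℤ
  fs : ℕ × ℕ → ℤ
  hasSec : ℕ × ℕ → Bool
  link : ℕ × ℕ → Bool
  s_ne : ∀ k ≤ M, s k ≠ 0
  fm_ne : ∀ k < M, ∀ i ≤ p k, fm (k, i) ≠ 0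
  fs_ne : ∀ k < M, ∀ i ≤ p k, hasSec (k, i) → fs (k, i) ≠ 0
  s_succ : ∀ k < M, s (k + 1) = s k + fm (k, 0)
  hasSec_zero : ∀ k < M, hasSec (k, 0) = false
  hasSec_succ : ∀ k < M, ∀ i < p k, hasSec (k, i + 1) = !(hasSec (k, i) && link (k, i))
  bal : ∀ k < M, ∀ i < p k,
    fm (k, i) + (if hasSec (k, i) ∧ link (k, i) then fs (k, i) else 0) =
      fm (k, i + 1) + (if hasSec (k, i + 1) then fs (k, i + 1) else 0)

namespace Caterpillar

variable (G : Caterpillar)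

/-- The set of vertices. -/
def verts : Finset (ℕ × ℕ) :=
  (Finset.range G.M).biUnion fun k => (Finset.range (G.p k + 1)).image (Prod.mk k)

@[simp] lemma mem_verts {k i : ℕ} : (k, i) ∈ G.verts ↔ k < G.M ∧ i ≤ G.p k := by
  simp [verts]

lemma sum_verts {A : Type*} [AddCommMonoid A] (f : ℕ × ℕ → A) :
    ∑ x ∈ G.verts, f x = ∑ k ∈ Finset.range G.M, ∑ i ∈ Finset.range (G.p k + 1), f (k, i) := by
  rw [verts, Finset.sum_biUnion]
  · exact Finset.sum_congr rfl fun k _ =>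
      Finset.sum_image fun i _ j _ h => (Prod.mk.inj h).2
  · intro a _ b _ hab
    simp only [Function.onFun, Finset.disjoint_left, Finset.mem_image]
    rintro _ ⟨i, _, rfl⟩ ⟨j, _, h⟩
    exact hab (congrArg Prod.fst h).symm

/-- The set of edges. -/
def edges : Finset EdgeCode :=
  (Finset.range (G.M + 1)).disjSum (G.verts.disjSum (G.verts.filter fun x => G.hasSec x))

@[simp] lemma spine_mem {k : ℕ} : spine k ∈ G.edges ↔ k ≤ G.M := by
  simp [edges]

@[simp] lemma main_mem {x : ℕ × ℕ} : main x ∈ G.edges ↔ x ∈ G.verts := by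
  simp only [edges, Finset.inr_mem_disjSum, Finset.inl_mem_disjSum]

@[simp] lemma sec_mem {x : ℕ × ℕ} : sec x ∈ G.edges ↔ x ∈ G.verts ∧ G.hasSec x := by
  simp only [edges, Finset.inr_mem_disjSum, Finset.mem_filter]

lemma sum_edges {A : Type*} [AddCommMonoid A] (f : EdgeCode → A) :
    ∑ c ∈ G.edges, f c = ∑ k ∈ Finset.range (G.M + 1), f (spine k) +
      (∑ x ∈ G.verts, f (main x) + ∑ x ∈ G.verts, if G.hasSec x then f (sec x) else 0) := by
  rw [edges, Finset.sum_disjSum, Finset.sum_disjSum, Finset.sum_filter]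

/-- The endpoint of an edge with the larger spine index, or closer to the spine. -/
def nearCode : EdgeCode → ℕ × ℕ
  | .inl k => (k, 0)
  | .inr (.inl x) => x
  | .inr (.inr x) => x

lemma nearCode_spine (k : ℕ) : nearCode (spine k) = (k, 0) := rfl
lemma nearCode_main (x : ℕ × ℕ) : nearCode (main x) = x := rfl
lemma nearCode_sec (x : ℕ × ℕ) : nearCode (sec x) = x := rfl

/-- The other endpoint of an edge. -/
def farCode : EdgeCode → Option (ℕ × ℕ)
  | .inl 0 => none
  | .inl (k + 1) => some (k, 0)
  | .inr (.inl x) => some (x.1, x.2 + 1)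
  | .inr (.inr x) => if G.link x then some (x.1, x.2 + 1) else none

/-- The flow on an edge, from its far endpoint to its near endpoint. -/
def flow : EdgeCode → ℤ
  | .inl k => G.s k
  | .inr (.inl x) => G.fm x
  | .inr (.inr x) => G.fs x

abbrev Vert : Type := {x // x ∈ G.verts}
abbrev Edge : Type := {c // c ∈ G.edges}

/-- The vertex with given coordinates, if there is one. -/
def toVert (x : ℕ × ℕ) : Option G.Vert := if h : x ∈ G.verts then some ⟨x, h⟩ else none

@[simp] lemma toVert_eq_some {x : ℕ × ℕ} {v : G.Vert} : G.toVert x = some v ↔ x = v.1 := by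
  unfold toVert
  split_ifs with h
  · simp [Subtype.ext_iff]
  · simp only [false_iff]
    rintro rfl; exact h v.2

@[simp] lemma toVert_eq_none {x : ℕ × ℕ} : G.toVert x = none ↔ x ∉ G.verts := by
  unfold toVert; split_ifs with h <;> simp [h]

/-- Besides the explicit `none` of `farCode`, coordinates outside `verts` also stand for leaves:
`toVert` turns them into `none`, which makes the last spine edge and the outermost edges of a
pendant into ends. -/
def near (e : G.Edge) : Option G.Vert := G.toVert (nearCode e.1)
def far (e : G.Edge) : Option G.Vert := (G.farCode e.1).bind G.toVert

lemma near_eq_some {e : G.Edge} {v : G.Vert} : G.near e = some v ↔ nearCode e.1 = v.1 := by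
  simp [near]

lemma far_eq_some {e : G.Edge} {v : G.Vert} : G.far e = some v ↔ G.farCode e.1 = some v.1 := by
  simp [far, Option.bind_eq_some_iff]

lemma flow_ne {c : EdgeCode} (hc : c ∈ G.edges) : G.flow c ≠ 0 := by
  rcases c with k | ⟨k, i⟩ | ⟨k, i⟩
  · exact G.s_ne k (by simpa using hc)
  · have := (G.main_mem.1 hc); rw [mem_verts] at this; exact G.fm_ne k this.1 i this.2
  · have := (G.sec_mem.1 hc); rw [mem_verts] at this; exact G.fs_ne k this.1.1 i this.1.2 this.2

lemma sum_near {A : Type*} [AddCommMonoid A] (f : EdgeCode → A) {v : ℕ × ℕ} (hv : v ∈ G.verts) :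
    (∑ c ∈ G.edges, if nearCode c = v then f c else 0) =
      (if v.2 = 0 then f (spine v.1) else 0) + (f (main v) + if G.hasSec v then f (sec v) else 0) := by
  rw [sum_edges]
  obtain ⟨k, i⟩ := v
  have hv' := (G.mem_verts.1 hv)
  simp only [nearCode_spine, nearCode_main, nearCode_sec]
  congr 1
  · by_cases hi : i = 0
    · subst hi
      simp only [Prod.mk.injEq, and_true, Finset.sum_ite_eq', Finset.mem_range, if_true]
      rw [if_pos (by omega)]
    · simp [hi, Ne.symm hi]
  · congr 1
    · rw [Finset.sum_eq_single (k, i)]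
      · simp
      · intro b _ hb; simp [hb]
      · exact fun h => absurd hv h
    · rw [Finset.sum_eq_single (k, i)]
      · simp
      · intro b _ hb; simp [hb]
      · exact fun h => absurd hv h

lemma sum_far {A : Type*} [AddCommMonoid A] (f : EdgeCode → A) {k i : ℕ} (hv : (k, i) ∈ G.verts) :
    (∑ c ∈ G.edges, if G.farCode c = some (k, i) then f c else 0) =
      match i with
      | 0 => f (spine (k + 1))
      | i + 1 => f (main (k, i)) + if G.hasSec (k, i) ∧ G.link (k, i) then f (sec (k, i)) else 0 := by
  rw [sum_edges]
  have hv' := (G.mem_verts.1 hv)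
  rcases i with _ | i
  · have h1 : ∀ x : ℕ × ℕ, (some (x.1, x.2 + 1) : Option (ℕ × ℕ)) ≠ some (k, 0) := by simp
    have h2 : ∀ x : ℕ × ℕ, G.farCode (sec x) ≠ some (k, 0) := by
      intro x; simp only [farCode]; split_ifs <;> simp
    have h3 : ∀ x : ℕ × ℕ, G.farCode (main x) ≠ some (k, 0) := h1
    simp only [h2, h3, if_false, Finset.sum_const_zero, add_zero, ite_self]
    rw [Finset.sum_eq_single (k + 1)]
    · simp [farCode]
    · rintro (_ | b) _ hb
      · simp [farCode]
      · rw [if_neg]; simp only [farCode, Option.some.injEq, Prod.mk.injEq, and_true]; omega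
    · intro h; simp at h; omega
  · have h0 : ∀ j, G.farCode (spine j) ≠ some (k, i + 1) := by
      rintro (_ | j) <;> simp [farCode]
    have hm : (k, i) ∈ G.verts := by simp; omega
    simp only [h0, if_false, Finset.sum_const_zero, zero_add]
    congr 1
    · rw [Finset.sum_eq_single (k, i)]
      · simp [farCode]
      · rintro ⟨a, b⟩ _ hb
        rw [if_neg]; simpa [farCode] using hb
      · simp [hm]
    · rw [Finset.sum_eq_single (k, i)]
      · by_cases h : G.link (k, i) <;> simp [farCode, h]
      · rintro ⟨a, b⟩ _ hb
        by_cases h : G.link (a, b)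
        · have : ¬ (a = k ∧ b = i) := by simpa using hb
          simp [farCode, h, this]
        · simp [farCode, h]
      · simp [hm]

/-- A root has two spine edges and one main edge. Elsewhere the preceding level sends one edge or
two parallel ones, and `hasSec_succ` supplies a secondary edge exactly in the first case. -/
lemma degree {v : ℕ × ℕ} (hv : v ∈ G.verts) :
    (∑ c ∈ G.edges, if nearCode c = v then 1 else 0) +
      (∑ c ∈ G.edges, if G.farCode c = some v then 1 else 0) = 3 := by
  obtain ⟨k, i⟩ := v
  rw [G.sum_near (fun _ => 1) hv, G.sum_far (fun _ => 1) hv]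
  have hv' := (G.mem_verts.1 hv)
  rcases i with _ | i
  · simp [G.hasSec_zero k hv'.1]
  · have := G.hasSec_succ k hv'.1 i (by omega)
    simp only [this]
    cases h1 : G.hasSec (k, i) <;> cases h2 : G.link (k, i) <;> simp

lemma balance {v : ℕ × ℕ} (hv : v ∈ G.verts) :
    (∑ c ∈ G.edges, if nearCode c = v then G.flow c else 0) =
      (∑ c ∈ G.edges, if G.farCode c = some v then G.flow c else 0) := by
  obtain ⟨k, i⟩ := v
  rw [G.sum_near _ hv, G.sum_far _ hv]
  have hv' := (G.mem_verts.1 hv)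
  rcases i with _ | i
  · simp only [G.hasSec_zero k hv'.1, flow]
    rw [G.s_succ k hv'.1]; simp
  · have := G.bal k hv'.1 i (by omega)
    simp only [flow, this]; simp

/-- The start of an edge for the orientation given by the flow. -/
def src (e : G.Edge) : Option G.Vert := if 0 < G.flow e.1 then G.far e else G.near e
/-- The end of an edge for the orientation given by the flow. -/
def tgt (e : G.Edge) : Option G.Vert := if 0 < G.flow e.1 then G.near e else G.far e

lemma trivalent (v : G.Vert) : (Finset.univ.filter fun e => G.src e = some v).card
      + (Finset.univ.filter fun e => G.tgt e = some v).card = 3 := by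
  have h := G.degree v.2
  rw [← Finset.sum_add_distrib, ← Finset.sum_coe_sort G.edges] at h
  rw [Finset.card_filter, Finset.card_filter, ← Finset.sum_add_distrib]
  refine Eq.trans (Finset.sum_congr rfl fun e _ => ?_) h
  simp only [src, tgt]
  split_ifs <;> simp_all [near_eq_some, far_eq_some]

/-- Orienting an edge of negative flow backwards moves its term to the other side of the signed
identity `balance`, where it becomes an absolute value. -/
lemma balanced (v : G.Vert) : ∑ e with G.tgt e = some v, (G.flow e.1).natAbs =
    ∑ e with G.src e = some v, (G.flow e.1).natAbs := by
  have h := G.balance v.2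
  rw [← sub_eq_zero, ← Finset.sum_sub_distrib, ← Finset.sum_coe_sort G.edges] at h
  zify
  rw [← sub_eq_zero, Finset.sum_filter, Finset.sum_filter, ← Finset.sum_sub_distrib]
  refine Eq.trans (Finset.sum_congr rfl fun e _ => ?_) h
  have hn := G.near_eq_some (e := e) (v := v)
  have hf := G.far_eq_some (e := e) (v := v)
  simp only [src, tgt]
  by_cases h0 : 0 < G.flow e.1
  · simp only [h0, if_true, hn, hf, abs_of_pos h0]
  · simp only [h0, if_false, hn, hf, abs_of_nonpos (not_lt.1 h0)]
    split_ifs <;> ring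

lemma near_or_far (e : G.Edge) : G.near e ≠ none ∨ G.far e ≠ none := by
  obtain ⟨c, hc⟩ := e
  rcases c with k | x | x
  · rcases k with _ | k
    · left; simp [near, nearCode, G.M_pos.ne']
    · right; simp [far, farCode]; simpa using hc
  · left; simpa [near, nearCode] using hc
  · left; simpa [near, nearCode] using (G.sec_mem.1 hc).1

lemma src_or_tgt (e : G.Edge) : G.src e ≠ none ∨ G.tgt e ≠ none := by
  have := G.near_or_far e
  simp only [src, tgt]; split_ifs <;> tauto

/-- The graph of the edges in a set `A` of codes. -/
def codeGraph (A : Set EdgeCode) : SimpleGraph G.Vert :=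
  SimpleGraph.fromRel fun u v => ∃ e : G.Edge, e.1 ∈ A ∧ G.src e = some u ∧ G.tgt e = some v

lemma codeGraph_adj {A : Set EdgeCode} {u v : G.Vert} : (G.codeGraph A).Adj u v ↔
    u ≠ v ∧ ∃ e : G.Edge, e.1 ∈ A ∧ ((G.near e = some u ∧ G.far e = some v) ∨
      (G.near e = some v ∧ G.far e = some u)) := by
  simp only [codeGraph, SimpleGraph.fromRel_adj, ← exists_or, and_congr_right_iff]
  intro _
  refine exists_congr fun e => ?_
  simp only [src, tgt]; split_ifs <;> tauto

lemma reachable_pendant {A : Set EdgeCode} {k i : ℕ} (h : (k, i) ∈ G.verts)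
    (hA : ∀ j < i, main (k, j) ∈ A) (h0 : (k, 0) ∈ G.verts) :
    (G.codeGraph A).Reachable ⟨(k, 0), h0⟩ ⟨(k, i), h⟩ := by
  induction i with
  | zero => rfl
  | succ i ih =>
    have hi : (k, i) ∈ G.verts := by simp at h ⊢; omega
    refine (ih hi fun j hj => hA j (by omega)).trans (SimpleGraph.Adj.reachable ?_)
    refine G.codeGraph_adj.2 ⟨by simp, ⟨main (k, i), by simpa using hi⟩, hA i (by omega), Or.inl ?_⟩
    simp [near_eq_some, far_eq_some, nearCode, farCode]

lemma reachable_spine {A : Set EdgeCode} {a b : ℕ} (hab : a ≤ b) (ha : (a, 0) ∈ G.verts)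
    (hb : (b, 0) ∈ G.verts) (hA : ∀ j, a < j → j ≤ b → spine j ∈ A) :
    (G.codeGraph A).Reachable ⟨(a, 0), ha⟩ ⟨(b, 0), hb⟩ := by
  induction b, hab using Nat.le_induction with
  | base => rfl
  | succ b hab ih =>
    have hi : (b, 0) ∈ G.verts := by simp at hb ⊢; omega
    refine (ih hi fun j hj hj' => hA j hj (by omega)).trans (SimpleGraph.Adj.reachable ?_)
    refine G.codeGraph_adj.2 ⟨by simp, ⟨spine (b + 1), by simp at hb ⊢; omega⟩,
      hA _ (by omega) le_rfl, Or.inr ?_⟩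
    simp [near_eq_some, far_eq_some, nearCode, farCode]

/-- A property that is invariant under adjacency is constant on components; this serves to show that
vertices are not connected. -/
lemma reachable_const {A : Set EdgeCode} {P : G.Vert → Prop}
    (hP : ∀ u v, (G.codeGraph A).Adj u v → (P u ↔ P v)) {u v : G.Vert}
    (h : (G.codeGraph A).Reachable u v) : P u ↔ P v := by
  obtain ⟨w⟩ := h
  induction w with
  | nil => rfl
  | cons hadj _ ih => exact (hP _ _ hadj).trans ih

lemma connected : (SimpleGraph.fromRel fun u v => ∃ e, G.src e = some u ∧ G.tgt e = some v).Connected := by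
  have : (SimpleGraph.fromRel fun u v => ∃ e, G.src e = some u ∧ G.tgt e = some v) =
      G.codeGraph Set.univ := by simp [codeGraph]
  rw [this]
  have h0 : (0, 0) ∈ G.verts := by simp [G.M_pos]
  have key : ∀ v : G.Vert, (G.codeGraph Set.univ).Reachable ⟨(0, 0), h0⟩ v := by
    rintro ⟨⟨k, i⟩, h⟩
    have hk : (k, 0) ∈ G.verts := by simp at h ⊢; omega
    exact (G.reachable_spine (Nat.zero_le k) h0 hk (by simp)).trans (G.reachable_pendant h (by simp) hk)
  exact (SimpleGraph.connected_iff_exists_forall_reachable _).2 ⟨_, key⟩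

/-- The tropical cover defined by a caterpillar and a height function that increases in the
direction of the flow. -/
noncomputable def cover (ht : G.Vert → ℝ)
    (hmono : ∀ e a b, G.src e = some a → G.tgt e = some b → ht a < ht b) : TropicalCover where
  Vert := G.Vert
  Edge := G.Edge
  src := G.src
  tgt := G.tgt
  -- The slope forces the length: height difference divided by weight.
  len e := match G.src e, G.tgt e with
    | some a, some b => ENNReal.ofReal ((ht b - ht a) / (G.flow e.1).natAbs)
    | _, _ => ⊤
  wt e := (G.flow e.1).natAbs
  pos := ht
  wt_pos e := Int.natAbs_pos.2 (G.flow_ne e.2)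
  src_or_tgt := G.src_or_tgt
  len_end e h := by
    rcases h with h | h
    · simp [h]
    · rw [h]; cases G.src e <;> rfl
  len_inner e h1 h2 := by
    obtain ⟨a, ha⟩ := Option.ne_none_iff_exists'.1 h1
    obtain ⟨b, hb⟩ := Option.ne_none_iff_exists'.1 h2
    have h3 : 0 < (G.flow e.1).natAbs := Int.natAbs_pos.2 (G.flow_ne e.2)
    have h4 : 0 < (ht b - ht a) / ((G.flow e.1).natAbs : ℝ) :=
      div_pos (sub_pos.2 (hmono e a b ha hb)) (by exact_mod_cast h3)
    rw [ha, hb]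
    exact ⟨ENNReal.ofReal_pos.2 h4, ENNReal.ofReal_lt_top⟩
  affine e a b ha hb := by
    have h3 : 0 < (G.flow e.1).natAbs := Int.natAbs_pos.2 (G.flow_ne e.2)
    have h3' : (0 : ℝ) < (G.flow e.1).natAbs := by exact_mod_cast h3
    have h4 : 0 < (ht b - ht a) / ((G.flow e.1).natAbs : ℝ) :=
      div_pos (sub_pos.2 (hmono e a b ha hb)) h3'
    rw [ha, hb]
    simp only [ENNReal.toReal_ofReal h4.le]
    field_simp; ring
  trivalent := G.trivalent
  balanced := G.balanced
  connected := G.connected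

end Caterpillar

/-! ### Pendants and their flows -/

/-- The shapes of pendants. -/
inductive Node
  /-- an end -/
  | leaf (x : ℤ)
  /-- an edge that splits into two ends -/
  | exch (a b : ℤ)
  /-- two ends of weight 1 merge into an edge which is joined by an end of weight 1; the edge of
  weight 3 obtained splits into an end of weight 1 and an edge that flows to the spine -/
  | birth
  /-- a chain of edges separated by `j` symmetric cycles, ending in a symmetric fork -/
  | tail (x : ℤ) (j : ℕ)

namespace Node

/-- The number of vertices of a pendant that are not on the spine. -/
def p : Node → ℕ
  | leaf _ => 0
  | exch _ _ => 1
  | birth => 3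
  | tail _ j => 2 * j + 1

/-- The flow on the main edges. -/
def fm : Node → ℕ → ℤ
  | leaf x, _ => x
  | exch a b, 0 => a + b
  | exch a _, _ + 1 => a
  | birth, 0 => 2
  | birth, 1 => 3
  | birth, 2 => 2
  | birth, _ + 3 => 1
  | tail x _, i => if i % 2 = 0 then 2 * x else x

/-- The flow on the secondary edges. -/
def fs : Node → ℕ → ℤ
  | leaf x, _ => x
  | exch _ b, _ => b
  | birth, 1 => -1
  | birth, _ => 1
  | tail x _, _ => x

/-- The presence of secondary edges. -/
def hasSec : Node → ℕ → Bool
  | leaf _, _ => false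
  | exch _ _, i => i == 1
  | birth, i => i != 0
  | tail _ _, i => i % 2 == 1

/-- The secondary edges which are parallel to the main edges. -/
def link : Node → ℕ → Bool
  | tail _ _, _ => true
  | _, _ => false

/-- The flow into the spine. -/
def val (N : Node) : ℤ := N.fm 0

/-- All flows are nonzero. -/
def Valid : Node → Prop
  | leaf x => x ≠ 0
  | exch a b => a ≠ 0 ∧ b ≠ 0 ∧ a + b ≠ 0
  | birth => True
  | tail x _ => x ≠ 0

lemma fm_ne {N : Node} (h : N.Valid) {i : ℕ} (hi : i ≤ N.p) : N.fm i ≠ 0 := by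
  cases N with
  | leaf x => exact h
  | exch a b => cases i with
    | zero => exact h.2.2
    | succ i => exact h.1
  | birth => simp only [p] at hi; interval_cases i <;> simp [fm]
  | tail x j => simp only [fm]; have : x ≠ 0 := h; split_ifs <;> omega

lemma fs_ne {N : Node} (h : N.Valid) {i : ℕ} (hi : i ≤ N.p) : N.fs i ≠ 0 := by
  cases N with
  | leaf x => exact h
  | exch a b => exact h.2.1
  | birth => simp only [p] at hi; interval_cases i <;> simp [fs]
  | tail x j => exact h

lemma hasSec_zero (N : Node) : N.hasSec 0 = false := by cases N <;> rfl

lemma hasSec_succ (N : Node) {i : ℕ} (hi : i < N.p) :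
    N.hasSec (i + 1) = !(N.hasSec i && N.link i) := by
  cases N with
  | leaf x => simp [p] at hi
  | exch a b => simp only [p] at hi; interval_cases i; rfl
  | birth => simp only [p] at hi; interval_cases i <;> rfl
  | tail x j =>
    rcases Nat.mod_two_eq_zero_or_one i with h | h <;> simp [hasSec, link, h] <;> omega

lemma bal (N : Node) {i : ℕ} (hi : i < N.p) :
    N.fm i + (if N.hasSec i ∧ N.link i then N.fs i else 0) =
      N.fm (i + 1) + (if N.hasSec (i + 1) then N.fs (i + 1) else 0) := by
  cases N with
  | leaf x => simp [p] at hi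
  | exch a b => simp only [p] at hi; interval_cases i; simp [hasSec, link, fm, fs]
  | birth => simp only [p] at hi; interval_cases i <;> simp [hasSec, link, fm, fs]
  | tail x j =>
    rcases Nat.mod_two_eq_zero_or_one i with h | h
    · have h' : (i + 1) % 2 = 1 := by omega
      simp [hasSec, link, fm, fs, h, h']; ring
    · have h' : (i + 1) % 2 = 0 := by omega
      simp [hasSec, link, fm, fs, h, h']; ring

end Node

/-- The caterpillar with given pendants. -/
def Caterpillar.ofNodes (M : ℕ) (hM : 0 < M) (node : ℕ → Node) (s0 : ℤ)
    (hv : ∀ k < M, (node k).Valid) (hs : ∀ k ≤ M, s0 + ∑ j ∈ Finset.range k, (node j).val ≠ 0) :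
    Caterpillar where
  M := M
  M_pos := hM
  p k := (node k).p
  s k := s0 + ∑ j ∈ Finset.range k, (node j).val
  fm x := (node x.1).fm x.2
  fs x := (node x.1).fs x.2
  hasSec x := (node x.1).hasSec x.2
  link x := (node x.1).link x.2
  s_ne := hs
  fm_ne k hk i hi := Node.fm_ne (hv k hk) hi
  fs_ne k hk i hi _ := Node.fs_ne (hv k hk) hi
  s_succ k _ := by rw [Finset.sum_range_succ, add_assoc]; rfl
  hasSec_zero k _ := Node.hasSec_zero _
  hasSec_succ k _ i hi := Node.hasSec_succ _ hi
  bal k _ i hi := Node.bal _ hi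

/-! ### Configurations and the flow along the spine -/

/-- The data from which the covers are constructed. The spine consists of `N₀` vertices with a pendant
of shape `exch`, `n` vertices with a pendant of shape `birth`, two vertices with an end of weight `o`,
a vertex with an end of weight `e`, `K` vertices with pendants given by `sp`, and finally
a zigzag of `u` vertices with an inward tail and `v` vertices with an outward tail. -/
structure Config where
  N₀ : ℕ
  n : ℕ
  K : ℕ
  u : ℕ
  v : ℕ
  o : ℕ
  e : ℕ
  Jmax : ℕ
  pre : ℕ → ℤ × ℤ
  sp : ℕ → Node
  J : ℕ → ℕ
  u_eq : u = v ∨ u = v + 1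
  J_le : ∀ c, J c ≤ Jmax
  o_odd : Odd o
  o_ne : o ≠ 1
  e_even : Even e
  le_e : 2 * o ≤ e
  pre_ok : ∀ k < N₀, ((pre k).1 = (pre k).2 ∧ (pre k).1 ≠ 0) ∨
    (Odd (pre k).1 ∧ Odd (pre k).2 ∧ (pre k).1 * (pre k).2 < 0 ∧ (pre k).1 + (pre k).2 ≠ 0)
  pre_nonpos : ∀ k ≤ N₀, ∑ j ∈ Finset.range k, ((pre j).1 + (pre j).2) ≤ 0
  pre_sum : ∑ j ∈ Finset.range N₀, ((pre j).1 + (pre j).2) = -2 * n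
  sp_ok : ∀ j < K, (∃ x, sp j = .leaf x ∧ Even x ∧ x ≠ 0) ∨ sp j = .tail 1 0 ∨ sp j = .tail (-1) 0
  sp_neg : ∀ k ≤ K, 2 * (o : ℤ) - 1 - e + ∑ j ∈ Finset.range k, (sp j).val ≤ -1
  sp_sum : 2 * (o : ℤ) - 1 - e + ∑ j ∈ Finset.range K, (sp j).val = -1

namespace Config

variable (F : Config)

/-- The index of the first vertex over the first pair. -/
def N : ℕ := F.N₀ + F.n
/-- The index of the beginning of the zigzag. -/
def Z : ℕ := F.N + 3 + F.K
/-- The number of vertices of the spine. -/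
def M : ℕ := F.Z + (F.u + F.v)

/-- The pendant at the `k`-th vertex of the spine. -/
def node (k : ℕ) : Node :=
  if k < F.N₀ then .exch (F.pre k).1 (F.pre k).2
  else if k < F.N then .birth
  else if k < F.N + 2 then .leaf F.o
  else if k = F.N + 2 then .leaf (-F.e)
  else if k < F.Z then F.sp (k - (F.N + 3))
  else if (k - F.Z) % 2 = 0 then .tail 1 (F.J ((k - F.Z) / 2))
  else .tail (-1) 0

lemma N_eq : F.N = F.N₀ + F.n := rfl
lemma Z_eq : F.Z = F.N + 3 + F.K := rfl
lemma M_eq : F.M = F.Z + (F.u + F.v) := rfl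

lemma node_pre {k : ℕ} (h : k < F.N₀) : F.node k = .exch (F.pre k).1 (F.pre k).2 := by
  rw [node, if_pos h]
lemma node_birth {i : ℕ} (h : i < F.n) : F.node (F.N₀ + i) = .birth := by
  have := F.N_eq
  rw [node, if_neg (by omega), if_pos (by omega)]
lemma node_low : F.node F.N = .leaf F.o := by
  have := F.N_eq
  rw [node, if_neg (by omega), if_neg (by omega), if_pos (by omega)]
lemma node_up : F.node (F.N + 1) = .leaf F.o := by
  have := F.N_eq
  rw [node, if_neg (by omega), if_neg (by omega), if_pos (by omega)]
lemma node_peak : F.node (F.N + 2) = .leaf (-F.e) := by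
  have := F.N_eq
  rw [node, if_neg (by omega), if_neg (by omega), if_neg (by omega), if_pos (by omega)]
lemma node_sp {j : ℕ} (h : j < F.K) : F.node (F.N + 3 + j) = F.sp j := by
  have := F.N_eq
  have := F.Z_eq
  rw [node, if_neg (by omega), if_neg (by omega), if_neg (by omega), if_neg (by omega),
    if_pos (by omega)]
  congr 1; omega
lemma node_in (c : ℕ) : F.node (F.Z + 2 * c) = .tail 1 (F.J c) := by
  have := F.N_eq
  have := F.Z_eq
  rw [node, if_neg (by omega), if_neg (by omega), if_neg (by omega), if_neg (by omega),
    if_neg (by omega), if_pos (by omega)]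
  congr 2; omega
lemma node_out (c : ℕ) : F.node (F.Z + 2 * c + 1) = .tail (-1) 0 := by
  have := F.N_eq
  have := F.Z_eq
  rw [node, if_neg (by omega), if_neg (by omega), if_neg (by omega), if_neg (by omega),
    if_neg (by omega), if_neg (by omega)]

lemma spine_cases {k : ℕ} (hk : k < F.M) : k < F.N₀ ∨ (∃ i < F.n, k = F.N₀ + i) ∨ k = F.N ∨
    k = F.N + 1 ∨ k = F.N + 2 ∨ (∃ j < F.K, k = F.N + 3 + j) ∨ (∃ c < F.u, k = F.Z + 2 * c) ∨
    (∃ c < F.v, k = F.Z + 2 * c + 1) := by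
  have hu := F.u_eq
  unfold M at hk
  by_cases h1 : k < F.N₀
  · exact Or.inl h1
  by_cases h2 : k < F.N
  · exact Or.inr (Or.inl ⟨k - F.N₀, by unfold N at h2; omega, by omega⟩)
  by_cases h3 : k < F.N + 3
  · have : k = F.N ∨ k = F.N + 1 ∨ k = F.N + 2 := by omega
    tauto
  by_cases h4 : k < F.Z
  · have : ∃ j < F.K, k = F.N + 3 + j := ⟨k - (F.N + 3), by unfold Z at h4; omega, by omega⟩
    simp only [this, true_or, or_true]
  rcases Nat.mod_two_eq_zero_or_one (k - F.Z) with h | h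
  · have : ∃ c < F.u, k = F.Z + 2 * c := ⟨(k - F.Z) / 2, by omega, by omega⟩
    simp only [this, true_or, or_true]
  · have : ∃ c < F.v, k = F.Z + 2 * c + 1 := ⟨(k - F.Z) / 2, by omega, by omega⟩
    simp only [this, or_true]

/-- The flow on the edges of the spine. -/
def s (k : ℕ) : ℤ := -1 + ∑ j ∈ Finset.range k, (F.node j).val

lemma s_succ (k : ℕ) : F.s (k + 1) = F.s k + (F.node k).val := by
  rw [s, s, Finset.sum_range_succ, add_assoc]

lemma s_zero : F.s 0 = -1 := by simp [s]

lemma s_pre {k : ℕ} (h : k ≤ F.N₀) :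
    F.s k = -1 + ∑ j ∈ Finset.range k, ((F.pre j).1 + (F.pre j).2) := by
  rw [s]; congr 1
  refine Finset.sum_congr rfl fun j hj => ?_
  rw [Finset.mem_range] at hj
  rw [F.node_pre (by omega)]; rfl

/-- The initial pendants leave a deficit of `2 * n`, which the births pay back in steps of 2. -/
lemma s_birth {i : ℕ} (h : i ≤ F.n) : F.s (F.N₀ + i) = -1 - 2 * F.n + 2 * i := by
  induction i with
  | zero => rw [add_zero, F.s_pre le_rfl, F.pre_sum]; push_cast; ring
  | succ i ih =>
    rw [← add_assoc, s_succ, ih (by omega), F.node_birth (by omega)]; simp [Node.val, Node.fm]; ring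

lemma s_low : F.s F.N = -1 := by rw [N, F.s_birth le_rfl]; ring
lemma s_up : F.s (F.N + 1) = F.o - 1 := by
  rw [s_succ, s_low, node_low]; simp [Node.val, Node.fm]; ring
lemma s_char : F.s (F.N + 2) = 2 * F.o - 1 := by
  rw [s_succ, s_up, node_up]; simp [Node.val, Node.fm]; ring
lemma s_sp {j : ℕ} (h : j ≤ F.K) :
    F.s (F.N + 3 + j) = 2 * F.o - 1 - F.e + ∑ i ∈ Finset.range j, (F.sp i).val := by
  induction j with
  | zero =>
    rw [add_zero, s_succ, s_char, node_peak]; simp [Node.val, Node.fm]; ring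
  | succ j ih =>
    rw [← add_assoc, s_succ, ih (by omega), F.node_sp (by omega), Finset.sum_range_succ]; ring
-- The pendants contribute 2 and -2 in turn, so the flow along the zigzag oscillates between -1 and
-- 1 and its spine vertices are alternately local minima and maxima of the height.
lemma s_in (c : ℕ) : F.s (F.Z + 2 * c) = -1 ∧ F.s (F.Z + 2 * c + 1) = 1 := by
  have key : ∀ c, F.s (F.Z + 2 * c) = -1 → F.s (F.Z + 2 * c + 1) = 1 := by
    intro c h
    rw [s_succ, h, node_in]; simp [Node.val, Node.fm]
  have : F.s (F.Z + 2 * c) = -1 := by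
    induction c with
    | zero => rw [Z, mul_zero, add_zero, F.s_sp le_rfl, F.sp_sum]
    | succ c ih =>
      rw [show F.Z + 2 * (c + 1) = F.Z + 2 * c + 1 + 1 by ring, s_succ, key c ih, node_out]
      simp [Node.val, Node.fm]
  exact ⟨this, key c this⟩

lemma s_neg {k : ℕ} (h : k ≤ F.N) : F.s k < 0 := by
  by_cases h1 : k ≤ F.N₀
  · rw [F.s_pre h1]; have := F.pre_nonpos k h1; omega
  · obtain ⟨i, rfl⟩ := Nat.exists_eq_add_of_le (not_le.1 h1).le
    unfold N at h
    rw [F.s_birth (by omega)]; omega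

lemma s_sp_neg {j : ℕ} (h : j ≤ F.K) : F.s (F.N + 3 + j) < 0 := by
  rw [F.s_sp h]; have := F.sp_neg j h; omega

lemma o_ge : 3 ≤ F.o := by
  obtain ⟨k, hk⟩ := F.o_odd
  have := F.o_ne
  omega

/-- The flow starts at -1 and every pendant except the two ends of weight `o` contributes an even
number, so the edge between these two is the only even one. -/
lemma s_odd {k : ℕ} (hk : k ≠ F.N + 1) (hM : k ≤ F.M) : Odd (F.s k) := by
  have ho := F.o_odd
  have step : ∀ j < F.M, j ≠ F.N → j ≠ F.N + 1 → Even (F.node j).val := by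
    intro j hj h1 h2
    rcases F.spine_cases hj with h | ⟨i, hi, rfl⟩ | h | h | rfl | ⟨i, hi, rfl⟩ | ⟨c, _, rfl⟩ | ⟨c, _, rfl⟩
    · rw [F.node_pre h]
      simp only [Node.val, Node.fm]
      rcases F.pre_ok j h with h' | h'
      · rw [h'.1]; exact Even.add_self _
      · exact h'.1.add_odd h'.2.1
    · rw [F.node_birth hi]; simp [Node.val, Node.fm]
    · exact absurd h h1
    · exact absurd h h2
    · rw [node_peak]; simp only [Node.val, Node.fm, even_neg]; exact_mod_cast F.e_even
    · rw [F.node_sp hi]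
      rcases F.sp_ok i hi with ⟨x, h, hx, _⟩ | h | h <;> rw [h] <;> simp [Node.val, Node.fm, *]
    · rw [node_in]; simp [Node.val, Node.fm]
    · rw [node_out]; simp [Node.val, Node.fm]
  induction k with
  | zero => rw [s_zero]; decide
  | succ k ih =>
    by_cases h : k = F.N + 1
    · subst h; rw [s_char]; exact ⟨F.o - 1, by ring⟩
    · rw [s_succ]; exact (ih h (by omega)).add_even (step k (by omega) (by omega) h)

lemma s_even : Even (F.s (F.N + 1)) := by
  obtain ⟨k, hk⟩ := F.o_odd
  rw [s_up]; exact ⟨k, by rw [hk]; push_cast; ring⟩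

lemma s_cases {k : ℕ} (hk : k ≤ F.M) : k ≤ F.N ∨ k = F.N + 1 ∨ k = F.N + 2 ∨
    (∃ j ≤ F.K, k = F.N + 3 + j) ∨ (∃ c < F.u, k = F.Z + 2 * c + 1) ∨
    (∃ c < F.v, k = F.Z + 2 * c + 2) := by
  rcases Nat.lt_or_ge k (F.N + 3) with h | h
  · omega
  rcases Nat.lt_or_ge F.Z k with h1 | h1
  · have hu := F.u_eq
    unfold M at hk
    rcases Nat.mod_two_eq_zero_or_one (k - F.Z) with h2 | h2
    · have : ∃ c < F.v, k = F.Z + 2 * c + 2 := ⟨(k - F.Z) / 2 - 1, by omega, by omega⟩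
      simp only [this, or_true]
    · have : ∃ c < F.u, k = F.Z + 2 * c + 1 := ⟨(k - F.Z) / 2, by omega, by omega⟩
      simp only [this, true_or, or_true]
  · have : ∃ j ≤ F.K, k = F.N + 3 + j := ⟨k - (F.N + 3), by unfold Z at h1; omega, by omega⟩
    simp only [this, true_or, or_true]

/-- Odd values do not vanish, and the one even value is `o - 1`; this is where `o ≠ 1` enters. -/
lemma s_ne {k : ℕ} (hk : k ≤ F.M) : F.s k ≠ 0 := by
  by_cases h : k = F.N + 1
  · subst h; rw [s_up]; have := F.o_ge; omega
  · intro h0; have := F.s_odd h hk; rw [h0] at this; exact absurd this (by decide)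

lemma node_valid {k : ℕ} (hk : k < F.M) : (F.node k).Valid := by
  have ho := F.o_ge
  have he := F.le_e
  rcases F.spine_cases hk with h | ⟨i, hi, rfl⟩ | rfl | rfl | rfl | ⟨i, hi, rfl⟩ | ⟨c, _, rfl⟩ | ⟨c, _, rfl⟩
  · rw [F.node_pre h]
    rcases F.pre_ok k h with ⟨h1, h2⟩ | ⟨h1, h2, h3, h4⟩
    · exact ⟨h2, h1 ▸ h2, by rw [← h1]; omega⟩
    · exact ⟨left_ne_zero_of_mul h3.ne, right_ne_zero_of_mul h3.ne, h4⟩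
  · rw [F.node_birth hi]; trivial
  · rw [node_low]; simp only [Node.Valid]; omega
  · rw [node_up]; simp only [Node.Valid]; omega
  · rw [node_peak]; simp only [Node.Valid]; omega
  · rw [F.node_sp hi]
    rcases F.sp_ok i hi with ⟨x, h, _, hx⟩ | h | h <;> rw [h] <;> simp [Node.Valid, *]
  · rw [node_in]; simp [Node.Valid]
  · rw [node_out]; simp [Node.Valid]

lemma M_pos : 0 < F.M := by unfold M Z; omega

/-- The caterpillar defined by the data. -/
def cat : Caterpillar :=
  Caterpillar.ofNodes F.M F.M_pos F.node (-1) (fun _ => F.node_valid) (fun _ => F.s_ne)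

@[simp] lemma cat_M : F.cat.M = F.M := rfl
@[simp] lemma cat_p (k : ℕ) : F.cat.p k = (F.node k).p := rfl
lemma flow_spine (k : ℕ) : F.cat.flow (spine k) = F.s k := rfl
lemma flow_main (k i : ℕ) : F.cat.flow (main (k, i)) = (F.node k).fm i := rfl
lemma flow_sec (k i : ℕ) : F.cat.flow (sec (k, i)) = (F.node k).fs i := rfl
lemma mem_cat {k i : ℕ} : (k, i) ∈ F.cat.verts ↔ k < F.M ∧ i ≤ (F.node k).p := Caterpillar.mem_verts _

end Config

/-! ### Ranks, layers and heights -/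

/-- The number of elements of `S` with smaller key. -/
def rankIn {α β : Type*} [LinearOrder β] (S : Finset α) (key : α → β) (x : α) : ℕ :=
  (S.filter fun y => key y < key x).card

lemma rankIn_lt_rankIn {α β : Type*} [LinearOrder β] {S : Finset α} {key : α → β} {x y : α}
    (hx : x ∈ S) (h : key x < key y) : rankIn S key x < rankIn S key y := by
  refine Finset.card_lt_card (Finset.ssubset_iff_of_subset ?_ |>.2 ⟨x, ?_, ?_⟩)
  · intro z hz
    simp only [Finset.mem_filter] at hz ⊢
    exact ⟨hz.1, hz.2.trans h⟩
  · simp [hx, h]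
  · simp

lemma rankIn_lt_iff {α β : Type*} [LinearOrder β] {S : Finset α} {key : α → β} {x y : α}
    (hx : x ∈ S) (hy : y ∈ S) (hinj : Set.InjOn key S) :
    rankIn S key x < rankIn S key y ↔ key x < key y := by
  refine ⟨fun h => ?_, rankIn_lt_rankIn hx⟩
  rcases lt_trichotomy (key x) (key y) with h1 | h1 | h1
  · exact h1
  · rw [hinj hx hy h1] at h; exact absurd h (lt_irrefl _)
  · exact absurd (rankIn_lt_rankIn hy h1) (not_lt.2 h.le)

lemma rankIn_injOn {α β : Type*} [LinearOrder β] {S : Finset α} {key : α → β}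
    (hinj : Set.InjOn key S) : Set.InjOn (rankIn S key) S := by
  intro x hx y hy h
  rcases lt_trichotomy (key x) (key y) with h1 | h1 | h1
  · exact absurd (rankIn_lt_rankIn hx h1) (by rw [h]; exact lt_irrefl _)
  · exact hinj hx hy h1
  · exact absurd (rankIn_lt_rankIn hy h1) (by rw [h]; exact lt_irrefl _)

lemma rankIn_lt_card {α β : Type*} [LinearOrder β] {S : Finset α} {key : α → β} {x : α} (hx : x ∈ S) :
    rankIn S key x < S.card :=
  Finset.card_lt_card ((Finset.ssubset_iff_of_subset (Finset.filter_subset _ _)).2 ⟨x, hx, by simp⟩)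

lemma image_rankIn {α β : Type*} [LinearOrder β] {S : Finset α} {key : α → β}
    (hinj : Set.InjOn key S) : S.image (rankIn S key) = Finset.range S.card := by
  refine Finset.eq_of_subset_of_card_le ?_ ?_
  · intro j hj
    obtain ⟨x, hx, rfl⟩ := Finset.mem_image.1 hj
    exact Finset.mem_range.2 (rankIn_lt_card hx)
  · rw [Finset.card_image_of_injOn (rankIn_injOn hinj), Finset.card_range]

namespace Config

variable (F : Config)

/-- The vertices over the simple points. -/
def upper : Finset (ℕ × ℕ) := F.cat.verts.filter fun x => F.N + 2 ≤ x.1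

/-- The number of pairs. -/
def numPairs : ℕ := 1 + F.n + F.N
/-- The number of simple points. -/
def numSimple : ℕ := F.upper.card

/-- The number of levels of the longest inward tail. -/
def T : ℕ := 2 * F.Jmax + 1

/-- The layer of a vertex over a simple point. -/
def layer (x : ℕ × ℕ) : ℕ :=
  if x.1 = F.N + 2 then F.T + 3 * F.K + 7
  else if x.1 < F.Z then
    F.T + 2 + 3 * (F.Z - x.1) +
      (if x.2 = 0 then 1 else if 0 < (F.node x.1).val then 0 else 2)
  else if (x.1 - F.Z) % 2 = 0 then F.T - x.2
  else if x.2 = 0 then F.T + 1 else F.T + 3 * F.K + 6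

/-- The position within a layer, given by permutations of the layers. -/
def within (ρ : ℕ → Equiv.Perm ℕ) (x : ℕ × ℕ) : ℕ :=
  if x.1 < F.Z then 0
  else if (x.1 - F.Z) % 2 = 0 then ρ (3 + x.2) ((x.1 - F.Z) / 2)
  else if x.2 = 0 then ρ 1 ((x.1 - F.Z) / 2) else ρ 2 ((x.1 - F.Z) / 2)

/-- The key by which the vertices over the simple points are ordered. -/
def key (ρ : ℕ → Equiv.Perm ℕ) (x : ℕ × ℕ) : ℕ ×ₗ ℕ := toLex (F.layer x, F.within ρ x)

lemma key_lt {ρ : ℕ → Equiv.Perm ℕ} {x y : ℕ × ℕ} (h : F.layer x < F.layer y) :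
    F.key ρ x < F.key ρ y := by
  rw [key, key, Prod.Lex.toLex_lt_toLex]; exact Or.inl h

lemma layer_peak : F.layer (F.N + 2, 0) = F.T + 3 * F.K + 7 := by simp [layer]
lemma layer_sp {j : ℕ} (h : j < F.K) : F.layer (F.N + 3 + j, 0) = F.T + 2 + 3 * (F.K - j) + 1 := by
  have := F.Z_eq
  rw [layer, if_neg (by simp only; omega), if_pos (by simp only; omega), if_pos rfl,
    show F.Z - (F.N + 3 + j) = F.K - j by omega]
lemma layer_sp_in {j : ℕ} (h : j < F.K) (h' : F.sp j = .tail 1 0) :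
    F.layer (F.N + 3 + j, 1) = F.T + 2 + 3 * (F.K - j) := by
  have := F.Z_eq
  rw [layer, if_neg (by simp only; omega), if_pos (by simp only; omega), if_neg (by simp),
    F.node_sp h, h', if_pos (by simp [Node.val, Node.fm])]
  simp only; rw [show F.Z - (F.N + 3 + j) = F.K - j by omega]; rw [add_zero]
lemma layer_sp_out {j : ℕ} (h : j < F.K) (h' : F.sp j = .tail (-1) 0) :
    F.layer (F.N + 3 + j, 1) = F.T + 2 + 3 * (F.K - j) + 2 := by
  have := F.Z_eq
  rw [layer, if_neg (by simp only; omega), if_pos (by simp only; omega), if_neg (by simp),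
    F.node_sp h, h', if_neg (by simp [Node.val, Node.fm])]
  simp only; rw [show F.Z - (F.N + 3 + j) = F.K - j by omega]
lemma layer_in (c i : ℕ) : F.layer (F.Z + 2 * c, i) = F.T - i := by
  have := F.Z_eq
  rw [layer, if_neg (by simp only; omega), if_neg (by simp only; omega), if_pos (by simp only; omega)]
lemma layer_out (c : ℕ) : F.layer (F.Z + 2 * c + 1, 0) = F.T + 1 := by
  have := F.Z_eq
  rw [layer, if_neg (by simp only; omega), if_neg (by simp only; omega), if_neg (by simp only; omega),
    if_pos rfl]
lemma layer_out' (c : ℕ) : F.layer (F.Z + 2 * c + 1, 1) = F.T + 3 * F.K + 6 := by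
  have := F.Z_eq
  rw [layer, if_neg (by simp only; omega), if_neg (by simp only; omega), if_neg (by simp only; omega),
    if_neg (by simp)]
lemma within_in (ρ : ℕ → Equiv.Perm ℕ) (c i : ℕ) : F.within ρ (F.Z + 2 * c, i) = ρ (3 + i) c := by
  rw [within, if_neg (by simp only; omega), if_pos (by simp only; omega)]
  simp only; congr 1; omega
lemma within_out (ρ : ℕ → Equiv.Perm ℕ) (c : ℕ) : F.within ρ (F.Z + 2 * c + 1, 0) = ρ 1 c := by
  rw [within, if_neg (by simp only; omega), if_neg (by simp only; omega), if_pos rfl]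
  simp only; congr 1; omega
lemma within_out' (ρ : ℕ → Equiv.Perm ℕ) (c : ℕ) : F.within ρ (F.Z + 2 * c + 1, 1) = ρ 2 c := by
  rw [within, if_neg (by simp only; omega), if_neg (by simp only; omega), if_neg (by simp)]
  simp only; congr 1; omega

lemma mem_upper {k i : ℕ} : (k, i) ∈ F.upper ↔ (k < F.M ∧ i ≤ (F.node k).p) ∧ F.N + 2 ≤ k := by
  simp [upper]

/-- The vertices over the simple points. -/
lemma upper_cases {x : ℕ × ℕ} (hx : x ∈ F.upper) : x = (F.N + 2, 0) ∨
    (∃ j < F.K, x = (F.N + 3 + j, 0)) ∨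
    (∃ j < F.K, x = (F.N + 3 + j, 1) ∧ (F.sp j = .tail 1 0 ∨ F.sp j = .tail (-1) 0)) ∨
    (∃ c < F.u, ∃ i ≤ F.T, i ≤ 2 * F.J c + 1 ∧ x = (F.Z + 2 * c, i)) ∨
    (∃ c < F.v, x = (F.Z + 2 * c + 1, 0)) ∨ (∃ c < F.v, x = (F.Z + 2 * c + 1, 1)) := by
  obtain ⟨k, i⟩ := x
  rw [mem_upper] at hx
  have := F.N_eq
  rcases F.spine_cases hx.1.1 with h | ⟨i, hi, rfl⟩ | rfl | rfl | rfl | ⟨j, hj, rfl⟩ | ⟨c, hc, rfl⟩ |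
    ⟨c, hc, rfl⟩
  · omega
  · omega
  · omega
  · omega
  · have := hx.1.2
    rw [node_peak] at this
    simp only [Node.p] at this
    left; simp; omega
  · have h1 := hx.1.2
    rw [F.node_sp hj] at h1
    rcases Nat.eq_zero_or_pos i with rfl | hi
    · exact .inr (.inl ⟨j, hj, rfl⟩)
    · have h2 := F.sp_ok j hj
      refine .inr (.inr (.inl ⟨j, hj, ?_, ?_⟩))
      · rcases h2 with ⟨x, h, _⟩ | h | h <;> rw [h] at h1 <;> simp only [Node.p] at h1
        · omega
        · simp; omega
        · simp; omega
      · rcases h2 with ⟨x, h, _⟩ | h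
        · rw [h] at h1; simp only [Node.p] at h1; omega
        · exact h
  · have h1 := hx.1.2
    rw [node_in] at h1
    simp only [Node.p] at h1
    have := F.J_le c
    exact .inr (.inr (.inr (.inl ⟨c, hc, i, by unfold T; omega, h1, rfl⟩)))
  · have h1 := hx.1.2
    rw [node_out] at h1
    simp only [Node.p] at h1
    have : i = 0 ∨ i = 1 := by omega
    rcases this with rfl | rfl
    · exact .inr (.inr (.inr (.inr (.inl ⟨c, hc, rfl⟩))))
    · exact .inr (.inr (.inr (.inr (.inr ⟨c, hc, rfl⟩))))

/-- Layers alone separate these vertices, except for vertices at the same level of different tails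
of the zigzag; there the injectivity of the permutation decides. -/
lemma key_injOn (ρ : ℕ → Equiv.Perm ℕ) : Set.InjOn (F.key ρ) F.upper := by
  intro x hx y hy h
  have h' : F.layer x = F.layer y ∧ F.within ρ x = F.within ρ y := by simpa [key] using h
  obtain ⟨h1, h2⟩ := h'
  clear h
  rcases F.upper_cases hx with rfl | ⟨j, hj, rfl⟩ | ⟨j, hj, rfl, e | e⟩ | ⟨c, hc, i, hi, _, rfl⟩ |
    ⟨c, hc, rfl⟩ | ⟨c, hc, rfl⟩ <;>
  rcases F.upper_cases hy with rfl | ⟨j', hj', rfl⟩ | ⟨j', hj', rfl, e' | e'⟩ | ⟨c', hc', i', hi', _, rfl⟩ |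
    ⟨c', hc', rfl⟩ | ⟨c', hc', rfl⟩ <;>
  simp only [*, layer_peak, layer_sp, layer_sp_in, layer_sp_out, layer_in, layer_out, layer_out'] at h1 <;>
  first
  | rfl
  | (exfalso; omega)
  | (have : j = j' := by omega
     subst this; rfl)
  | (rw [within_out, within_out] at h2; rw [(ρ 1).injective h2])
  | (rw [within_out', within_out'] at h2; rw [(ρ 2).injective h2])
  | (have : i = i' := by omega
     subst this
     rw [within_in, within_in] at h2; rw [(ρ (3 + i)).injective h2])

/-- The rank of the image of a vertex in the set of all points. -/
def height (ρ : ℕ → Equiv.Perm ℕ) (x : ℕ × ℕ) : ℕ :=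
  -- Pair 0 belongs to the two ends of weight `o`, pairs 1 to `n` to the outer pairs of the births,
  -- ordered by `ρ 0`, and pair `n + N - k` to the spine vertex `k` and the root of its pendant. The
  -- flow on this part of the spine is negative, so a larger `k` must lie lower.
  if x.1 < F.N then
    match x.2 with
    | 0 => 2 * (F.n + F.N - x.1) + (if 0 < (F.node x.1).val then 1 else 0)
    | 1 => 2 * (F.n + F.N - x.1) + (if 0 < (F.node x.1).val then 0 else 1)
    | 2 => 2 * (1 + ρ 0 (x.1 - F.N₀)) + 1
    | _ => 2 * (1 + ρ 0 (x.1 - F.N₀))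
  else if x.1 = F.N then 0
  else if x.1 = F.N + 1 then 1
  else 2 * F.numPairs + rankIn F.upper (F.key ρ) x

variable {ρ : ℕ → Equiv.Perm ℕ}

lemma height_zero {k : ℕ} (h : k < F.N) : F.height ρ (k, 0) =
    2 * (F.n + F.N - k) + (if 0 < (F.node k).val then 1 else 0) := by simp [height, h]
lemma height_one {k : ℕ} (h : k < F.N) : F.height ρ (k, 1) =
    2 * (F.n + F.N - k) + (if 0 < (F.node k).val then 0 else 1) := by simp [height, h]
lemma height_two {i : ℕ} (h : i < F.n) : F.height ρ (F.N₀ + i, 2) = 2 * (1 + ρ 0 i) + 1 := by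
  have : F.N₀ + i < F.N := by unfold N; omega
  simp [height, this]
lemma height_three {i : ℕ} (h : i < F.n) : F.height ρ (F.N₀ + i, 3) = 2 * (1 + ρ 0 i) := by
  have : F.N₀ + i < F.N := by unfold N; omega
  simp [height, this]
lemma height_low (i : ℕ) : F.height ρ (F.N, i) = 0 := by simp [height]
lemma height_up (i : ℕ) : F.height ρ (F.N + 1, i) = 1 := by simp [height]
lemma height_upper {x : ℕ × ℕ} (hx : x ∈ F.upper) :
    F.height ρ x = 2 * F.numPairs + rankIn F.upper (F.key ρ) x := by
  obtain ⟨k, i⟩ := x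
  rw [mem_upper] at hx
  rw [height, if_neg (by simp only; omega), if_neg (by simp only; omega), if_neg (by simp only; omega)]

/-- The vertices over the pairs. -/
lemma lower_cases {x : ℕ × ℕ} (hx : x ∈ F.cat.verts) (h : x.1 < F.N + 2) :
    (∃ k < F.N, x = (k, 0)) ∨ (∃ k < F.N, x = (k, 1)) ∨ (∃ i < F.n, x = (F.N₀ + i, 2)) ∨
    (∃ i < F.n, x = (F.N₀ + i, 3)) ∨ x = (F.N, 0) ∨ x = (F.N + 1, 0) := by
  obtain ⟨k, i⟩ := x
  rw [mem_cat] at hx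
  simp only at h
  have := F.N_eq
  rcases Nat.eq_zero_or_pos i with rfl | hi
  · have h' : k < F.N ∨ k = F.N ∨ k = F.N + 1 := by omega
    rcases h' with h' | rfl | rfl
    · exact .inl ⟨k, h', rfl⟩
    · simp
    · simp
  have h2 := hx.2
  rcases F.spine_cases hx.1 with h | ⟨j, hj, rfl⟩ | rfl | rfl | rfl | ⟨j, hj, rfl⟩ | ⟨c, hc, rfl⟩ |
    ⟨c, hc, rfl⟩
  · rw [F.node_pre h] at h2
    simp only [Node.p] at h2
    exact .inr (.inl ⟨k, by omega, by simp; omega⟩)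
  · rw [F.node_birth hj] at h2
    simp only [Node.p] at h2
    have h' : i = 1 ∨ i = 2 ∨ i = 3 := by omega
    rcases h' with rfl | rfl | rfl
    · exact .inr (.inl ⟨_, by omega, rfl⟩)
    · exact .inr (.inr (.inl ⟨j, hj, rfl⟩))
    · exact .inr (.inr (.inr (.inl ⟨j, hj, rfl⟩)))
  · rw [node_low] at h2; simp only [Node.p] at h2; omega
  · rw [node_up] at h2; simp only [Node.p] at h2; omega
  · omega
  · omega
  · unfold Z at h; omega
  · unfold Z at h; omega

lemma upper_of_le {x : ℕ × ℕ} (hx : x ∈ F.cat.verts) (h : F.N + 2 ≤ x.1) : x ∈ F.upper := by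
  simp [upper, hx, h]

lemma p_pos {k : ℕ} (h : k < F.N) : 1 ≤ (F.node k).p := by
  by_cases h1 : k < F.N₀
  · rw [F.node_pre h1]; rfl
  · obtain ⟨i, rfl⟩ := Nat.exists_eq_add_of_le (not_lt.1 h1)
    rw [F.node_birth (by unfold N at h; omega)]; simp [Node.p]

lemma spine_mem_verts {k : ℕ} (h : k < F.M) : (k, 0) ∈ F.cat.verts := by rw [mem_cat]; omega

lemma N_add_two_lt_M : F.N + 2 < F.M := by unfold M Z; omega

/-- Only `ρ 0` has to preserve the numbers below `n`, since its values are used directly as indices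
of pairs; the other permutations enter through ranks only. -/
lemma height_lower_lt (hρ : ∀ c < F.n, ρ 0 c < F.n) {x : ℕ × ℕ} (hx : x ∈ F.cat.verts)
    (h : x.1 < F.N + 2) : F.height ρ x < 2 * F.numPairs := by
  have hN := F.N_eq
  unfold numPairs
  rcases F.lower_cases hx h with ⟨k, hk, rfl⟩ | ⟨k, hk, rfl⟩ | ⟨i, hi, rfl⟩ | ⟨i, hi, rfl⟩ | rfl | rfl
  · rw [F.height_zero hk]; split_ifs <;> omega
  · rw [F.height_one hk]; split_ifs <;> omega
  · rw [F.height_two hi]; have := hρ i hi; omega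
  · rw [F.height_three hi]; have := hρ i hi; omega
  · rw [height_low]; omega
  · rw [height_up]; omega

lemma height_injOn (hρ : ∀ c < F.n, ρ 0 c < F.n) : Set.InjOn (F.height ρ) F.cat.verts := by
  intro x hx y hy h
  by_cases hx1 : x.1 < F.N + 2 <;> by_cases hy1 : y.1 < F.N + 2
  · rcases F.lower_cases hx hx1 with ⟨k, hk, rfl⟩ | ⟨k, hk, rfl⟩ | ⟨i, hi, rfl⟩ | ⟨i, hi, rfl⟩ | rfl | rfl <;>
    rcases F.lower_cases hy hy1 with ⟨k', hk', rfl⟩ | ⟨k', hk', rfl⟩ | ⟨i', hi', rfl⟩ | ⟨i', hi', rfl⟩ |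
      rfl | rfl <;>
    simp only [*, height_zero, height_one, height_two, height_three, height_low, height_up] at h <;>
    have hN := F.N_eq <;>
    first
    | rfl
    | (have : k = k' := by split_ifs at h <;> omega
       subst this
       first
       | rfl
       | (exfalso; split_ifs at h <;> omega))
    | (exfalso; omega)
    | (have : ρ 0 i = ρ 0 i' := by omega
       rw [(ρ 0).injective this])
    | (have := hρ i hi; exfalso; split_ifs at h <;> omega)
    | (have := hρ i' hi'; exfalso; split_ifs at h <;> omega)
  · have h1 := F.height_lower_lt hρ hx hx1
    have h2 := F.height_upper (ρ := ρ) (F.upper_of_le hy (not_lt.1 hy1))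
    omega
  · have h1 := F.height_lower_lt hρ hy hy1
    have h2 := F.height_upper (ρ := ρ) (F.upper_of_le hx (not_lt.1 hx1))
    omega
  · have hx2 := F.upper_of_le hx (not_lt.1 hx1)
    have hy2 := F.upper_of_le hy (not_lt.1 hy1)
    rw [F.height_upper hx2, F.height_upper hy2] at h
    exact rankIn_injOn (F.key_injOn ρ) hx2 hy2 (by omega)

lemma exists_lower (hρ : ∀ c < F.n, ρ 0 c < F.n) {b : ℕ} (hb : b < F.numPairs) (r : ℕ) (hr : r < 2) :
    ∃ x ∈ F.cat.verts, x.1 < F.N + 2 ∧ F.height ρ x = 2 * b + r := by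
  have hN := F.N_eq
  have hM : F.N + 2 < F.M := F.N_add_two_lt_M
  unfold numPairs at hb
  have hr' : r = 0 ∨ r = 1 := by omega
  rcases Nat.eq_zero_or_pos b with rfl | hb0
  · rcases hr' with rfl | rfl
    · exact ⟨(F.N, 0), F.spine_mem_verts (by omega), by simp, by rw [height_low]⟩
    · exact ⟨(F.N + 1, 0), F.spine_mem_verts (by omega), by simp, by rw [height_up]⟩
  by_cases h : b ≤ F.n
  · have hsurj : Set.SurjOn (ρ 0) (Finset.range F.n) (Finset.range F.n) :=
      Finset.surjOn_of_injOn_of_card_le _ (fun c hc => by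
        simp at hc ⊢; exact hρ c hc) (ρ 0).injective.injOn le_rfl
    obtain ⟨i, hi, hib⟩ := hsurj (show b - 1 ∈ (Finset.range F.n : Set ℕ) by simp; omega)
    have hi' : i < F.n := by simpa using hi
    have hp : (F.node (F.N₀ + i)).p = 3 := by rw [F.node_birth hi']; rfl
    rcases hr' with rfl | rfl
    · exact ⟨(F.N₀ + i, 3), by rw [mem_cat, hp]; omega, by simp only; omega,
        by rw [F.height_three hi', hib]; omega⟩
    · exact ⟨(F.N₀ + i, 2), by rw [mem_cat, hp]; omega, by simp only; omega,
        by rw [F.height_two hi', hib]; omega⟩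
  · obtain ⟨k, hk, rfl⟩ : ∃ k < F.N, b = F.n + F.N - k := ⟨F.n + F.N - b, by omega, by omega⟩
    have h0 : (k, 0) ∈ F.cat.verts := F.spine_mem_verts (by omega)
    have h1 : (k, 1) ∈ F.cat.verts := by rw [mem_cat]; exact ⟨by omega, F.p_pos hk⟩
    by_cases hv : 0 < (F.node k).val <;> rcases hr' with rfl | rfl
    · exact ⟨(k, 1), h1, by simp only; omega, by rw [F.height_one hk, if_pos hv]⟩
    · exact ⟨(k, 0), h0, by simp only; omega, by rw [F.height_zero hk, if_pos hv]⟩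
    · exact ⟨(k, 0), h0, by simp only; omega, by rw [F.height_zero hk, if_neg hv]⟩
    · exact ⟨(k, 1), h1, by simp only; omega, by rw [F.height_one hk, if_neg hv]⟩

lemma exists_upper {j : ℕ} (hj : j < F.numSimple) :
    ∃ x ∈ F.upper, F.height ρ x = 2 * F.numPairs + j := by
  have : j ∈ F.upper.image (rankIn F.upper (F.key ρ)) := by
    rw [image_rankIn (F.key_injOn ρ)]; exact Finset.mem_range.2 hj
  obtain ⟨x, hx, rfl⟩ := Finset.mem_image.1 this
  exact ⟨x, hx, F.height_upper hx⟩

lemma height_upper_lt {x : ℕ × ℕ} (hx : x ∈ F.upper) :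
    F.height ρ x < 2 * F.numPairs + F.numSimple := by
  rw [F.height_upper hx]; have := rankIn_lt_card (key := F.key ρ) hx; unfold numSimple; omega

lemma height_upper_lt_iff {x y : ℕ × ℕ} (hx : x ∈ F.upper) (hy : y ∈ F.upper) :
    F.height ρ x < F.height ρ y ↔ F.key ρ x < F.key ρ y := by
  rw [F.height_upper hx, F.height_upper hy, add_lt_add_iff_left,
    rankIn_lt_iff hx hy (F.key_injOn ρ)]

lemma height_lt_of_layer {x y : ℕ × ℕ} (hx : x ∈ F.upper) (hy : y ∈ F.upper)
    (h : F.layer x < F.layer y) : F.height ρ x < F.height ρ y :=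
  (F.height_upper_lt_iff hx hy).2 (F.key_lt h)

/-- The peak is alone in the highest layer, so no other vertex can have the largest rank. -/
lemma height_peak : F.height ρ (F.N + 2, 0) = 2 * F.numPairs + F.numSimple - 1 := by
  have hM : F.N + 2 < F.M := F.N_add_two_lt_M
  have hp : (F.N + 2, 0) ∈ F.upper := F.upper_of_le (F.spine_mem_verts hM) le_rfl
  have h0 := F.height_upper_lt (ρ := ρ) hp
  have h1 := F.height_upper (ρ := ρ) hp
  obtain ⟨x, hx, hxj⟩ := F.exists_upper (ρ := ρ) (j := F.numSimple - 1) (by omega)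
  by_contra hne
  have hxp : x ≠ (F.N + 2, 0) := by rintro rfl; omega
  have : F.layer x < F.layer (F.N + 2, 0) := by
    rw [layer_peak]
    rcases F.upper_cases hx with rfl | ⟨j, hj, rfl⟩ | ⟨j, hj, rfl, e | e⟩ | ⟨c, hc, i, hi, _, rfl⟩ |
      ⟨c, hc, rfl⟩ | ⟨c, hc, rfl⟩ <;>
    simp only [*, layer_sp, layer_sp_in, layer_sp_out, layer_in, layer_out, layer_out', ne_eq,
      not_true_eq_false] at hxp ⊢ <;> omega
  have := F.height_lt_of_layer (ρ := ρ) hx hp this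
  omega

end Config

/-! ### Numbers of vertices, weights of ends, and the type of the covers -/

namespace TropicalCover

variable (C : TropicalCover)

lemma sum_card_filter_eq_some {E V : Type*} [Fintype E] [Fintype V] [DecidableEq V] (f : E → Option V) :
    ∑ v : V, (Finset.univ.filter fun e => f e = some v).card =
      (Finset.univ.filter fun e => f e ≠ none).card := by
  simp only [Finset.card_filter]
  rw [Finset.sum_comm]
  refine Finset.sum_congr rfl fun e _ => ?_
  cases h : f e <;> simp

/-- Incidences of edges with inner vertices, counted in two ways: an inner edge has two of them, an
end has one. -/
lemma three_mul_card_vert : 3 * Fintype.card C.Vert = 2 * Nat.card {e // C.IsInner e} +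
    (Finset.univ.filter fun e => C.src e = none).card +
    (Finset.univ.filter fun e => C.tgt e = none).card := by
  classical
  have h : ∑ v : C.Vert, ((Finset.univ.filter fun e => C.src e = some v).card +
      (Finset.univ.filter fun e => C.tgt e = some v).card) = 3 * Fintype.card C.Vert := by
    rw [Finset.sum_congr rfl fun v _ => C.trivalent v]; simp [mul_comm]
  rw [← h, Finset.sum_add_distrib, sum_card_filter_eq_some, sum_card_filter_eq_some,
    Nat.card_eq_fintype_card, Fintype.card_subtype]
  simp only [Finset.card_filter, Finset.mul_sum]
  rw [← Finset.sum_add_distrib, ← Finset.sum_add_distrib, ← Finset.sum_add_distrib]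
  refine Finset.sum_congr rfl fun e _ => ?_
  have := C.src_or_tgt e
  by_cases h1 : C.src e = none <;> by_cases h2 : C.tgt e = none <;> simp_all [IsInner]

lemma card_edge : Fintype.card C.Edge = Nat.card {e // C.IsInner e} +
    (Finset.univ.filter fun e => C.src e = none).card +
    (Finset.univ.filter fun e => C.tgt e = none).card := by
  classical
  rw [Nat.card_eq_fintype_card, Fintype.card_subtype, ← Finset.card_univ, Finset.card_eq_sum_ones]
  simp only [Finset.card_filter]
  rw [← Finset.sum_add_distrib, ← Finset.sum_add_distrib]
  refine Finset.sum_congr rfl fun e _ => ?_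
  have := C.src_or_tgt e
  by_cases h1 : C.src e = none <;> by_cases h2 : C.tgt e = none <;> simp_all [IsInner]

end TropicalCover

/-- Written as a sum over edges, a multiset of weights of ends splits into the contributions of the
spine and of the pendants. -/
lemma map_val_filter {E : Type*} [Fintype E] (P : E → Prop) [DecidablePred P] (f : E → ℕ) :
    (Finset.univ.filter P).val.map f = ∑ e : E, if P e then ({f e} : Multiset ℕ) else 0 := by
  rw [← Finset.sum_filter, Finset.sum, ← Multiset.sum_map_singleton ((Finset.univ.filter P).val.map f),
    Multiset.map_map]
  rfl

namespace PointDistribution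

variable {s t : ℕ} {w : ℕ → ℝ} {hw : StrictMono w}

lemma trivial_x (i : Fin s) : (trivial s t w hw).x i = (w (2 * i), w (2 * i + 1)) := rfl

lemma pairPoints_trivial : (trivial s t w hw).pairPoints = w '' {j | j < 2 * s} := by
  ext r
  simp only [pairPoints, Set.mem_union, Set.mem_range, trivial_x, Set.mem_image, Set.mem_ofPred_eq]
  constructor
  · rintro (⟨i, rfl⟩ | ⟨i, rfl⟩)
    · exact ⟨_, by have := i.2; omega, rfl⟩
    · exact ⟨_, by have := i.2; omega, rfl⟩
  · rintro ⟨j, hj, rfl⟩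
    rcases Nat.mod_two_eq_zero_or_one j with h | h
    · exact .inl ⟨⟨j / 2, by omega⟩, congrArg w (by simp only; omega)⟩
    · exact .inr ⟨⟨j / 2, by omega⟩, congrArg w (by simp only; omega)⟩

lemma simplePoints_trivial :
    (trivial s t w hw).simplePoints = w '' {j | 2 * s ≤ j ∧ j < 2 * s + t} := by
  ext r
  simp only [simplePoints, Set.mem_range, Set.mem_image, Set.mem_ofPred_eq]
  constructor
  · rintro ⟨i, rfl⟩; exact ⟨2 * s + i, by have := i.2; omega, rfl⟩
  · rintro ⟨j, hj, rfl⟩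
    exact ⟨⟨j - 2 * s, by omega⟩, congrArg w (by simp only; omega)⟩

lemma points_trivial : (trivial s t w hw).points = w '' {j | j < 2 * s + t} := by
  rw [points, pairPoints_trivial, simplePoints_trivial, ← Set.image_union]
  congr 1; ext j; simp; omega

end PointDistribution

namespace Node

/-- The weights of the ends of a pendant which are directed to the spine (`σ = 1`) or away from
it (`σ = -1`). -/
def ends (σ : ℤ) (N : Node) : Multiset ℕ := ∑ i ∈ Finset.range (N.p + 1),
  ((if i = N.p ∧ 0 < σ * N.fm i then {(N.fm i).natAbs} else 0) +
    (if N.hasSec i ∧ (N.link i = false ∨ i = N.p) ∧ 0 < σ * N.fs i then {(N.fs i).natAbs} else 0))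

lemma ends_leaf (σ x : ℤ) : (leaf x).ends σ = if 0 < σ * x then {x.natAbs} else 0 := by
  simp [ends, p, fm, hasSec]

lemma ends_exch (σ a b : ℤ) : (exch a b).ends σ =
    (if 0 < σ * a then {a.natAbs} else 0) + (if 0 < σ * b then {b.natAbs} else 0) := by
  simp [ends, p, fm, hasSec, fs, link, Finset.sum_range_succ]

lemma ends_birth_in : birth.ends 1 = {1} + {1} + {1} := by
  simp [ends, p, fm, hasSec, fs, link, Finset.sum_range_succ]

lemma ends_birth_out : birth.ends (-1) = {1} := by
  simp [ends, p, fm, hasSec, fs, link, Finset.sum_range_succ]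

lemma ends_tail (σ x : ℤ) (j : ℕ) : (tail x j).ends σ =
    if 0 < σ * x then {x.natAbs} + {x.natAbs} else 0 := by
  have h : (2 * j + 1) % 2 = 1 := by omega
  rw [ends, Finset.sum_eq_single (2 * j + 1)]
  · simp only [p, fm, hasSec, fs, link, h]
    split_ifs <;> simp_all
  · intro i _ hi
    simp [p, link, hi]
  · intro h; simp [p] at h

end Node

namespace Config

variable (F : Config) {ρ : ℕ → Equiv.Perm ℕ}

lemma sum_zigzag {A : Type*} [AddCommMonoid A] (g : ℕ → A) (u v : ℕ) (h : u = v ∨ u = v + 1) :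
    ∑ j ∈ Finset.range (u + v), g j =
      ∑ c ∈ Finset.range u, g (2 * c) + ∑ c ∈ Finset.range v, g (2 * c + 1) := by
  have key : ∀ v, ∑ j ∈ Finset.range (v + v), g j =
      ∑ c ∈ Finset.range v, g (2 * c) + ∑ c ∈ Finset.range v, g (2 * c + 1) := by
    intro v
    induction v with
    | zero => simp
    | succ v ih =>
      rw [show v + 1 + (v + 1) = v + v + 1 + 1 by ring, Finset.sum_range_succ, Finset.sum_range_succ, ih,
        Finset.sum_range_succ, Finset.sum_range_succ, ← two_mul]
      abel
  rcases h with rfl | rfl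
  · exact key u
  · rw [show v + 1 + v = v + v + 1 by ring, Finset.sum_range_succ, key, Finset.sum_range_succ, ← two_mul]
    abel

lemma sum_upper {A : Type*} [AddCommMonoid A] (f : Node → A) :
    ∑ j ∈ Finset.range (1 + F.K + (F.u + F.v)), f (F.node (F.N + 2 + j)) =
      f (.leaf (-F.e)) + ∑ j ∈ Finset.range F.K, f (F.sp j) +
      (∑ c ∈ Finset.range F.u, f (.tail 1 (F.J c)) + F.v • f (.tail (-1) 0)) := by
  rw [Finset.sum_range_add, Finset.sum_range_add]
  have hZ := F.Z_eq
  congr 1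
  · congr 1
    · simp [node_peak]
    · refine Finset.sum_congr rfl fun j hj => ?_
      rw [← F.node_sp (Finset.mem_range.1 hj)]; congr 2; omega
  · rw [sum_zigzag _ _ _ F.u_eq]
    congr 1
    · refine Finset.sum_congr rfl fun c hc => ?_
      rw [← F.node_in]; congr 2; omega
    · rw [Finset.sum_congr rfl (g := fun _ => f (.tail (-1) 0)) fun c hc => ?_]
      · simp
      · rw [← F.node_out c]; congr 2; omega

lemma sum_lower {A : Type*} [AddCommMonoid A] (f : Node → A) :
    ∑ j ∈ Finset.range (F.N + 2), f (F.node j) =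
      ∑ k ∈ Finset.range F.N₀, f (.exch (F.pre k).1 (F.pre k).2) + F.n • f .birth +
        (f (.leaf F.o) + f (.leaf F.o)) := by
  rw [Finset.sum_range_succ, Finset.sum_range_succ, add_assoc, node_low, node_up, N, Finset.sum_range_add]
  congr 2
  · refine Finset.sum_congr rfl fun j hj => ?_
    rw [F.node_pre (Finset.mem_range.1 hj)]
  · rw [Finset.sum_congr rfl (g := fun _ => f .birth) fun c hc => ?_]
    · simp
    · rw [F.node_birth (Finset.mem_range.1 hc)]

lemma sum_node {A : Type*} [AddCommMonoid A] (f : Node → A) :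
    ∑ j ∈ Finset.range F.M, f (F.node j) =
      ∑ k ∈ Finset.range F.N₀, f (.exch (F.pre k).1 (F.pre k).2) + F.n • f .birth +
        (f (.leaf F.o) + f (.leaf F.o)) + (f (.leaf (-F.e)) + ∑ j ∈ Finset.range F.K, f (F.sp j) +
      (∑ c ∈ Finset.range F.u, f (.tail 1 (F.J c)) + F.v • f (.tail (-1) 0))) := by
  rw [show F.M = F.N + 2 + (1 + F.K + (F.u + F.v)) by unfold M Z; omega, Finset.sum_range_add,
    sum_lower, sum_upper]

lemma numSimple_eq : F.numSimple = 1 + ∑ j ∈ Finset.range F.K, ((F.sp j).p + 1) +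
    (∑ c ∈ Finset.range F.u, (2 * F.J c + 2) + F.v * 2) := by
  have h : F.numSimple = ∑ k ∈ Finset.range F.M, if F.N + 2 ≤ k then (F.node k).p + 1 else 0 := by
    rw [numSimple, upper, Finset.card_filter, Caterpillar.sum_verts]
    refine Finset.sum_congr rfl fun k _ => ?_
    split_ifs <;> simp
  rw [h, show F.M = F.N + 2 + (1 + F.K + (F.u + F.v)) by unfold M Z; omega, Finset.sum_range_add,
    Finset.sum_eq_zero, zero_add]
  · have := F.sum_upper (fun N => N.p + 1)
    rw [Finset.sum_congr rfl fun j _ => if_pos (by omega)]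
    exact this
  · intro k hk
    rw [if_neg]; simp at hk; omega

/-- The heights follow the signs of `s`: they descend along the spine over the pairs, ascend through
pair 0 to the peak, descend to the zigzag, and alternate there between the layers `T` and `T + 1`.
-/
lemma spine_height {k : ℕ} (h : k + 1 < F.M) :
    (0 < F.s (k + 1) → F.height ρ (k, 0) < F.height ρ (k + 1, 0)) ∧
    (F.s (k + 1) < 0 → F.height ρ (k + 1, 0) < F.height ρ (k, 0)) := by
  have hN := F.N_eq
  have hZ := F.Z_eq
  have hM := F.M_eq
  have hmem : ∀ j, F.N + 2 ≤ j → j ≤ k + 1 → (j, 0) ∈ F.upper := fun j hj hj' =>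
    F.upper_of_le (F.spine_mem_verts (by omega)) hj
  have hu := F.u_eq
  rcases F.s_cases h.le with h1 | h1 | h1 | ⟨j, hj, h1⟩ | ⟨c, hc, h1⟩ | ⟨c, hc, h1⟩
  · refine ⟨fun h2 => absurd (F.s_neg h1) h2.le.not_gt, fun _ => ?_⟩
    rw [F.height_zero (by omega : k < F.N)]
    by_cases h3 : k + 1 = F.N
    · rw [h3, height_low]; omega
    · rw [F.height_zero (by omega)]; split_ifs <;> omega
  · have : k = F.N := by omega
    subst this
    refine ⟨fun _ => by rw [height_low, height_up]; omega, fun h2 => ?_⟩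
    rw [s_up] at h2; have := F.o_ge; omega
  · have : k = F.N + 1 := by omega
    subst this
    refine ⟨fun _ => ?_, fun h2 => ?_⟩
    · rw [height_up, F.height_upper (hmem _ (by omega) le_rfl)]; unfold numPairs; omega
    · rw [s_char] at h2; have := F.o_ge; omega
  · refine ⟨fun h2 => absurd (F.s_sp_neg hj) (by rw [← h1]; exact h2.le.not_gt), fun _ => ?_⟩
    refine F.height_lt_of_layer (hmem _ (by omega) le_rfl) (hmem _ (by omega) (by omega)) ?_
    have h3 : F.layer (k + 1, 0) ≤ F.T + 2 + 3 * (F.K - j) + 1 := by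
      rcases hj.lt_or_eq with h3 | rfl
      · rw [h1, F.layer_sp h3]
      · rw [h1, ← hZ]; have := F.layer_in 0 0; simp only [mul_zero, add_zero] at this; omega
    rcases Nat.eq_zero_or_pos j with rfl | hj0
    · have h4 : F.layer (k, 0) = F.T + 3 * F.K + 7 := by
        rw [show k = F.N + 2 by omega]; exact F.layer_peak
      omega
    · have h4 : F.layer (k, 0) = F.T + 2 + 3 * (F.K - (j - 1)) + 1 := by
        rw [show k = F.N + 3 + (j - 1) by omega]; exact F.layer_sp (by omega)
      omega
  · have h2 : k = F.Z + 2 * c := by omega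
    subst h2
    refine ⟨fun _ => F.height_lt_of_layer (hmem _ (by omega) (by omega)) (hmem _ (by omega) le_rfl) ?_,
      fun h3 => ?_⟩
    · rw [layer_in, layer_out]; omega
    · rw [(F.s_in c).2] at h3; omega
  · have h2 : k = F.Z + 2 * c + 1 := by omega
    subst h2
    refine ⟨fun h3 => ?_, fun _ => F.height_lt_of_layer (hmem _ (by omega) le_rfl)
      (hmem _ (by omega) (by omega)) ?_⟩
    · have := (F.s_in (c + 1)).1
      rw [show F.Z + 2 * c + 1 + 1 = F.Z + 2 * (c + 1) by ring] at h3; omega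
    · rw [show F.Z + 2 * c + 1 + 1 = F.Z + 2 * (c + 1) by ring, layer_in, layer_out]; omega

/-- In an inward pendant heights fall with the level, in an outward one they rise. A birth flows to
the spine, and its outer pair has index at most `n`, hence lies below its pair at the spine. -/
lemma pendant_height (hρ : ∀ c < F.n, ρ 0 c < F.n) {k i : ℕ} (h : k < F.M) (hi : i < (F.node k).p) :
    (0 < (F.node k).fm i → F.height ρ (k, i + 1) < F.height ρ (k, i)) ∧
    ((F.node k).fm i < 0 → F.height ρ (k, i) < F.height ρ (k, i + 1)) := by
  have hN := F.N_eq
  have hZ := F.Z_eq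
  have base : k < F.N → i = 0 → (0 < (F.node k).fm i → F.height ρ (k, i + 1) < F.height ρ (k, i)) ∧
    ((F.node k).fm i < 0 → F.height ρ (k, i) < F.height ρ (k, i + 1)) := by
    rintro hk rfl
    rw [zero_add, F.height_zero hk, F.height_one hk]
    unfold Node.val
    constructor <;> intro h <;> split_ifs <;> omega
  have hmem : F.N + 2 ≤ k → ∀ j ≤ (F.node k).p, (k, j) ∈ F.upper := fun hk j hj =>
    F.upper_of_le (by rw [mem_cat]; exact ⟨h, hj⟩) hk
  rcases F.spine_cases h with h | ⟨j, hj, rfl⟩ | rfl | rfl | rfl | ⟨j, hj, rfl⟩ | ⟨c, hc, rfl⟩ |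
    ⟨c, hc, rfl⟩
  · refine base (by omega) ?_
    rw [F.node_pre h] at hi; simp only [Node.p] at hi; omega
  · have hr := hρ j hj
    have hp := hi
    rw [F.node_birth hj] at hp; simp only [Node.p] at hp
    have h3 : i = 0 ∨ i = 1 ∨ i = 2 := by omega
    rcases h3 with rfl | rfl | rfl
    · exact base (by omega) rfl
    · rw [F.height_two hj, F.height_one (by omega), F.node_birth hj]
      simp only [Node.val, Node.fm]
      exact ⟨fun _ => by split_ifs <;> omega, fun h => by omega⟩
    · rw [F.height_two hj, F.height_three hj, F.node_birth hj]
      simp only [Node.fm]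
      exact ⟨fun _ => by omega, fun h => by omega⟩
  · rw [node_low] at hi; simp [Node.p] at hi
  · rw [node_up] at hi; simp [Node.p] at hi
  · rw [node_peak] at hi; simp [Node.p] at hi
  · have h1 := hmem (by omega) i hi.le
    have h2 := hmem (by omega) (i + 1) hi
    have hp := hi
    rw [F.node_sp hj] at hp ⊢
    rcases F.sp_ok j hj with ⟨x, h, _⟩ | h | h <;> rw [h] at hp ⊢ <;> simp only [Node.p] at hp
    · omega
    · obtain rfl : i = 0 := by omega
      simp only [Node.fm]
      refine ⟨fun _ => F.height_lt_of_layer h2 h1 ?_, fun h => by simp at h⟩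
      rw [F.layer_sp hj, F.layer_sp_in hj h]; omega
    · obtain rfl : i = 0 := by omega
      simp only [Node.fm]
      refine ⟨fun h => by simp at h, fun _ => F.height_lt_of_layer h1 h2 ?_⟩
      rw [F.layer_sp hj, F.layer_sp_out hj h]; omega
  · have h1 := hmem (by omega) i hi.le
    have h2 := hmem (by omega) (i + 1) hi
    rw [node_in] at hi ⊢
    simp only [Node.p] at hi
    have := F.J_le c
    refine ⟨fun _ => F.height_lt_of_layer h2 h1 ?_, fun h => ?_⟩
    · rw [layer_in, layer_in]; unfold T; omega
    · simp only [Node.fm] at h; split_ifs at h <;> omega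
  · have h1 := hmem (by omega) i hi.le
    have h2 := hmem (by omega) (i + 1) hi
    rw [node_out] at hi ⊢
    simp only [Node.p] at hi
    obtain rfl : i = 0 := by omega
    simp only [Node.fm]
    refine ⟨fun h => by simp at h, fun _ => F.height_lt_of_layer h1 h2 ?_⟩
    rw [layer_out, layer_out']; omega

/-- A secondary edge that is not an end is parallel to a main edge and has the same direction, so
`pendant_height` covers it too. -/
lemma fs_pos_iff {N : Node} {i : ℕ} (h : N.link i) : (0 < N.fs i ↔ 0 < N.fm i) := by
  cases N with
  | tail x j => simp only [Node.fs, Node.fm]; split_ifs <;> omega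
  | _ => simp [Node.link] at h

lemma height_src_lt_tgt (hρ : ∀ c < F.n, ρ 0 c < F.n) (e : F.cat.Edge) (a b : F.cat.Vert)
    (ha : F.cat.src e = some a) (hb : F.cat.tgt e = some b) : F.height ρ a.1 < F.height ρ b.1 := by
  obtain ⟨c, hc⟩ := e
  have hne := F.cat.flow_ne hc
  suffices h : ∀ x y : F.cat.Vert, F.cat.near ⟨c, hc⟩ = some x → F.cat.far ⟨c, hc⟩ = some y →
      (0 < F.cat.flow c → F.height ρ y.1 < F.height ρ x.1) ∧
      (F.cat.flow c < 0 → F.height ρ x.1 < F.height ρ y.1) by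
    simp only [Caterpillar.src, Caterpillar.tgt] at ha hb
    split_ifs at ha hb with h0
    · exact (h b a hb ha).1 h0
    · exact (h a b ha hb).2 (by omega)
  intro x y hx hy
  rw [Caterpillar.near_eq_some] at hx
  rw [Caterpillar.far_eq_some] at hy
  rw [← hx]
  have hx2 := x.2
  rw [← hx] at hx2
  have hy2 := y.2
  rcases c with (_ | k) | ⟨k, i⟩ | ⟨k, i⟩
  · simp [Caterpillar.farCode] at hy
  · simp only [Caterpillar.farCode, Option.some.injEq] at hy
    rw [← hy]
    exact F.spine_height (F.mem_cat.1 hx2).1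
  · simp only [Caterpillar.farCode, Option.some.injEq] at hy
    rw [← hy] at hy2 ⊢
    exact F.pendant_height hρ (F.mem_cat.1 hx2).1 (F.mem_cat.1 hy2).2
  · simp only [Caterpillar.farCode] at hy
    split_ifs at hy with hl
    simp only [Option.some.injEq] at hy
    rw [← hy] at hy2 ⊢
    have h := F.pendant_height hρ (F.mem_cat.1 hx2).1 (F.mem_cat.1 hy2).2
    have h1 := fs_pos_iff (N := F.node k) (i := i) hl
    have h2 := Node.fm_ne (F.node_valid (F.mem_cat.1 hx2).1) (F.mem_cat.1 hx2).2
    rw [flow_sec] at hne ⊢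
    exact ⟨fun h3 => h.1 (h1.1 h3), fun h3 => h.2 (by omega)⟩

/-- The tropical cover defined by the data and by permutations of the layers. -/
noncomputable def cover (ρ : ℕ → Equiv.Perm ℕ) (hρ : ∀ c < F.n, ρ 0 c < F.n) (w : ℕ → ℝ)
    (hw : StrictMono w) : TropicalCover :=
  F.cat.cover (fun x => w (F.height ρ x.1))
    (fun e a b ha hb => hw (F.height_src_lt_tgt hρ e a b ha hb))

end Config

namespace Config

variable (F : Config) {ρ : ℕ → Equiv.Perm ℕ}

lemma near_ne_none_main (x : ℕ × ℕ) (h : main x ∈ F.cat.edges) : F.cat.near ⟨main x, h⟩ ≠ none := by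
  simpa [Caterpillar.near, Caterpillar.nearCode] using h

lemma near_ne_none_sec (x : ℕ × ℕ) (h : sec x ∈ F.cat.edges) : F.cat.near ⟨sec x, h⟩ ≠ none := by
  simpa [Caterpillar.near, Caterpillar.nearCode] using (F.cat.sec_mem.1 h).1

lemma near_spine_eq_none {k : ℕ} (h : spine k ∈ F.cat.edges) :
    F.cat.near ⟨spine k, h⟩ = none ↔ k = F.M := by
  have := F.cat.spine_mem.1 h
  simp only [cat_M] at this
  simp [Caterpillar.near, Caterpillar.nearCode]; omega

lemma far_spine_eq_none {k : ℕ} (h : spine k ∈ F.cat.edges) :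
    F.cat.far ⟨spine k, h⟩ = none ↔ k = 0 := by
  have := F.cat.spine_mem.1 h
  simp only [cat_M] at this
  rcases k with _ | k
  · simp [Caterpillar.far, Caterpillar.farCode]
  · simp [Caterpillar.far, Caterpillar.farCode]; omega

lemma far_main_eq_none {k i : ℕ} (h : main (k, i) ∈ F.cat.edges) :
    F.cat.far ⟨main (k, i), h⟩ = none ↔ i = (F.node k).p := by
  have := F.mem_cat.1 (F.cat.main_mem.1 h)
  simp [Caterpillar.far, Caterpillar.farCode]; omega

lemma far_sec_eq_none {k i : ℕ} (h : sec (k, i) ∈ F.cat.edges) :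
    F.cat.far ⟨sec (k, i), h⟩ = none ↔ (F.node k).link i = false ∨ i = (F.node k).p := by
  have := F.mem_cat.1 (F.cat.sec_mem.1 h).1
  have hl : F.cat.link (k, i) = (F.node k).link i := rfl
  simp only [Caterpillar.far, Caterpillar.farCode, hl]
  cases (F.node k).link i <;> simp
  omega

/-- The start of an edge if `σ = 1`, its end if `σ = -1`. -/
def back (σ : ℤ) (e : F.cat.Edge) : Option F.cat.Vert :=
  if 0 < σ * F.cat.flow e.1 then F.cat.far e else F.cat.near e

lemma src_eq_back (e : F.cat.Edge) : F.cat.src e = F.back 1 e := by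
  simp [Caterpillar.src, back]

lemma tgt_eq_back (e : F.cat.Edge) : F.cat.tgt e = F.back (-1) e := by
  have := F.cat.flow_ne e.2
  simp only [Caterpillar.tgt, back]
  split_ifs <;> first | rfl | omega

lemma s_M : F.s F.M = if F.u = F.v then -1 else 1 := by
  have := F.u_eq
  split_ifs with h
  · rw [F.M_eq, h, ← two_mul, (F.s_in _).1]
  · rw [F.M_eq, show F.u = F.v + 1 by omega, show F.Z + (F.v + 1 + F.v) = F.Z + 2 * F.v + 1 by ring,
      (F.s_in _).2]

/-- The ends of the spine. -/
def spineEnds (σ : ℤ) : Multiset ℕ :=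
  (if σ < 0 then {1} else 0) + (if (σ < 0 ∧ F.u ≠ F.v) ∨ (0 < σ ∧ F.u = F.v) then {1} else 0)

/-- The weights of all ends. -/
def ends (σ : ℤ) : Multiset ℕ :=
  F.spineEnds σ + ∑ k ∈ Finset.range F.M, (F.node k).ends σ

/-- The sign `σ` treats inward and outward ends in one computation. -/
lemma map_back_eq_none {σ : ℤ} (hσ : σ = 1 ∨ σ = -1) :
    (Finset.univ.filter fun e => F.back σ e = none).val.map (fun e => (F.cat.flow e.1).natAbs) =
      F.ends σ := by
  have hM := F.M_pos
  -- Extension by 0 to all codes, so that `sum_edges` applies.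
  set g : EdgeCode → Multiset ℕ := fun c =>
    if h : c ∈ F.cat.edges then if F.back σ ⟨c, h⟩ = none then {(F.cat.flow c).natAbs} else 0 else 0
    with hg
  have h1 : ∀ e : F.cat.Edge, (if F.back σ e = none then ({(F.cat.flow e.1).natAbs} : Multiset ℕ) else 0)
      = g e.1 := fun e => by simp only [hg, e.2, dif_pos]
  rw [map_val_filter, Finset.sum_congr rfl fun e _ => h1 e, Finset.sum_coe_sort, Caterpillar.sum_edges,
    ends]
  congr 1
  · have hs : ∀ k ≤ F.M, g (spine k) = if (k = 0 ∧ 0 < σ * F.s k) ∨ (k = F.M ∧ ¬ 0 < σ * F.s k) then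
        {(F.s k).natAbs} else 0 := by
      intro k hk
      have hk' : spine k ∈ F.cat.edges := by simpa using hk
      simp only [hg, hk', dif_pos, back, flow_spine]
      refine if_congr ?_ rfl rfl
      by_cases hp : 0 < σ * F.s k
      · simp [hp, far_spine_eq_none]
      · simp [hp, near_spine_eq_none]
    rw [Finset.sum_congr rfl fun k hk => hs k (by simp at hk; omega), cat_M, Finset.sum_range_succ,
      Finset.sum_eq_single 0]
    · simp only [s_zero, s_M, spineEnds]
      have := F.u_eq
      rcases hσ with rfl | rfl <;> by_cases h : F.u = F.v <;> simp [h, hM.ne, hM.ne']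
    · intro k hk hk0
      rw [if_neg]
      simp only [Finset.mem_range] at hk
      omega
    · intro h; simp at h; omega
  · rw [← Finset.sum_add_distrib, Caterpillar.sum_verts]
    refine Finset.sum_congr rfl fun k hk => ?_
    rw [Node.ends]
    refine Finset.sum_congr rfl fun i hi => ?_
    simp only [Finset.mem_range] at hk hi
    have hv : (k, i) ∈ F.cat.verts := by rw [mem_cat]; omega
    congr 1
    · have hk' : main (k, i) ∈ F.cat.edges := by rw [Caterpillar.main_mem]; exact hv
      simp only [hg, hk', dif_pos, back, flow_main]
      refine if_congr ?_ rfl rfl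
      by_cases hp : 0 < σ * (F.node k).fm i
      · simp [hp, far_main_eq_none]
      · simp [hp, near_ne_none_main]
    · have hS : F.cat.hasSec (k, i) = (F.node k).hasSec i := rfl
      by_cases hs : F.cat.hasSec (k, i)
      · have hk' : sec (k, i) ∈ F.cat.edges := by rw [Caterpillar.sec_mem]; exact ⟨hv, hs⟩
        simp only [hg, hk', dif_pos, back, flow_sec, hs, if_true]
        refine if_congr ?_ rfl rfl
        rw [hS] at hs
        by_cases hp : 0 < σ * (F.node k).fs i
        · simp [hp, far_sec_eq_none, hs]
        · simp [hp, near_ne_none_sec]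
      · rw [if_neg hs, if_neg]
        rw [← hS]; exact fun h => hs h.1

/-- Together with injectivity, this says that heights number the vertices consecutively; it yields
both the image of the vertices and their number. -/
lemma card_verts (hρ : ∀ c < F.n, ρ 0 c < F.n) :
    F.cat.verts.image (F.height ρ) = Finset.range (2 * F.numPairs + F.numSimple) := by
  ext j
  simp only [Finset.mem_image, Finset.mem_range]
  constructor
  · rintro ⟨x, hx, rfl⟩
    by_cases h : x.1 < F.N + 2
    · have := F.height_lower_lt hρ hx h; omega
    · exact F.height_upper_lt (F.upper_of_le hx (not_lt.1 h))
  · intro hj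
    by_cases h : j < 2 * F.numPairs
    · obtain ⟨x, hx, _, h'⟩ := F.exists_lower hρ (b := j / 2) (by omega) (j % 2) (by omega)
      exact ⟨x, hx, by omega⟩
    · obtain ⟨x, hx, h'⟩ := F.exists_upper (ρ := ρ) (j := j - 2 * F.numPairs) (by omega)
      exact ⟨x, Finset.filter_subset _ _ hx, by omega⟩

/-- Cycles are not counted: `hg` is the relation between vertices, ends and genus in a trivalent
graph, and the number of vertices is known from the heights. -/
lemma hasType (hρ : ∀ c < F.n, ρ 0 c < F.n) {w : ℕ → ℝ} (hw : StrictMono w) {g : ℕ}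
    {lam mu : Multiset ℕ} {s t : ℕ} (hs : s = F.numPairs) (ht : t = F.numSimple)
    (hlam : F.ends 1 = lam) (hmu : F.ends (-1) = mu)
    (hg : 2 * s + t + 2 = 2 * g + lam.card + mu.card) :
    (F.cover ρ hρ w hw).HasType g lam mu (PointDistribution.trivial s t w hw) := by
  have hin : (Finset.univ.filter fun e => (F.cover ρ hρ w hw).src e = none).val.map
      (F.cover ρ hρ w hw).wt = lam := by
    rw [← hlam, ← F.map_back_eq_none (Or.inl rfl)]
    simp only [← src_eq_back]; rfl
  have hout : (Finset.univ.filter fun e => (F.cover ρ hρ w hw).tgt e = none).val.map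
      (F.cover ρ hρ w hw).wt = mu := by
    rw [← hmu, ← F.map_back_eq_none (Or.inr rfl)]
    simp only [← tgt_eq_back]; rfl
  have hcard : Fintype.card (F.cover ρ hρ w hw).Vert = 2 * s + t := by
    have : F.cat.verts.card = 2 * s + t := by
      rw [← Finset.card_image_of_injOn (F.height_injOn hρ), F.card_verts hρ, Finset.card_range, hs, ht]
    rw [← this, ← Fintype.card_coe]
    exact Fintype.card_congr (Equiv.refl _)
  refine ⟨?_, ?_, hin, hout⟩
  · have h3 := (F.cover ρ hρ w hw).three_mul_card_vert
    have h1 := congrArg Multiset.card hin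
    have h2 := congrArg Multiset.card hout
    rw [Multiset.card_map] at h1 h2
    simp only [Finset.card_val] at h1 h2
    rw [Nat.card_eq_fintype_card (α := (F.cover ρ hρ w hw).Vert)]
    omega
  · rw [PointDistribution.points_trivial, hs, ht]
    have h1 := F.card_verts hρ
    ext r
    constructor
    · rintro ⟨x, rfl⟩
      refine ⟨F.height ρ x.1, ?_, rfl⟩
      have : F.height ρ x.1 ∈ F.cat.verts.image (F.height ρ) := Finset.mem_image_of_mem _ x.2
      rw [h1] at this
      simpa using this
    · rintro ⟨j, hj, rfl⟩
      have : j ∈ F.cat.verts.image (F.height ρ) := by rw [h1]; simpa using hj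
      obtain ⟨x, hx, rfl⟩ := Finset.mem_image.1 this
      exact ⟨⟨x, hx⟩, rfl⟩

end Config

/-! ### The zigzag subgraph -/

namespace Config

variable (F : Config) {ρ : ℕ → Equiv.Perm ℕ}

lemma node_cases_lower {k : ℕ} (h : k < F.N + 2) :
    (∃ a b, F.node k = .exch a b ∧ k < F.N₀ ∧ ((a = b ∧ a ≠ 0) ∨ (Odd a ∧ Odd b ∧ a * b < 0 ∧ a + b ≠ 0))) ∨
    (∃ i < F.n, k = F.N₀ + i ∧ F.node k = .birth) ∨ ((k = F.N ∨ k = F.N + 1) ∧ F.node k = .leaf F.o) := by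
  by_cases h1 : k < F.N₀
  · exact .inl ⟨_, _, F.node_pre h1, h1, F.pre_ok k h1⟩
  by_cases h2 : k < F.N
  · unfold N at h2
    obtain ⟨i, rfl⟩ := Nat.exists_eq_add_of_le (not_lt.1 h1)
    exact .inr (.inl ⟨i, by omega, rfl, F.node_birth (by omega)⟩)
  · have h3 : k = F.N ∨ k = F.N + 1 := by omega
    refine .inr (.inr ⟨h3, ?_⟩)
    rcases h3 with rfl | rfl
    · exact F.node_low
    · exact F.node_up

lemma node_cases_upper {k : ℕ} (h : F.N + 2 ≤ k) (hM : k < F.M) :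
    (∃ x, F.node k = .leaf x ∧ Even x) ∨ ∃ x j, F.node k = .tail x j ∧ (x = 1 ∨ x = -1) := by
  have := F.N_eq
  rcases F.spine_cases hM with h | ⟨i, hi, rfl⟩ | rfl | rfl | rfl | ⟨j, hj, rfl⟩ | ⟨c, hc, rfl⟩ |
    ⟨c, hc, rfl⟩
  · omega
  · omega
  · omega
  · omega
  · exact .inl ⟨_, F.node_peak, by rw [even_neg]; exact_mod_cast F.e_even⟩
  · rw [F.node_sp hj]
    rcases F.sp_ok j hj with ⟨x, h, hx, _⟩ | h | h
    · exact .inl ⟨x, h, hx⟩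
    · exact .inr ⟨1, 0, h, by simp⟩
    · exact .inr ⟨-1, 0, h, by simp⟩
  · exact .inr ⟨1, _, F.node_in c, by simp⟩
  · exact .inr ⟨-1, _, F.node_out c, by simp⟩

lemma val_even {k : ℕ} (h : F.N + 2 ≤ k) (hM : k < F.M) : Even (F.node k).val := by
  rcases F.node_cases_upper h hM with ⟨x, hx, he⟩ | ⟨x, j, hx, _⟩ <;> rw [hx]
  · exact he
  · simp [Node.val, Node.fm]

lemma link_lower {k : ℕ} (h : k < F.N + 2) (i : ℕ) : (F.node k).link i = false := by
  rcases F.node_cases_lower h with ⟨a, b, h, _⟩ | ⟨i, _, _, h⟩ | ⟨_, h⟩ <;> rw [h] <;> rfl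

section Edges

lemma src_of_pos {e : F.cat.Edge} (h : 0 < F.cat.flow e.1) : F.cat.src e = F.cat.far e := by
  simp [Caterpillar.src, h]
lemma tgt_of_pos {e : F.cat.Edge} (h : 0 < F.cat.flow e.1) : F.cat.tgt e = F.cat.near e := by
  simp [Caterpillar.tgt, h]
lemma src_of_neg {e : F.cat.Edge} (h : F.cat.flow e.1 < 0) : F.cat.src e = F.cat.near e := by
  simp [Caterpillar.src, h.le.not_gt]
lemma tgt_of_neg {e : F.cat.Edge} (h : F.cat.flow e.1 < 0) : F.cat.tgt e = F.cat.far e := by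
  simp [Caterpillar.tgt, h.le.not_gt]

lemma src_tgt_cases (e : F.cat.Edge) : (F.cat.src e = F.cat.far e ∧ F.cat.tgt e = F.cat.near e) ∨
    (F.cat.src e = F.cat.near e ∧ F.cat.tgt e = F.cat.far e) := by
  simp only [Caterpillar.src, Caterpillar.tgt]; split_ifs <;> simp

end Edges

variable (hρ : ∀ c < F.n, ρ 0 c < F.n) {w : ℕ → ℝ} (hw : StrictMono w)

lemma incident_iff {e : F.cat.Edge} {v : F.cat.Vert} : (F.cover ρ hρ w hw).Incident e v ↔
    F.cat.near e = some v ∨ F.cat.far e = some v := by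
  change F.cat.src e = some v ∨ F.cat.tgt e = some v ↔ _
  rcases F.src_tgt_cases e with ⟨h1, h2⟩ | ⟨h1, h2⟩ <;> rw [h1, h2]
  exact or_comm

lemma incident_iff_code {e : F.cat.Edge} {v : F.cat.Vert} : (F.cover ρ hρ w hw).Incident e v ↔
    Caterpillar.nearCode e.1 = v.1 ∨ F.cat.farCode e.1 = some v.1 := by
  rw [incident_iff, Caterpillar.near_eq_some, Caterpillar.far_eq_some]

variable {s t : ℕ} (hs : s = F.numPairs) (ht : t = F.numSimple)

include hs in
-- Pair `i` has the heights `2 * i` and `2 * i + 1`, so equal halves suffice; monotonicity along the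
-- edge tells which endpoint is the lower one.
lemma isContractible_of {e : F.cat.Edge} {a b : F.cat.Vert} (i : ℕ) (hi : i < F.numPairs)
    (ha : F.cat.near e = some a) (hb : F.cat.far e = some b)
    (h1 : F.height ρ a.1 / 2 = i) (h2 : F.height ρ b.1 / 2 = i) :
    (F.cover ρ hρ w hw).IsContractible (PointDistribution.trivial s t w hw) e := by
  subst hs
  have key : ∀ a b, F.cat.src e = some a → F.cat.tgt e = some b → F.height ρ a.1 / 2 = i →
      F.height ρ b.1 / 2 = i →
      (F.cover ρ hρ w hw).IsContractible (PointDistribution.trivial F.numPairs t w hw) e := by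
    intro a b ha hb h1 h2
    have h3 := F.height_src_lt_tgt hρ e a b ha hb
    refine ⟨⟨i, hi⟩, a, b, ?_, ?_, ha, hb⟩
    · change w (F.height ρ a.1) = w (2 * i)
      congr 1; omega
    · change w (F.height ρ b.1) = w (2 * i + 1)
      congr 1; omega
  rcases F.src_tgt_cases e with ⟨h3, h4⟩ | ⟨h3, h4⟩
  · exact key b a (h3.trans hb) (h4.trans ha) h2 h1
  · exact key a b (h3.trans ha) (h4.trans hb) h1 h2

include hs in
lemma isContractible_base {k : ℕ} (hk : k < F.N) (h : main (k, 0) ∈ F.cat.edges) :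
    (F.cover ρ hρ w hw).IsContractible (PointDistribution.trivial s t w hw) ⟨main (k, 0), h⟩ := by
  have hp := F.p_pos hk
  have hM : k < F.M := by unfold M Z; omega
  refine F.isContractible_of hρ hw hs (a := ⟨(k, 0), F.mem_cat.2 ⟨hM, by omega⟩⟩)
    (b := ⟨(k, 1), F.mem_cat.2 ⟨hM, hp⟩⟩) (F.n + F.N - k) (by unfold numPairs; omega)
    (by rw [Caterpillar.near_eq_some]; rfl) (by rw [Caterpillar.far_eq_some]; rfl) ?_ ?_
  · simp only [F.height_zero hk]; split_ifs <;> omega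
  · simp only [F.height_one hk]; split_ifs <;> omega

include hs in
lemma isContractible_birth {i : ℕ} (hi : i < F.n) (h : main (F.N₀ + i, 2) ∈ F.cat.edges) :
    (F.cover ρ hρ w hw).IsContractible (PointDistribution.trivial s t w hw)
      ⟨main (F.N₀ + i, 2), h⟩ := by
  have hp : (F.node (F.N₀ + i)).p = 3 := by rw [F.node_birth hi]; rfl
  have hM : F.N₀ + i < F.M := by unfold M Z N; omega
  have := hρ i hi
  refine F.isContractible_of hρ hw hs (a := ⟨(F.N₀ + i, 2), F.mem_cat.2 ⟨hM, by omega⟩⟩)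
    (b := ⟨(F.N₀ + i, 3), F.mem_cat.2 ⟨hM, by omega⟩⟩) (1 + ρ 0 i) (by unfold numPairs N; omega)
    (by rw [Caterpillar.near_eq_some]; rfl) (by rw [Caterpillar.far_eq_some]; rfl) ?_ ?_
  · simp only [F.height_two hi]; omega
  · simp only [F.height_three hi]; omega

include hs in
lemma isContractible_first (h : spine (F.N + 1) ∈ F.cat.edges) :
    (F.cover ρ hρ w hw).IsContractible (PointDistribution.trivial s t w hw) ⟨spine (F.N + 1), h⟩ := by
  have hM := F.N_add_two_lt_M
  refine F.isContractible_of hρ hw hs (a := ⟨(F.N + 1, 0), F.mem_cat.2 ⟨by omega, by omega⟩⟩)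
    (b := ⟨(F.N, 0), F.mem_cat.2 ⟨by omega, by omega⟩⟩) 0 (by unfold numPairs; omega)
    (by rw [Caterpillar.near_eq_some]; rfl) (by rw [Caterpillar.far_eq_some]; rfl) ?_ ?_
  · simp only [F.height_up]
  · simp only [F.height_low]

include hs in
/-- Each vertex over a pair is adjacent to a contractible edge. -/
lemma exists_contractible {v : F.cat.Vert} (hv : v.1.1 < F.N + 2) : ∃ c : F.cat.Edge,
    (F.cover ρ hρ w hw).IsContractible (PointDistribution.trivial s t w hw) c ∧
    (F.cover ρ hρ w hw).Incident c v := by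
  have hM := F.N_add_two_lt_M
  have hN := F.N_eq
  have hbase : ∀ k < F.N, main (k, 0) ∈ F.cat.edges := fun k hk => by
    rw [Caterpillar.main_mem]; exact F.spine_mem_verts (by omega)
  have hb2 : ∀ i < F.n, main (F.N₀ + i, 2) ∈ F.cat.edges := fun i hi => by
    rw [Caterpillar.main_mem, mem_cat, F.node_birth hi]; simp only [Node.p]; omega
  have h1 : spine (F.N + 1) ∈ F.cat.edges := by simp; omega
  rcases F.lower_cases v.2 hv with ⟨k, hk, h⟩ | ⟨k, hk, h⟩ | ⟨i, hi, h⟩ | ⟨i, hi, h⟩ | h | h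
  · exact ⟨_, F.isContractible_base hρ hw hs hk (hbase k hk), (F.incident_iff_code hρ hw).2 (.inl h.symm)⟩
  · exact ⟨_, F.isContractible_base hρ hw hs hk (hbase k hk), (F.incident_iff_code hρ hw).2
      (.inr (by rw [h]; rfl))⟩
  · exact ⟨_, F.isContractible_birth hρ hw hs hi (hb2 i hi), (F.incident_iff_code hρ hw).2 (.inl h.symm)⟩
  · exact ⟨_, F.isContractible_birth hρ hw hs hi (hb2 i hi), (F.incident_iff_code hρ hw).2
      (.inr (by rw [h]; rfl))⟩
  · exact ⟨_, F.isContractible_first hρ hw hs h1, (F.incident_iff_code hρ hw).2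
      (.inr (by rw [h]; rfl))⟩
  · exact ⟨_, F.isContractible_first hρ hw hs h1, (F.incident_iff_code hρ hw).2 (.inl h.symm)⟩

/-- The codes of the edges of the zigzag subgraph. -/
def zigzagCode : EdgeCode → Prop
  -- The whole spine, and the pendants over the pairs with the exception of their even ends.
  | .inl _ => True
  | .inr (.inl x) => x.1 < F.N + 2 ∧ (x.2 < (F.node x.1).p ∨ Odd ((F.node x.1).fm x.2))
  | .inr (.inr x) => x.1 < F.N + 2 ∧ Odd ((F.node x.1).fs x.2)

/-- The zigzag subgraph. -/
def zigzag : (F.cover ρ hρ w hw).Subgraph where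
  verts := {v : F.cat.Vert | v.1.2 = 0 ∨ v.1.1 < F.N + 2}
  edges := {e : F.cat.Edge | F.zigzagCode e.1}
  closed := by
    rintro ⟨c, hc⟩ he v hv
    replace hv := (F.incident_iff_code hρ hw (e := ⟨c, hc⟩) (v := v)).1 hv
    change v.1.2 = 0 ∨ v.1.1 < F.N + 2
    rcases c with (_ | k) | x | x
    · rcases hv with hv | hv
      · left; rw [← hv]; rfl
      · simp [Caterpillar.farCode] at hv
    · left
      rcases hv with hv | hv
      · rw [← hv]; rfl
      · simp only [Caterpillar.farCode, Option.some.injEq] at hv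
        rw [← hv]
    · right
      rcases hv with hv | hv
      · rw [← hv]; exact he.1
      · simp only [Caterpillar.farCode, Option.some.injEq] at hv
        rw [← hv]; exact he.1
    · right
      rcases hv with hv | hv
      · rw [← hv]; exact he.1
      · simp only [Caterpillar.farCode] at hv
        split_ifs at hv
        simp only [Option.some.injEq] at hv
        rw [← hv]; exact he.1

lemma graphOn_eq (A : Set EdgeCode) (B : Set (F.cover ρ hρ w hw).Edge)
    (h : B = {e : F.cat.Edge | e.1 ∈ A}) :
    (F.cover ρ hρ w hw).graphOn B = F.cat.codeGraph A := by
  subst h; rfl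

lemma zigzag_connected : (F.zigzag hρ hw).Connected := by
  have h0 : (0, 0) ∈ F.cat.verts := F.spine_mem_verts F.M_pos
  have key : ∀ v : F.cat.Vert, v.1.2 = 0 ∨ v.1.1 < F.N + 2 →
      (F.cat.codeGraph {c | F.zigzagCode c}).Reachable ⟨(0, 0), h0⟩ v := by
    rintro ⟨⟨k, i⟩, hv⟩ h
    have hv' := F.mem_cat.1 hv
    have hk : (k, 0) ∈ F.cat.verts := F.spine_mem_verts hv'.1
    refine (F.cat.reachable_spine (A := {c | F.zigzagCode c}) (Nat.zero_le k) h0 hk (fun _ _ _ => True.intro)).trans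
      (F.cat.reachable_pendant hv (fun j hj => ?_) hk)
    simp only at h
    exact ⟨by simp only; omega, .inl (by simp only; omega)⟩
  refine ⟨⟨⟨(0, 0), h0⟩, .inl rfl⟩, fun u hu v hv => ?_⟩
  rw [F.graphOn_eq hρ hw {c | F.zigzagCode c} (F.zigzag hρ hw).edges rfl]
  exact (key u hu).symm.trans (key v hv)

lemma wt_eq (e : F.cat.Edge) : (F.cover ρ hρ w hw).wt e = (F.cat.flow e.1).natAbs := rfl

include hs in
-- Every vertex over a pair touches a contractible edge, so a symmetric pair as in `InSymTwo` has
-- all its vertices beyond the characteristic edge. There the subgraph consists of odd spine edges,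
-- no two of which have the same endpoints, and a pendant edge at the spine is even, so it cannot
-- have the same weight.
lemma zigzag_disjoint_symTwo {e : F.cat.Edge} (he : F.zigzagCode e.1) :
    ¬ (F.cover ρ hρ w hw).InSymTwo (PointDistribution.trivial s t w hw) e := by
  rintro ⟨f, ⟨hne, hwt, hsrc, htgt⟩, -, -, hadj⟩
  have hlow : ∀ v : F.cat.Vert, (F.cover ρ hρ w hw).Incident e v → F.N + 2 ≤ v.1.1 := by
    intro v hv
    by_contra h
    obtain ⟨c, hc, hcv⟩ := F.exists_contractible (t := t) hρ hw hs (not_le.1 h)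
    exact hadj c v hc hcv hv
  have hinc : ∀ v : F.cat.Vert, (F.cover ρ hρ w hw).Incident f v ↔ (F.cover ρ hρ w hw).Incident e v := by
    intro v; unfold TropicalCover.Incident; rw [hsrc, htgt]
  have hnear : ∀ x (hx : x ∈ F.cat.verts), Caterpillar.nearCode e.1 = x → F.N + 2 ≤ x.1 :=
    fun x hx h => hlow ⟨x, hx⟩ ((F.incident_iff_code hρ hw).2 (.inl h))
  obtain ⟨c, hc⟩ := e
  rcases c with k | x | x
  · have hk : k ≤ F.M := by simpa using hc
    rcases k with _ | k
    · have := hnear (0, 0) (F.spine_mem_verts F.M_pos) rfl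
      simp at this
    have hfar : (F.cover ρ hρ w hw).Incident ⟨spine (k + 1), hc⟩ ⟨(k, 0), F.spine_mem_verts (by omega)⟩ :=
      (F.incident_iff_code hρ hw).2 (.inr rfl)
    have hk2 : F.N + 2 ≤ k := hlow _ hfar
    have hodd : Odd (F.s (k + 1)) := F.s_odd (by omega) hk
    have hf := (F.incident_iff_code hρ hw).1 ((hinc _).2 hfar)
    obtain ⟨c', hc'⟩ := f
    replace hwt : (F.s (k + 1)).natAbs = (F.cat.flow c').natAbs := hwt
    rcases c' with (_ | k') | ⟨k', i⟩ | ⟨k', i⟩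
    · simp [Caterpillar.nearCode, Caterpillar.farCode] at hf; omega
    · simp only [Caterpillar.nearCode, Caterpillar.farCode, Prod.mk.injEq, and_true,
        Option.some.injEq] at hf
      rcases hf with hf | hf
      · have h1 : (F.cover ρ hρ w hw).Incident ⟨spine (k' + 1), hc'⟩
          ⟨(k', 0), F.spine_mem_verts (by omega)⟩ := (F.incident_iff_code hρ hw).2 (.inr rfl)
        have h2 := (F.incident_iff_code hρ hw).1 ((hinc _).1 h1)
        simp [Caterpillar.nearCode, Caterpillar.farCode] at h2; omega
      · subst hf; exact hne rfl
    · have hm := F.mem_cat.1 (F.cat.main_mem.1 hc')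
      simp only [Caterpillar.nearCode, Caterpillar.farCode, Prod.mk.injEq,
        Option.some.injEq, Nat.succ_ne_zero, and_false, or_false] at hf
      obtain ⟨rfl, rfl⟩ := hf
      rw [flow_main] at hwt
      have h1 : Even (F.node k').val := F.val_even hk2 hm.1
      rw [← Int.natAbs_odd, hwt, Int.natAbs_odd] at hodd
      exact (Int.not_odd_iff_even.2 h1) hodd
    · have hm := F.cat.sec_mem.1 hc'
      simp only [Caterpillar.nearCode, Caterpillar.farCode, Prod.mk.injEq] at hf
      rcases hf with hf | hf
      · obtain ⟨rfl, rfl⟩ := hf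
        have : F.cat.hasSec (k', 0) = false := Node.hasSec_zero _
        rw [this] at hm; simp at hm
      · split_ifs at hf; simp at hf
  · have := hnear x (F.cat.main_mem.1 hc) rfl
    exact absurd he.1 (not_lt.2 this)
  · have := hnear x (F.cat.sec_mem.1 hc).1 rfl
    exact absurd he.1 (not_lt.2 this)

include hs in
-- Vertices from the peak on have heights of at least `2 * numPairs`, so they belong to no pair.
lemma lower_of_isContractible {e : F.cat.Edge}
    (h : (F.cover ρ hρ w hw).IsContractible (PointDistribution.trivial s t w hw) e) :
    ∃ a b : F.cat.Vert, F.cat.near e = some a ∧ F.cat.far e = some b ∧ a.1.1 < F.N + 2 := by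
  obtain ⟨i, a, b, h1, h2, h3, h4⟩ := h
  have hi := i.2
  have hlow : ∀ v : F.cat.Vert, F.height ρ v.1 < 2 * F.numPairs → v.1.1 < F.N + 2 := by
    intro v hv
    by_contra h
    rw [F.height_upper (F.upper_of_le v.2 (not_lt.1 h))] at hv
    omega
  have ha : F.height ρ a.1 = 2 * i := hw.injective h1
  have hb : F.height ρ b.1 = 2 * i + 1 := hw.injective h2
  rcases F.src_tgt_cases e with ⟨h5, h6⟩ | ⟨h5, h6⟩
  · exact ⟨b, a, h6.symm.trans h4, h5.symm.trans h3, hlow b (by omega)⟩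
  · exact ⟨a, b, h5.symm.trans h3, h6.symm.trans h4, hlow a (by omega)⟩

include hs in
lemma zigzag_contractible_mem {e : F.cat.Edge}
    (h : (F.cover ρ hρ w hw).IsContractible (PointDistribution.trivial s t w hw) e) :
    F.zigzagCode e.1 := by
  obtain ⟨a, b, h1, h2, h3⟩ := F.lower_of_isContractible hρ hw hs h
  rw [Caterpillar.near_eq_some] at h1
  rw [Caterpillar.far_eq_some] at h2
  obtain ⟨c, hc⟩ := e
  rcases c with k | x | x
  · trivial
  · rw [← h1] at h3
    refine ⟨h3, .inl ?_⟩
    simp only [Caterpillar.farCode, Option.some.injEq] at h2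
    have := b.2
    rw [← h2, mem_cat] at this
    exact this.2
  · rw [← h1] at h3
    have hl : F.cat.link x = false := F.link_lower h3 _
    simp [Caterpillar.farCode, hl] at h2

include hs in
-- The even edges in the subgraph are the main edges joining the spine to the pendants over the
-- pairs, the outer edge of weight 2 in each birth, and the spine edge between the two ends of
-- weight `o`. Each of them joins the two vertices of a pair.
lemma zigzag_odd {e : F.cat.Edge} (he : F.zigzagCode e.1)
    (h : ¬ (F.cover ρ hρ w hw).IsContractible (PointDistribution.trivial s t w hw) e) :
    Odd ((F.cover ρ hρ w hw).wt e) := by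
  rw [wt_eq, Int.natAbs_odd]
  obtain ⟨c, hc⟩ := e
  rcases c with k | ⟨k, i⟩ | x
  · by_cases hk : k = F.N + 1
    · subst hk; exact absurd (F.isContractible_first hρ hw hs hc) h
    · exact F.s_odd hk (by simpa using hc)
  · rw [flow_main]
    obtain ⟨h1, h2 | h2⟩ := he
    · simp only at h1 h2
      rcases F.node_cases_lower h1 with ⟨a, b, h3, h4, _⟩ | ⟨j, hj, rfl, h3⟩ | ⟨_, h3⟩
      · rw [h3] at h2
        simp only [Node.p] at h2
        obtain rfl : i = 0 := by omega
        exact absurd (F.isContractible_base hρ hw hs (by unfold N; omega) hc) h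
      · rw [h3] at h2 ⊢
        simp only [Node.p] at h2
        interval_cases i
        · exact absurd (F.isContractible_base hρ hw hs (by unfold N; omega) hc) h
        · decide
        · exact absurd (F.isContractible_birth hρ hw hs hj hc) h
      · rw [h3] at h2; simp [Node.p] at h2
    · exact h2
  · exact he.2

end Config

/-! ### The components of the complement are tails -/

namespace Config

variable (F : Config) {ρ : ℕ → Equiv.Perm ℕ}
variable (hρ : ∀ c < F.n, ρ 0 c < F.n) {w : ℕ → ℝ} (hw : StrictMono w)

/-- The edges of the pendant at the `k`-th vertex of the spine from level `l` on. -/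
def pendantFrom (k l : ℕ) : Set F.cat.Edge :=
  {e | ∃ i, l ≤ i ∧ (e.1 = main (k, i) ∨ e.1 = sec (k, i))}

lemma hasSec_eq (k i : ℕ) : F.cat.hasSec (k, i) = (F.node k).hasSec i := rfl
lemma link_eq (k i : ℕ) : F.cat.link (k, i) = (F.node k).link i := rfl

section Tail

variable {F} {k : ℕ} {x : ℤ} {j : ℕ} (hn : F.node k = .tail x j) (hk : k < F.M)

include hn hk

lemma main_mem_tail {i : ℕ} : main (k, i) ∈ F.cat.edges ↔ i ≤ 2 * j + 1 := by
  rw [Caterpillar.main_mem, mem_cat, hn]; simp [Node.p, hk]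

lemma sec_mem_tail {i : ℕ} : sec (k, i) ∈ F.cat.edges ↔ i ≤ 2 * j + 1 ∧ i % 2 = 1 := by
  rw [Caterpillar.sec_mem, mem_cat, hasSec_eq, hn]; simp [Node.p, hk, Node.hasSec]

lemma pendantFrom_eq {l : ℕ} (h : main (k, 2 * l) ∈ F.cat.edges)
    (hm1 : main (k, 2 * l + 1) ∈ F.cat.edges) (hs1 : sec (k, 2 * l + 1) ∈ F.cat.edges) :
    F.pendantFrom k (2 * l) = {⟨main (k, 2 * l), h⟩, ⟨main (k, 2 * l + 1), hm1⟩,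
        ⟨sec (k, 2 * l + 1), hs1⟩} ∪ F.pendantFrom k (2 * (l + 1)) := by
  ext ⟨c, hc⟩
  simp only [pendantFrom, Set.mem_ofPred_eq, Subtype.mk.injEq, Set.mem_union, Set.mem_insert_iff,
    Set.mem_singleton_iff]
  constructor
  · rintro ⟨i, hi, rfl | rfl⟩
    · have : i = 2 * l ∨ i = 2 * l + 1 ∨ 2 * (l + 1) ≤ i := by omega
      rcases this with rfl | rfl | h
      · simp
      · simp
      · exact .inr ⟨i, h, .inl rfl⟩
    · have h' := (sec_mem_tail hn hk).1 hc
      have : i = 2 * l + 1 ∨ 2 * (l + 1) ≤ i := by omega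
      rcases this with rfl | h
      · simp
      · exact .inr ⟨i, h, .inr rfl⟩
  · rintro ((rfl | rfl | rfl) | ⟨i, hi, h⟩)
    · exact ⟨_, le_rfl, .inl rfl⟩
    · exact ⟨2 * l + 1, by omega, .inl rfl⟩
    · exact ⟨2 * l + 1, by omega, .inr rfl⟩
    · exact ⟨i, by omega, h⟩

/-- With abstract endpoint maps `nr` and `fr`, one proof serves inward and outward tails. The
induction on the number of cycles still to come peels off an edge of weight 2 and the symmetric
cycle after it, until the fork is left. Any number of cycles is admissible because the edges of the
cycles have the odd weight 1. -/
lemma isTail_pendantFrom {nr fr : F.cat.Edge → Option F.cat.Vert}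
    (hnr : ∀ e ∈ F.pendantFrom k 0, nr e = F.cat.near e ∧ fr e = F.cat.far e)
    (hx : x = 1 ∨ x = -1) {l : ℕ} (hl : l ≤ j)
    (h : main (k, 2 * l) ∈ F.cat.edges) :
    (F.cover ρ hρ w hw).IsTail nr fr 1 ⟨main (k, 2 * l), h⟩ (F.pendantFrom k (2 * l)) := by
  have hwm : ∀ i (h : main (k, i) ∈ F.cat.edges), (F.cover ρ hρ w hw).wt ⟨main (k, i), h⟩ =
      if i % 2 = 0 then 2 * 1 else 1 := by
    intro i h
    rw [wt_eq, flow_main, hn]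
    simp only [Node.fm]
    rcases hx with rfl | rfl <;> split_ifs <;> rfl
  have hws : ∀ i (h : sec (k, i) ∈ F.cat.edges), (F.cover ρ hρ w hw).wt ⟨sec (k, i), h⟩ = 1 := by
    intro i h
    rw [wt_eq, flow_sec, hn]
    rcases hx with rfl | rfl <;> rfl
  have hvert : ∀ i ≤ 2 * j + 1, (k, i) ∈ F.cat.verts := by
    intro i hi; rw [mem_cat, hn]; exact ⟨hk, hi⟩
  have nearm : ∀ i (h : main (k, i) ∈ F.cat.edges), nr ⟨main (k, i), h⟩ =
      some ⟨(k, i), hvert i ((main_mem_tail hn hk).1 h)⟩ := by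
    intro i h
    rw [(hnr _ ⟨i, by simp⟩).1, Caterpillar.near_eq_some]; rfl
  have nears : ∀ i (h : sec (k, i) ∈ F.cat.edges), nr ⟨sec (k, i), h⟩ =
      some ⟨(k, i), hvert i ((sec_mem_tail hn hk).1 h).1⟩ := by
    intro i h
    rw [(hnr _ ⟨i, by simp⟩).1, Caterpillar.near_eq_some]; rfl
  have farm : ∀ i (h : main (k, i) ∈ F.cat.edges) (hi : i + 1 ≤ 2 * j + 1), fr ⟨main (k, i), h⟩ =
      some ⟨(k, i + 1), hvert _ hi⟩ := by
    intro i h hi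
    rw [(hnr _ ⟨i, by simp⟩).2, Caterpillar.far_eq_some]; rfl
  have hlink : ∀ i, F.cat.link (k, i) = true := by intro i; rw [link_eq, hn]; rfl
  have fars : ∀ i (h : sec (k, i) ∈ F.cat.edges) (hi : i + 1 ≤ 2 * j + 1), fr ⟨sec (k, i), h⟩ =
      some ⟨(k, i + 1), hvert _ hi⟩ := by
    intro i h hi
    rw [(hnr _ ⟨i, by simp⟩).2, Caterpillar.far_eq_some]
    simp [Caterpillar.farCode, hlink]
  induction hd : j - l generalizing l with
  | zero =>
    have hm1 : main (k, 2 * l + 1) ∈ F.cat.edges := (main_mem_tail hn hk).2 (by omega)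
    have hs1 : sec (k, 2 * l + 1) ∈ F.cat.edges := (sec_mem_tail hn hk).2 (by omega)
    obtain rfl : l = j := by omega
    have hempty : F.pendantFrom k (2 * (l + 1)) = ∅ := by
      ext ⟨c, hc⟩
      simp only [pendantFrom, Set.mem_ofPred_eq, Set.mem_empty_iff_false, iff_false]
      rintro ⟨i, hi, rfl | rfl⟩
      · have := (main_mem_tail hn hk).1 hc; omega
      · have := (sec_mem_tail hn hk).1 hc; omega
    have hset : F.pendantFrom k (2 * l) = {⟨main (k, 2 * l), h⟩, ⟨main (k, 2 * l + 1), hm1⟩,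
        ⟨sec (k, 2 * l + 1), hs1⟩} := by
      rw [pendantFrom_eq hn hk h hm1 hs1, hempty, Set.union_empty]
    rw [hset]
    have hf1 : F.cat.far ⟨main (k, 2 * l + 1), hm1⟩ = none := by
      rw [far_main_eq_none, hn]; rfl
    have hf2 : F.cat.far ⟨sec (k, 2 * l + 1), hs1⟩ = none := by
      rw [far_sec_eq_none, hn]; exact .inr rfl
    refine TropicalCover.IsTail.fork _ _ _ (⟨(k, 2 * l + 1), hvert _ le_rfl⟩ : F.cat.Vert) ?_
      (farm _ h le_rfl) ?_ ⟨nearm _ hm1, ?_, ?_⟩ ⟨nears _ hs1, ?_, ?_⟩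
    · rw [hwm, if_pos (by omega)]
    · intro h; simpa using congrArg Subtype.val h
    · rw [(hnr _ ⟨_, Nat.zero_le _, .inl rfl⟩).2, hf1]; rfl
    · rw [hwm, if_neg (by omega)]
    · rw [(hnr _ ⟨_, Nat.zero_le _, .inr rfl⟩).2, hf2]; rfl
    · rw [hws]
  | succ d ih =>
    have hm1 : main (k, 2 * l + 1) ∈ F.cat.edges := (main_mem_tail hn hk).2 (by omega)
    have hs1 : sec (k, 2 * l + 1) ∈ F.cat.edges := (sec_mem_tail hn hk).2 (by omega)
    rw [pendantFrom_eq hn hk h hm1 hs1]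
    have hm2 : main (k, 2 * (l + 1)) ∈ F.cat.edges := (main_mem_tail hn hk).2 (by omega)
    refine TropicalCover.IsTail.cycle (C := F.cover ρ hρ w hw) _ _ _ (⟨main (k, 2 * (l + 1)), hm2⟩ : F.cat.Edge)
      (⟨(k, 2 * l + 1), hvert _ (by omega)⟩ : F.cat.Vert)
      (⟨(k, 2 * l + 1 + 1), hvert _ (by omega)⟩ : F.cat.Vert) _ odd_one ?_ (farm _ h (by omega)) ?_
      ⟨nearm _ hm1, farm _ hm1 (by omega), ?_⟩ ⟨nears _ hs1, fars _ hs1 (by omega), ?_⟩ (nearm _ hm2)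
      (ih (by omega) hm2 (by omega))
    · rw [hwm, if_pos (by omega)]
    · intro h; simpa using congrArg Subtype.val h
    · rw [hwm, if_neg (by omega)]
    · rw [hws]

end Tail

lemma mem_pendantFrom_of_incident {e : F.cat.Edge} {v : F.cat.Vert}
    (h : (F.cover ρ hρ w hw).Incident e v) (hv : v.1.2 ≠ 0) : e ∈ F.pendantFrom v.1.1 0 := by
  replace h := (F.incident_iff_code hρ hw).1 h
  obtain ⟨c, hc⟩ := e
  obtain ⟨⟨k, i⟩, hx⟩ := v
  rcases c with (_ | k') | ⟨k', i'⟩ | ⟨k', i'⟩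
  · simp [Caterpillar.nearCode, Caterpillar.farCode] at h hv; omega
  · simp [Caterpillar.nearCode, Caterpillar.farCode] at h hv; omega
  · have : k' = k := by
      simp [Caterpillar.nearCode, Caterpillar.farCode] at h; omega
    subst this
    exact ⟨i', Nat.zero_le _, .inl rfl⟩
  · have : k' = k := by
      simp only [Caterpillar.nearCode, Caterpillar.farCode] at h
      split_ifs at h <;> simp at h <;> omega
    subst this
    exact ⟨i', Nat.zero_le _, .inr rfl⟩

lemma eq_of_incident_pendant {e : F.cat.Edge} {v : F.cat.Vert} {k : ℕ}
    (h : (F.cover ρ hρ w hw).Incident e v) (he : e ∈ F.pendantFrom k 0) : v.1.1 = k := by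
  replace h := (F.incident_iff_code hρ hw).1 h
  obtain ⟨c, hc⟩ := e
  obtain ⟨⟨k', i'⟩, hx⟩ := v
  obtain ⟨i, -, rfl | rfl⟩ := he
  · simp [Caterpillar.nearCode, Caterpillar.farCode] at h ⊢; omega
  · simp only [Caterpillar.nearCode, Caterpillar.farCode] at h ⊢
    split_ifs at h <;> simp at h <;> omega

lemma not_zigzagCode_of_pendant {e : F.cat.Edge} {k : ℕ} (hk : F.N + 2 ≤ k)
    (he : e ∈ F.pendantFrom k 0) : ¬ F.zigzagCode e.1 := by
  obtain ⟨c, hc⟩ := e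
  obtain ⟨i, -, rfl | rfl⟩ := he
  · exact fun h => absurd h.1 (not_lt.2 hk)
  · exact fun h => absurd h.1 (not_lt.2 hk)

/-- `Linked` passes only through vertices outside the subgraph. These have positive level, and all
edges at such a vertex belong to its own pendant. -/
lemma component_subset {e f : F.cat.Edge} {k : ℕ} (he : e ∈ F.pendantFrom k 0)
    (hf : f ∈ (F.zigzag hρ hw).component e) : f ∈ F.pendantFrom k 0 := by
  replace hf : Relation.ReflTransGen (F.zigzag hρ hw).Linked e f := hf
  induction hf with
  | refl => exact he
  | @tail b c _ h ih =>
    obtain ⟨-, v, hv, h1, h2⟩ := h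
    have h3 : ¬ ((v : F.cat.Vert).1.2 = 0 ∨ (v : F.cat.Vert).1.1 < F.N + 2) := hv
    rw [not_or] at h3
    have h4 := F.eq_of_incident_pendant hρ hw h1 ih
    have h5 := F.mem_pendantFrom_of_incident hρ hw h2 h3.1
    rwa [h4] at h5

/-- A pendant of tail shape meets the subgraph only in its vertex on the spine, so its edges are
linked to one another through vertices of positive level. -/
lemma component_tail {k : ℕ} {x : ℤ} {j : ℕ} (hn : F.node k = .tail x j) (hk : k < F.M)
    (hk2 : F.N + 2 ≤ k) {e : F.cat.Edge} (he : e ∈ F.pendantFrom k 0) :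
    (F.zigzag hρ hw).component e = F.pendantFrom k 0 := by
  have hvert : ∀ i ≤ 2 * j + 1, (k, i) ∈ F.cat.verts := by
    intro i hi; rw [mem_cat, hn]; exact ⟨hk, hi⟩
  have linked : ∀ (f g : F.cat.Edge) (v : F.cat.Vert), f ∈ F.pendantFrom k 0 → g ∈ F.pendantFrom k 0 →
      v.1.2 ≠ 0 → (F.cover ρ hρ w hw).Incident f v → (F.cover ρ hρ w hw).Incident g v →
      Relation.ReflTransGen (F.zigzag hρ hw).Linked f g ∧
      Relation.ReflTransGen (F.zigzag hρ hw).Linked g f := by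
    intro f g v hf hg hv h1 h2
    have h3 := F.eq_of_incident_pendant hρ hw h1 hf
    have h4 : v ∉ (F.zigzag hρ hw).verts := by
      change ¬ (v.1.2 = 0 ∨ v.1.1 < F.N + 2)
      omega
    exact ⟨.single ⟨F.not_zigzagCode_of_pendant hk2 hg, v, h4, h1, h2⟩,
      .single ⟨F.not_zigzagCode_of_pendant hk2 hf, v, h4, h2, h1⟩⟩
  have hm0 : main (k, 0) ∈ F.cat.edges := (main_mem_tail hn hk).2 (by omega)
  have key : ∀ i (h : main (k, i) ∈ F.cat.edges),
      Relation.ReflTransGen (F.zigzag hρ hw).Linked (⟨main (k, 0), hm0⟩ : F.cat.Edge)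
        (⟨main (k, i), h⟩ : F.cat.Edge) ∧
      Relation.ReflTransGen (F.zigzag hρ hw).Linked (⟨main (k, i), h⟩ : F.cat.Edge)
        (⟨main (k, 0), hm0⟩ : F.cat.Edge) := by
    intro i
    induction i with
    | zero => intro h; exact ⟨.refl, .refl⟩
    | succ i ih =>
      intro h
      have h' := (main_mem_tail hn hk).1 h
      have hi : main (k, i) ∈ F.cat.edges := (main_mem_tail hn hk).2 (by omega)
      have h1 := linked ⟨main (k, i), hi⟩ ⟨main (k, i + 1), h⟩ ⟨(k, i + 1), hvert _ h'⟩
        ⟨i, Nat.zero_le _, .inl rfl⟩ ⟨i + 1, Nat.zero_le _, .inl rfl⟩ (Nat.succ_ne_zero i)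
        ((F.incident_iff_code hρ hw).2 (.inr rfl)) ((F.incident_iff_code hρ hw).2 (.inl rfl))
      exact ⟨(ih hi).1.trans h1.1, h1.2.trans (ih hi).2⟩
  have key2 : ∀ f ∈ F.pendantFrom k 0,
      Relation.ReflTransGen (F.zigzag hρ hw).Linked (⟨main (k, 0), hm0⟩ : F.cat.Edge) f ∧
      Relation.ReflTransGen (F.zigzag hρ hw).Linked f (⟨main (k, 0), hm0⟩ : F.cat.Edge) := by
    rintro ⟨c, hc⟩ ⟨i, -, rfl | rfl⟩
    · exact key i hc
    · have h' := (sec_mem_tail hn hk).1 hc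
      have hi : main (k, i) ∈ F.cat.edges := (main_mem_tail hn hk).2 h'.1
      have h1 := linked ⟨main (k, i), hi⟩ ⟨sec (k, i), hc⟩ ⟨(k, i), hvert _ h'.1⟩
        ⟨i, Nat.zero_le _, .inl rfl⟩ ⟨i, Nat.zero_le _, .inr rfl⟩ (by simp only; omega)
        ((F.incident_iff_code hρ hw).2 (.inl rfl)) ((F.incident_iff_code hρ hw).2 (.inl rfl))
      exact ⟨(key i hi).1.trans h1.1, h1.2.trans (key i hi).2⟩
  ext f
  exact ⟨fun hf => F.component_subset hρ hw he hf, fun hf => (key2 e he).2.trans (key2 f hf).1⟩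

/-- The only inner vertex of such an end lies in the subgraph, so nothing is linked to the end: it
is a tail with a single edge. -/
lemma isTailComponent_leaf {e : F.cat.Edge} {v : F.cat.Vert} (hv : v.1.2 = 0 ∨ v.1.1 < F.N + 2)
    (hnear : F.cat.near e = some v) (hfar : F.cat.far e = none) (he : Even (F.cat.flow e.1)) :
    (F.cover ρ hρ w hw).IsTailComponent (F.zigzag hρ hw) e := by
  have hcomp : (F.zigzag hρ hw).component e = {e} := by
    ext f
    constructor
    · intro hf
      replace hf : Relation.ReflTransGen (F.zigzag hρ hw).Linked e f := hf
      induction hf with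
      | refl => rfl
      | @tail b c _ h ih =>
        obtain rfl : b = e := ih
        obtain ⟨-, v', hv', h1, -⟩ := h
        replace h1 := (F.incident_iff hρ hw).1 h1
        rw [hnear, hfar] at h1
        rcases h1 with h1 | h1
        · obtain rfl := Option.some.inj h1
          exact absurd hv hv'
        · exact absurd h1 (by simp)
    · rintro rfl; exact Relation.ReflTransGen.refl
  obtain ⟨k, hk⟩ := he
  have hwt : (F.cover ρ hρ w hw).wt e = 2 * k.natAbs := by rw [wt_eq]; omega
  refine ⟨k.natAbs, e, ?_⟩
  rw [hcomp]
  rcases lt_or_gt_of_ne (F.cat.flow_ne e.2) with h | h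
  · exact .inr ⟨v, hv, (F.src_of_neg h).trans hnear, TropicalCover.IsTail.leaf (C := F.cover ρ hρ w hw) (far := (F.cover ρ hρ w hw).tgt) e hwt ((F.tgt_of_neg h).trans hfar)⟩
  · exact .inl ⟨v, hv, (F.tgt_of_pos h).trans hnear, TropicalCover.IsTail.leaf (C := F.cover ρ hρ w hw) (far := (F.cover ρ hρ w hw).src) e hwt ((F.src_of_pos h).trans hfar)⟩

lemma isTailComponent {e : F.cat.Edge} (he : ¬ F.zigzagCode e.1) :
    (F.cover ρ hρ w hw).IsTailComponent (F.zigzag hρ hw) e := by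
  have upper : ∀ k, F.N + 2 ≤ k → k < F.M → e ∈ F.pendantFrom k 0 →
      (F.cover ρ hρ w hw).IsTailComponent (F.zigzag hρ hw) e := by
    intro k hk hM hek
    have h0 : (k, 0) ∈ F.cat.verts := F.spine_mem_verts hM
    rcases F.node_cases_upper hk hM with ⟨x, hn, hx⟩ | ⟨x, j, hn, hx⟩
    · obtain ⟨c, hc⟩ := e
      obtain ⟨i, -, rfl | rfl⟩ := hek
      · have hi := (F.mem_cat.1 (F.cat.main_mem.1 hc)).2
        rw [hn] at hi
        simp only [Node.p] at hi
        obtain rfl : i = 0 := by omega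
        refine F.isTailComponent_leaf hρ hw (v := ⟨(k, 0), h0⟩) (.inl rfl)
          (by rw [Caterpillar.near_eq_some]; rfl) (by rw [far_main_eq_none, hn]; rfl) ?_
        rw [flow_main, hn]; exact hx
      · have hi := (F.cat.sec_mem.1 hc).2
        rw [hasSec_eq, hn] at hi
        simp [Node.hasSec] at hi
    · have hm0 : main (k, 0) ∈ F.cat.edges := (main_mem_tail hn hM).2 (by omega)
      have hnear : F.cat.near ⟨main (k, 0), hm0⟩ = some ⟨(k, 0), h0⟩ := by
        rw [Caterpillar.near_eq_some]; rfl
      have hflow : ∀ f ∈ F.pendantFrom k 0, (0 < x → 0 < F.cat.flow f.1) ∧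
          (x < 0 → F.cat.flow f.1 < 0) := by
        rintro ⟨c, hc⟩ ⟨i, -, rfl | rfl⟩
        · simp only [flow_main, hn, Node.fm]; split_ifs <;> omega
        · simp only [flow_sec, hn, Node.fs]; omega
      refine ⟨1, ⟨main (k, 0), hm0⟩, ?_⟩
      rw [F.component_tail hρ hw hn hM hk hek]
      rcases hx with hx' | hx'
      · have h1 : ∀ f ∈ F.pendantFrom k 0, 0 < F.cat.flow f.1 := fun f hf =>
          (hflow f hf).1 (by omega)
        exact .inl ⟨(⟨(k, 0), h0⟩ : F.cat.Vert), .inl rfl,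
          (F.tgt_of_pos (h1 _ ⟨0, le_rfl, .inl rfl⟩)).trans hnear,
          isTail_pendantFrom hρ hw hn hM
            (fun f hf => ⟨F.tgt_of_pos (h1 f hf), F.src_of_pos (h1 f hf)⟩) (.inl hx') (Nat.zero_le j) hm0⟩
      · have h1 : ∀ f ∈ F.pendantFrom k 0, F.cat.flow f.1 < 0 := fun f hf =>
          (hflow f hf).2 (by omega)
        exact .inr ⟨(⟨(k, 0), h0⟩ : F.cat.Vert), .inl rfl,
          (F.src_of_neg (h1 _ ⟨0, le_rfl, .inl rfl⟩)).trans hnear,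
          isTail_pendantFrom hρ hw hn hM
            (fun f hf => ⟨F.src_of_neg (h1 f hf), F.tgt_of_neg (h1 f hf)⟩) (.inr hx') (Nat.zero_le j) hm0⟩
  obtain ⟨c, hc⟩ := e
  rcases c with k | ⟨k, i⟩ | ⟨k, i⟩
  · exact absurd True.intro he
  · have hv := F.cat.main_mem.1 hc
    have hv' := F.mem_cat.1 hv
    by_cases hk : k < F.N + 2
    · have h1 : ¬ (i < (F.node k).p ∨ Odd ((F.node k).fm i)) := fun h => he ⟨hk, h⟩
      rw [not_or, Int.not_odd_iff_even] at h1
      exact F.isTailComponent_leaf hρ hw (v := ⟨(k, i), hv⟩) (.inr hk)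
        (by rw [Caterpillar.near_eq_some]; rfl) (by rw [far_main_eq_none]; omega) h1.2
    · exact upper k (not_lt.1 hk) hv'.1 ⟨i, Nat.zero_le _, .inl rfl⟩
  · have hv := (F.cat.sec_mem.1 hc).1
    have hv' := F.mem_cat.1 hv
    by_cases hk : k < F.N + 2
    · have h1 : ¬ Odd ((F.node k).fs i) := fun h => he ⟨hk, h⟩
      rw [Int.not_odd_iff_even] at h1
      exact F.isTailComponent_leaf hρ hw (v := ⟨(k, i), hv⟩) (.inr hk)
        (by rw [Caterpillar.near_eq_some]; rfl)
        (by rw [far_sec_eq_none]; exact .inl (F.link_lower hk i)) h1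
    · exact upper k (not_lt.1 hk) hv'.1 ⟨i, Nat.zero_le _, .inr rfl⟩

variable {s t : ℕ} (hs : s = F.numPairs) (ht : t = F.numSimple)

include hs in
lemma isZigzagSubgraph : (F.cover ρ hρ w hw).IsZigzagSubgraph (PointDistribution.trivial s t w hw)
    (F.zigzag hρ hw) where
  connected := F.zigzag_connected hρ hw
  disjoint_symTwo _ he := F.zigzag_disjoint_symTwo hρ hw hs he
  contractible_mem _ h := F.zigzag_contractible_mem hρ hw hs h
  odd_of_mem _ he h := F.zigzag_odd hρ hw hs he h
  tails _ he := F.isTailComponent hρ hw he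

end Config

/-! ### Local pictures over the pairs, and the characteristic edge -/

namespace Config

variable (F : Config) {ρ : ℕ → Equiv.Perm ℕ}

lemma src_eq_some_of_pos {c : EdgeCode} (hc : c ∈ F.cat.edges) {v : F.cat.Vert} (h : 0 < F.cat.flow c)
    (h' : F.cat.farCode c = some v.1) : F.cat.src ⟨c, hc⟩ = some v := by
  rw [src_of_pos F h, Caterpillar.far_eq_some, h']

lemma src_eq_some_of_neg {c : EdgeCode} (hc : c ∈ F.cat.edges) {v : F.cat.Vert} (h : F.cat.flow c < 0)
    (h' : Caterpillar.nearCode c = v.1) : F.cat.src ⟨c, hc⟩ = some v := by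
  rw [src_of_neg F h, Caterpillar.near_eq_some, h']

lemma tgt_eq_some_of_pos {c : EdgeCode} (hc : c ∈ F.cat.edges) {v : F.cat.Vert} (h : 0 < F.cat.flow c)
    (h' : Caterpillar.nearCode c = v.1) : F.cat.tgt ⟨c, hc⟩ = some v := by
  rw [tgt_of_pos F h, Caterpillar.near_eq_some, h']

lemma tgt_eq_some_of_neg {c : EdgeCode} (hc : c ∈ F.cat.edges) {v : F.cat.Vert} (h : F.cat.flow c < 0)
    (h' : F.cat.farCode c = some v.1) : F.cat.tgt ⟨c, hc⟩ = some v := by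
  rw [tgt_of_neg F h, Caterpillar.far_eq_some, h']

variable (hρ : ∀ c < F.n, ρ 0 c < F.n) {w : ℕ → ℝ} (hw : StrictMono w)

/-- Over a pair consisting of a vertex of the spine and the root of its pendant, there is
an admissible local picture. -/
lemma localPicture_base {k : ℕ} (hk : k < F.N) : ∃ v₁ v₂ : F.cat.Vert,
    F.height ρ v₁.1 = 2 * (F.n + F.N - k) ∧ F.height ρ v₂.1 = 2 * (F.n + F.N - k) + 1 ∧
    (F.cover ρ hρ w hw).LocalPicture v₁ v₂ := by
  have hN := F.N_eq
  have hM := F.N_add_two_lt_M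
  have hp := F.p_pos hk
  have hs0 := F.s_neg hk.le
  have hs1 := F.s_neg (show k + 1 ≤ F.N from hk)
  have h0 : (k, 0) ∈ F.cat.verts := F.spine_mem_verts (by omega)
  have h1 : (k, 1) ∈ F.cat.verts := F.mem_cat.2 ⟨by omega, hp⟩
  have hk0 : spine k ∈ F.cat.edges := by rw [Caterpillar.spine_mem, cat_M]; omega
  have hk1 : spine (k + 1) ∈ F.cat.edges := by rw [Caterpillar.spine_mem, cat_M]; omega
  have hm0 : main (k, 0) ∈ F.cat.edges := F.cat.main_mem.2 h0
  have hm1 : main (k, 1) ∈ F.cat.edges := F.cat.main_mem.2 h1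
  have hval : F.cat.flow (main (k, 0)) = (F.node k).val := rfl
  have hfm : F.cat.flow (main (k, 1)) = (F.node k).fm 1 := rfl
  have hfs : F.cat.flow (sec (k, 1)) = (F.node k).fs 1 := rfl
  have hsec : F.cat.hasSec (k, 1) = (F.node k).hasSec 1 := rfl
  have hlink : F.cat.link (k, 1) = (F.node k).link 1 := rfl
  have hd : F.cat.tgt ⟨spine (k + 1), hk1⟩ = some ⟨(k, 0), h0⟩ :=
    F.tgt_eq_some_of_neg hk1 hs1 rfl
  have hd' : (⟨spine (k + 1), hk1⟩ : F.cat.Edge) ≠ ⟨main (k, 0), hm0⟩ := fun h => by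
    simpa using congrArg Subtype.val h
  have hb : F.cat.src ⟨spine k, hk0⟩ = some ⟨(k, 0), h0⟩ := F.src_eq_some_of_neg hk0 hs0 rfl
  have hb' : F.cat.tgt ⟨spine k, hk0⟩ ≠ some ⟨(k, 1), h1⟩ := by
    rw [F.tgt_of_neg (e := ⟨spine k, hk0⟩) hs0, Ne, Caterpillar.far_eq_some]
    rcases k with _ | k <;> simp [Caterpillar.farCode]
  have hbm : (⟨spine k, hk0⟩ : F.cat.Edge) ≠ ⟨main (k, 0), hm0⟩ := fun h => by
    simpa using congrArg Subtype.val h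
  have pos : 0 < (F.node k).val →
      (F.cover ρ hρ w hw).LocalPicture (⟨(k, 1), h1⟩ : F.cat.Vert) (⟨(k, 0), h0⟩ : F.cat.Vert) →
      ∃ v₁ v₂ : F.cat.Vert,
      F.height ρ v₁.1 = 2 * (F.n + F.N - k) ∧ F.height ρ v₂.1 = 2 * (F.n + F.N - k) + 1 ∧
      (F.cover ρ hρ w hw).LocalPicture v₁ v₂ := fun h hl =>
    ⟨⟨(k, 1), h1⟩, ⟨(k, 0), h0⟩, by simp only [F.height_one hk, if_pos h]; rfl,
      by simp only [F.height_zero hk, if_pos h], hl⟩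
  have neg : (F.node k).val < 0 →
      (F.cover ρ hρ w hw).LocalPicture (⟨(k, 0), h0⟩ : F.cat.Vert) (⟨(k, 1), h1⟩ : F.cat.Vert) →
      ∃ v₁ v₂ : F.cat.Vert,
      F.height ρ v₁.1 = 2 * (F.n + F.N - k) ∧ F.height ρ v₂.1 = 2 * (F.n + F.N - k) + 1 ∧
      (F.cover ρ hρ w hw).LocalPicture v₁ v₂ := fun h hl =>
    ⟨⟨(k, 0), h0⟩, ⟨(k, 1), h1⟩, by simp only [F.height_zero hk, if_neg h.not_gt]; rfl,
      by simp only [F.height_one hk, if_neg h.not_gt], hl⟩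
  have posc : 0 < (F.node k).val → F.cat.src ⟨main (k, 0), hm0⟩ = some ⟨(k, 1), h1⟩ ∧
      F.cat.tgt ⟨main (k, 0), hm0⟩ = some ⟨(k, 0), h0⟩ := fun h =>
    ⟨F.src_eq_some_of_pos hm0 h rfl, F.tgt_eq_some_of_pos hm0 h rfl⟩
  have negc : (F.node k).val < 0 → F.cat.src ⟨main (k, 0), hm0⟩ = some ⟨(k, 0), h0⟩ ∧
      F.cat.tgt ⟨main (k, 0), hm0⟩ = some ⟨(k, 1), h1⟩ := fun h =>
    ⟨F.src_eq_some_of_neg hm0 h rfl, F.tgt_eq_some_of_neg hm0 h rfl⟩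
  rcases F.node_cases_lower (by omega : k < F.N + 2) with ⟨a, b, h, -, hab⟩ | ⟨i, hi, -, h⟩ | ⟨h, -⟩
  · have hs1 : sec (k, 1) ∈ F.cat.edges := F.cat.sec_mem.2 ⟨h1, by rw [hsec, h]; rfl⟩
    have hne : (⟨main (k, 1), hm1⟩ : F.cat.Edge) ≠ ⟨sec (k, 1), hs1⟩ := fun h => by
      simpa using congrArg Subtype.val h
    have hne1 : (⟨main (k, 1), hm1⟩ : F.cat.Edge) ≠ ⟨main (k, 0), hm0⟩ := fun h => by
      simpa using congrArg Subtype.val h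
    have hne2 : (⟨sec (k, 1), hs1⟩ : F.cat.Edge) ≠ ⟨main (k, 0), hm0⟩ := fun h => by
      simpa using congrArg Subtype.val h
    have hf1 : F.cat.far ⟨main (k, 1), hm1⟩ = none := by rw [far_main_eq_none, h]; rfl
    have hf2 : F.cat.far ⟨sec (k, 1), hs1⟩ = none := by rw [far_sec_eq_none, h]; exact .inl rfl
    have hv : (F.node k).val = a + b := by rw [h]; rfl
    have hma : F.cat.flow (main (k, 1)) = a := by rw [hfm, h]; rfl
    have hsb : F.cat.flow (sec (k, 1)) = b := by rw [hfs, h]; rfl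
    -- Two equal ends form a symmetric fork, which gives `splitSplit` or `mergeMerge`. Two odd ends
    -- of opposite directions give `splitMerge`, and the sign of their sum tells whether the
    -- splitting takes place on the spine or in the pendant.
    rcases hab with ⟨rfl, ha⟩ | ⟨-, -, hab, hne0⟩
    · have hwt : (F.cat.flow (main (k, 1))).natAbs = (F.cat.flow (sec (k, 1))).natAbs := by
        rw [hma, hsb]
      rcases lt_or_gt_of_ne ha with ha | ha
      · have e1 : F.cat.src ⟨main (k, 1), hm1⟩ = some ⟨(k, 1), h1⟩ :=
          F.src_eq_some_of_neg hm1 (by omega) rfl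
        have e2 : F.cat.src ⟨sec (k, 1), hs1⟩ = some ⟨(k, 1), h1⟩ :=
          F.src_eq_some_of_neg hs1 (by omega) rfl
        have e3 : F.cat.tgt ⟨main (k, 1), hm1⟩ = none := (F.tgt_of_neg (by simp only; omega)).trans hf1
        have e4 : F.cat.tgt ⟨sec (k, 1), hs1⟩ = none := (F.tgt_of_neg (by simp only; omega)).trans hf2
        exact neg (by omega) (.splitSplit (C := F.cover ρ hρ w hw) (⟨main (k, 0), hm0⟩ : F.cat.Edge)
          (⟨main (k, 1), hm1⟩ : F.cat.Edge) (⟨sec (k, 1), hs1⟩ : F.cat.Edge) (⟨spine k, hk0⟩ : F.cat.Edge)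
          (negc (by omega)) e1 e2 ⟨hne, hwt, e1.trans e2.symm, e3.trans e4.symm⟩ hb hbm)
      · have e1 : F.cat.tgt ⟨main (k, 1), hm1⟩ = some ⟨(k, 1), h1⟩ :=
          F.tgt_eq_some_of_pos hm1 (by omega) rfl
        have e2 : F.cat.tgt ⟨sec (k, 1), hs1⟩ = some ⟨(k, 1), h1⟩ :=
          F.tgt_eq_some_of_pos hs1 (by omega) rfl
        have e3 : F.cat.src ⟨main (k, 1), hm1⟩ = none := (F.src_of_pos (by simp only; omega)).trans hf1
        have e4 : F.cat.src ⟨sec (k, 1), hs1⟩ = none := (F.src_of_pos (by simp only; omega)).trans hf2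
        exact pos (by omega) (.mergeMerge (C := F.cover ρ hρ w hw) (⟨main (k, 0), hm0⟩ : F.cat.Edge)
          (⟨main (k, 1), hm1⟩ : F.cat.Edge) (⟨sec (k, 1), hs1⟩ : F.cat.Edge)
          (⟨spine (k + 1), hk1⟩ : F.cat.Edge)
          (posc (by omega)) e1 e2 ⟨hne, hwt, e3.trans e4.symm, e1.trans e2.symm⟩ hd hd')
    · rcases lt_or_gt_of_ne hne0 with h2 | h2
      · rcases mul_neg_iff.1 hab with ⟨ha, -⟩ | ⟨-, ha⟩
        · exact neg (by omega) (.splitMerge (C := F.cover ρ hρ w hw) (⟨main (k, 0), hm0⟩ : F.cat.Edge)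
            (⟨spine k, hk0⟩ : F.cat.Edge) (⟨main (k, 1), hm1⟩ : F.cat.Edge) (negc (by omega)) hb hb'
            (F.tgt_eq_some_of_pos hm1 (by omega) rfl) hne1)
        · exact neg (by omega) (.splitMerge (C := F.cover ρ hρ w hw) (⟨main (k, 0), hm0⟩ : F.cat.Edge)
            (⟨spine k, hk0⟩ : F.cat.Edge) (⟨sec (k, 1), hs1⟩ : F.cat.Edge) (negc (by omega)) hb hb'
            (F.tgt_eq_some_of_pos hs1 (by omega) rfl) hne2)
      · rcases mul_neg_iff.1 hab with ⟨-, ha⟩ | ⟨ha, -⟩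
        · have e3 : F.cat.tgt ⟨sec (k, 1), hs1⟩ = none :=
            (F.tgt_of_neg (by simp only; omega)).trans hf2
          exact pos (by omega) (.splitMerge (C := F.cover ρ hρ w hw) (⟨main (k, 0), hm0⟩ : F.cat.Edge)
            (⟨sec (k, 1), hs1⟩ : F.cat.Edge) (⟨spine (k + 1), hk1⟩ : F.cat.Edge) (posc (by omega))
            (F.src_eq_some_of_neg hs1 (by omega) rfl)
            (fun h => by have := e3.symm.trans h; simp at this) hd hd')
        · have e3 : F.cat.tgt ⟨main (k, 1), hm1⟩ = none :=
            (F.tgt_of_neg (by simp only; omega)).trans hf1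
          exact pos (by omega) (.splitMerge (C := F.cover ρ hρ w hw) (⟨main (k, 0), hm0⟩ : F.cat.Edge)
            (⟨main (k, 1), hm1⟩ : F.cat.Edge) (⟨spine (k + 1), hk1⟩ : F.cat.Edge) (posc (by omega))
            (F.src_eq_some_of_neg hm1 (by omega) rfl)
            (fun h => by have := e3.symm.trans h; simp at this) hd hd')
  -- In a birth, the edge of weight 3 splits into an outward end and the edge that merges with the
  -- spine.
  · have hs1 : sec (k, 1) ∈ F.cat.edges := F.cat.sec_mem.2 ⟨h1, by rw [hsec, h]; rfl⟩
    have hf2 : F.cat.far ⟨sec (k, 1), hs1⟩ = none := by rw [far_sec_eq_none, h]; exact .inl rfl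
    have hv : (F.node k).val = 2 := by rw [h]; rfl
    have hsb : F.cat.flow (sec (k, 1)) = -1 := by rw [hfs, h]; rfl
    have e3 : F.cat.tgt ⟨sec (k, 1), hs1⟩ = none := (F.tgt_of_neg (by simp only; omega)).trans hf2
    exact pos (by omega) (.splitMerge (C := F.cover ρ hρ w hw) (⟨main (k, 0), hm0⟩ : F.cat.Edge)
      (⟨sec (k, 1), hs1⟩ : F.cat.Edge) (⟨spine (k + 1), hk1⟩ : F.cat.Edge) (posc (by omega))
      (F.src_eq_some_of_neg hs1 (by omega) rfl)
      (fun h => by have := e3.symm.trans h; simp at this) hd hd')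
  · omega

/-- At the outer pair of a birth, a fork of two ends of weight 1 merges into an edge of weight 2,
which a third end joins. -/
lemma localPicture_birth {i : ℕ} (hi : i < F.n) : ∃ v₁ v₂ : F.cat.Vert,
    F.height ρ v₁.1 = 2 * (1 + ρ 0 i) ∧ F.height ρ v₂.1 = 2 * (1 + ρ 0 i) + 1 ∧
    (F.cover ρ hρ w hw).LocalPicture v₁ v₂ := by
  have hN := F.N_eq
  have hM := F.N_add_two_lt_M
  have h := F.node_birth hi
  have hp : (F.node (F.N₀ + i)).p = 3 := by rw [h]; rfl
  have h2 : (F.N₀ + i, 2) ∈ F.cat.verts := F.mem_cat.2 ⟨by omega, by omega⟩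
  have h3 : (F.N₀ + i, 3) ∈ F.cat.verts := F.mem_cat.2 ⟨by omega, by omega⟩
  have hm2 : main (F.N₀ + i, 2) ∈ F.cat.edges := F.cat.main_mem.2 h2
  have hm3 : main (F.N₀ + i, 3) ∈ F.cat.edges := F.cat.main_mem.2 h3
  have hs2 : sec (F.N₀ + i, 2) ∈ F.cat.edges := F.cat.sec_mem.2 ⟨h2, by rw [hasSec_eq, h]; rfl⟩
  have hs3 : sec (F.N₀ + i, 3) ∈ F.cat.edges := F.cat.sec_mem.2 ⟨h3, by rw [hasSec_eq, h]; rfl⟩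
  have f2 : F.cat.flow (main (F.N₀ + i, 2)) = 2 := by rw [flow_main, h]; rfl
  have f3 : F.cat.flow (main (F.N₀ + i, 3)) = 1 := by rw [flow_main, h]; rfl
  have g2 : F.cat.flow (sec (F.N₀ + i, 2)) = 1 := by rw [flow_sec, h]; rfl
  have g3 : F.cat.flow (sec (F.N₀ + i, 3)) = 1 := by rw [flow_sec, h]; rfl
  have e1 : F.cat.tgt ⟨main (F.N₀ + i, 3), hm3⟩ = some ⟨(F.N₀ + i, 3), h3⟩ :=
    F.tgt_eq_some_of_pos hm3 (by omega) rfl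
  have e2 : F.cat.tgt ⟨sec (F.N₀ + i, 3), hs3⟩ = some ⟨(F.N₀ + i, 3), h3⟩ :=
    F.tgt_eq_some_of_pos hs3 (by omega) rfl
  have e3 : F.cat.src ⟨main (F.N₀ + i, 3), hm3⟩ = none :=
    (F.src_of_pos (by simp only; omega)).trans (by rw [far_main_eq_none, h]; rfl)
  have e4 : F.cat.src ⟨sec (F.N₀ + i, 3), hs3⟩ = none :=
    (F.src_of_pos (by simp only; omega)).trans (by rw [far_sec_eq_none, h]; exact .inl rfl)
  refine ⟨⟨(F.N₀ + i, 3), h3⟩, ⟨(F.N₀ + i, 2), h2⟩, F.height_three hi, F.height_two hi, ?_⟩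
  refine .mergeMerge (C := F.cover ρ hρ w hw) (⟨main (F.N₀ + i, 2), hm2⟩ : F.cat.Edge)
    (⟨main (F.N₀ + i, 3), hm3⟩ : F.cat.Edge) (⟨sec (F.N₀ + i, 3), hs3⟩ : F.cat.Edge)
    (⟨sec (F.N₀ + i, 2), hs2⟩ : F.cat.Edge)
    ⟨F.src_eq_some_of_pos hm2 (by omega) rfl, F.tgt_eq_some_of_pos hm2 (by omega) rfl⟩ e1 e2
    ⟨fun h => ?_, ?_, e3.trans e4.symm, e1.trans e2.symm⟩ (F.tgt_eq_some_of_pos hs2 (by omega) rfl)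
    (fun h => ?_)
  · simpa using congrArg Subtype.val h
  · rw [wt_eq, wt_eq, f3, g3]
  · simpa using congrArg Subtype.val h

section First

lemma low_mem : (F.N, 0) ∈ F.cat.verts :=
  F.spine_mem_verts (by have := F.N_add_two_lt_M; omega)
lemma up_mem : (F.N + 1, 0) ∈ F.cat.verts :=
  F.spine_mem_verts (by have := F.N_add_two_lt_M; omega)
lemma peak_mem : (F.N + 2, 0) ∈ F.cat.verts := F.spine_mem_verts (F.N_add_two_lt_M)
lemma spine_mem {k : ℕ} (h : k ≤ F.N + 3) : spine k ∈ F.cat.edges := by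
  have := F.N_add_two_lt_M
  rw [Caterpillar.spine_mem, cat_M]; omega

lemma src_first : F.cat.src ⟨spine (F.N + 1), F.spine_mem (by omega)⟩ = some ⟨(F.N, 0), F.low_mem⟩ :=
  F.src_eq_some_of_pos _ (by rw [flow_spine, s_up]; have := F.o_ge; omega) rfl
lemma tgt_first : F.cat.tgt ⟨spine (F.N + 1), F.spine_mem (by omega)⟩ = some ⟨(F.N + 1, 0), F.up_mem⟩ :=
  F.tgt_eq_some_of_pos _ (by rw [flow_spine, s_up]; have := F.o_ge; omega) rfl
lemma src_low : F.cat.src ⟨spine F.N, F.spine_mem (by omega)⟩ = some ⟨(F.N, 0), F.low_mem⟩ :=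
  F.src_eq_some_of_neg _ (by rw [flow_spine, s_low]; omega) rfl
lemma tgt_low_ne {i : ℕ} (h : (F.N + 1, i) ∈ F.cat.verts) :
    F.cat.tgt ⟨spine F.N, F.spine_mem (by omega)⟩ ≠ some ⟨(F.N + 1, i), h⟩ := by
  rw [F.tgt_of_neg (e := ⟨spine F.N, _⟩) (by rw [flow_spine, s_low]; omega), Ne, Caterpillar.far_eq_some]
  have key : ∀ k, F.cat.farCode (spine k) ≠ some (k + 1, i) := by
    rintro (_ | k) <;> simp [Caterpillar.farCode]; omega
  exact key _
lemma tgt_up_end : F.cat.tgt ⟨main (F.N + 1, 0), F.cat.main_mem.2 F.up_mem⟩ =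
    some ⟨(F.N + 1, 0), F.up_mem⟩ :=
  F.tgt_eq_some_of_pos _ (by rw [flow_main, node_up]; simp only [Node.fm]; have := F.o_ge; omega) rfl
lemma tgt_low_end : F.cat.tgt ⟨main (F.N, 0), F.cat.main_mem.2 F.low_mem⟩ = some ⟨(F.N, 0), F.low_mem⟩ :=
  F.tgt_eq_some_of_pos _ (by rw [flow_main, node_low]; simp only [Node.fm]; have := F.o_ge; omega) rfl
lemma src_up_end : F.cat.src ⟨main (F.N + 1, 0), F.cat.main_mem.2 F.up_mem⟩ = none :=
  (F.src_of_pos (by rw [flow_main, node_up]; simp only [Node.fm]; have := F.o_ge; omega)).trans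
    (by rw [far_main_eq_none, node_up]; rfl)
lemma src_low_end : F.cat.src ⟨main (F.N, 0), F.cat.main_mem.2 F.low_mem⟩ = none :=
  (F.src_of_pos (by rw [flow_main, node_low]; simp only [Node.fm]; have := F.o_ge; omega)).trans
    (by rw [far_main_eq_none, node_low]; rfl)
lemma src_char : F.cat.src ⟨spine (F.N + 2), F.spine_mem (by omega)⟩ = some ⟨(F.N + 1, 0), F.up_mem⟩ :=
  F.src_eq_some_of_pos _ (by rw [flow_spine, s_char]; have := F.o_ge; omega) rfl
lemma tgt_char : F.cat.tgt ⟨spine (F.N + 2), F.spine_mem (by omega)⟩ = some ⟨(F.N + 2, 0), F.peak_mem⟩ :=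
  F.tgt_eq_some_of_pos _ (by rw [flow_spine, s_char]; have := F.o_ge; omega) rfl
lemma tgt_last : F.cat.tgt ⟨spine (F.N + 3), F.spine_mem le_rfl⟩ = some ⟨(F.N + 2, 0), F.peak_mem⟩ :=
  F.tgt_eq_some_of_neg _ (by have := F.s_sp_neg (Nat.zero_le F.K); rwa [add_zero] at this) rfl

/-- The first end of weight `o` splits into a spine edge of weight 1 and an edge of weight `o - 1`,
which the second end of weight `o` joins. -/
lemma localPicture_first : (F.cover ρ hρ w hw).LocalPicture
    (⟨(F.N, 0), F.low_mem⟩ : F.cat.Vert) (⟨(F.N + 1, 0), F.up_mem⟩ : F.cat.Vert) :=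
  .splitMerge (C := F.cover ρ hρ w hw) (⟨spine (F.N + 1), F.spine_mem (by omega)⟩ : F.cat.Edge)
    (⟨spine F.N, F.spine_mem (by omega)⟩ : F.cat.Edge)
    (⟨main (F.N + 1, 0), F.cat.main_mem.2 F.up_mem⟩ : F.cat.Edge) ⟨F.src_first, F.tgt_first⟩
    F.src_low (F.tgt_low_ne _) F.tgt_up_end (fun h => by simpa using congrArg Subtype.val h)

end First

variable {s t : ℕ} (hs : s = F.numPairs) (ht : t = F.numSimple)

include hs in
lemma isResolving : (F.cover ρ hρ w hw).IsResolving (PointDistribution.trivial s t w hw) := by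
  subst hs
  rintro ⟨b, hb⟩
  suffices h : ∃ v₁ v₂ : F.cat.Vert, F.height ρ v₁.1 = 2 * b ∧ F.height ρ v₂.1 = 2 * b + 1 ∧
      (F.cover ρ hρ w hw).LocalPicture v₁ v₂ by
    obtain ⟨v₁, v₂, h1, h2, h3⟩ := h
    exact ⟨v₁, v₂, congrArg w h1, congrArg w h2, h3⟩
  obtain ⟨x, hx, hlow, hxb⟩ := F.exists_lower hρ hb 0 (by omega)
  have hN := F.N_eq
  rcases F.lower_cases hx hlow with ⟨k, hk, rfl⟩ | ⟨k, hk, rfl⟩ | ⟨i, hi, rfl⟩ | ⟨i, hi, rfl⟩ | rfl | rfl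
  · rw [F.height_zero hk] at hxb
    obtain rfl : b = F.n + F.N - k := by split_ifs at hxb <;> omega
    exact F.localPicture_base hρ hw hk
  · rw [F.height_one hk] at hxb
    obtain rfl : b = F.n + F.N - k := by split_ifs at hxb <;> omega
    exact F.localPicture_base hρ hw hk
  · rw [F.height_two hi] at hxb; omega
  · rw [F.height_three hi] at hxb
    obtain rfl : b = 1 + ρ 0 i := by omega
    exact F.localPicture_birth hρ hw hi
  · rw [height_low] at hxb
    obtain rfl : b = 0 := by omega
    exact ⟨_, _, F.height_low _, F.height_up _, F.localPicture_first hρ hw⟩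
  · rw [height_up] at hxb; omega

lemma reachable_char {u v : F.cat.Vert} (h : u.1.1 < F.N + 2 ↔ v.1.1 < F.N + 2) :
    (F.cat.codeGraph {c | c ≠ spine (F.N + 2)}).Reachable u v := by
  have key : ∀ (a b : ℕ) (hab : a ≤ b) (ha : (a, 0) ∈ F.cat.verts) (hb : (b, 0) ∈ F.cat.verts),
      (a < F.N + 2 ↔ b < F.N + 2) →
      (F.cat.codeGraph {c | c ≠ spine (F.N + 2)}).Reachable ⟨(a, 0), ha⟩ ⟨(b, 0), hb⟩ := by
    intro a b hab ha hb h
    refine F.cat.reachable_spine hab ha hb fun j h1 h2 => ?_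
    simp only [Set.mem_ofPred_eq, ne_eq, Sum.inl.injEq]
    omega
  have hroot : ∀ v : F.cat.Vert, (v.1.1, 0) ∈ F.cat.verts := fun v =>
    F.spine_mem_verts (F.mem_cat.1 v.2).1
  have hpend : ∀ v : F.cat.Vert, (F.cat.codeGraph {c | c ≠ spine (F.N + 2)}).Reachable
      ⟨(v.1.1, 0), hroot v⟩ v := fun v =>
    F.cat.reachable_pendant v.2 (fun j _ => by simp) (hroot v)
  refine (hpend u).symm.trans (SimpleGraph.Reachable.trans ?_ (hpend v))
  rcases le_total u.1.1 v.1.1 with huv | huv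
  · exact key _ _ huv _ _ h
  · exact (key _ _ huv _ _ h.symm).symm

/-- Pendant edges keep the spine index and spine edges change it by one, so the removed edge is the
only passage between the two sides; within a side, vertices are connected through the spine. -/
lemma reachable_char_iff {u v : F.cat.Vert} :
    (F.cat.codeGraph {c | c ≠ spine (F.N + 2)}).Reachable u v ↔
      (u.1.1 < F.N + 2 ↔ v.1.1 < F.N + 2) := by
  refine ⟨F.cat.reachable_const (P := fun v => v.1.1 < F.N + 2) fun u v h => ?_, F.reachable_char⟩
  obtain ⟨-, e, he, h⟩ := F.cat.codeGraph_adj.1 h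
  suffices h' : ∀ x y : F.cat.Vert, F.cat.near e = some x → F.cat.far e = some y →
      (x.1.1 < F.N + 2 ↔ y.1.1 < F.N + 2) by
    rcases h with ⟨h1, h2⟩ | ⟨h1, h2⟩
    · exact h' u v h1 h2
    · exact (h' v u h1 h2).symm
  intro x y hx hy
  rw [Caterpillar.near_eq_some] at hx
  rw [Caterpillar.far_eq_some] at hy
  rw [← hx]
  obtain ⟨c, hc⟩ := e
  rcases c with (_ | k) | z | z
  · simp [Caterpillar.farCode] at hy
  · simp only [Caterpillar.farCode, Option.some.injEq] at hy
    simp only [Set.mem_ofPred_eq, ne_eq, Sum.inl.injEq] at he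
    rw [← hy]; simp only [Caterpillar.nearCode]; omega
  · simp only [Caterpillar.farCode, Option.some.injEq] at hy
    rw [← hy]; simp only [Caterpillar.nearCode]
  · simp only [Caterpillar.farCode] at hy
    split_ifs at hy
    simp only [Option.some.injEq] at hy
    rw [← hy]; simp only [Caterpillar.nearCode]

include hρ hs ht in
lemma separates : ∃ K₁ K₂ : (F.cat.codeGraph {c | c ≠ spine (F.N + 2)}).ConnectedComponent, K₁ ≠ K₂ ∧
    (∀ K, K = K₁ ∨ K = K₂) ∧
    (fun x : F.cat.Vert => w (F.height ρ x.1)) '' K₁.supp =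
      (PointDistribution.trivial s t w hw).pairPoints ∧
    (fun x : F.cat.Vert => w (F.height ρ x.1)) '' K₂.supp =
      (PointDistribution.trivial s t w hw).simplePoints := by
  subst hs ht
  have hsupp : ∀ u : F.cat.Vert,
      ((F.cat.codeGraph {c | c ≠ spine (F.N + 2)}).connectedComponentMk u).supp =
        {v | v.1.1 < F.N + 2 ↔ u.1.1 < F.N + 2} := by
    intro u
    ext v
    rw [SimpleGraph.ConnectedComponent.mem_supp_iff, SimpleGraph.ConnectedComponent.eq,
      reachable_char_iff]
    rfl
  refine ⟨(F.cat.codeGraph _).connectedComponentMk ⟨(F.N, 0), F.low_mem⟩,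
    (F.cat.codeGraph _).connectedComponentMk ⟨(F.N + 2, 0), F.peak_mem⟩, ?_, ?_, ?_, ?_⟩
  · rw [ne_eq, SimpleGraph.ConnectedComponent.eq, reachable_char_iff]
    simp
  · intro K
    induction K using SimpleGraph.ConnectedComponent.ind with
    | h v =>
      rw [SimpleGraph.ConnectedComponent.eq, SimpleGraph.ConnectedComponent.eq, reachable_char_iff,
        reachable_char_iff]
      simp only; omega
  · rw [hsupp, PointDistribution.pairPoints_trivial]
    ext r
    constructor
    · rintro ⟨v, hv, rfl⟩
      have hv' : v.1.1 < F.N + 2 := by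
        have : v.1.1 < F.N + 2 ↔ F.N < F.N + 2 := hv
        omega
      exact ⟨_, F.height_lower_lt hρ v.2 hv', rfl⟩
    · rintro ⟨j, hj, rfl⟩
      obtain ⟨x, hx, hx1, hx2⟩ := F.exists_lower hρ (b := j / 2)
        (by simp only [Set.mem_ofPred_eq] at hj; omega) (j % 2) (by omega)
      refine ⟨⟨x, hx⟩, ?_, congrArg w (by simp only; omega)⟩
      change x.1 < F.N + 2 ↔ F.N < F.N + 2
      omega
  · rw [hsupp, PointDistribution.simplePoints_trivial]
    ext r
    constructor
    · rintro ⟨v, hv, rfl⟩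
      have hv' : F.N + 2 ≤ v.1.1 := by
        have : v.1.1 < F.N + 2 ↔ F.N + 2 < F.N + 2 := hv
        omega
      have hu := F.upper_of_le v.2 hv'
      exact ⟨_, ⟨by rw [F.height_upper hu]; omega, F.height_upper_lt hu⟩, rfl⟩
    · rintro ⟨j, hj, rfl⟩
      simp only [Set.mem_ofPred_eq] at hj
      obtain ⟨⟨k, i⟩, hx, hx2⟩ := F.exists_upper (ρ := ρ) (j := j - 2 * F.numPairs) (by omega)
      have hk := F.mem_upper.1 hx
      refine ⟨⟨(k, i), F.mem_cat.2 hk.1⟩, ?_, congrArg w (by simp only; omega)⟩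
      change k < F.N + 2 ↔ F.N + 2 < F.N + 2
      omega

include hs ht in
-- The edge has the odd flow `2 * o - 1`, starts at the upper vertex of pair 0 and ends at the peak,
-- where it meets the odd spine edge of flow `2 * o - 1 - e` coming from the other side.
lemma isCharacteristicEdge : (F.cover ρ hρ w hw).IsCharacteristicEdge s t w hw (F.zigzag hρ hw)
    (⟨spine (F.N + 2), F.spine_mem (by omega)⟩ : F.cat.Edge) where
  inner := by
    have h1 := F.src_char
    have h2 := F.tgt_char
    exact ⟨fun h => by have := h1.symm.trans h; simp at this,
      fun h => by have := h2.symm.trans h; simp at this⟩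
  odd := by
    rw [wt_eq, Int.natAbs_odd, flow_spine]
    exact F.s_odd (by omega) (F.N_add_two_lt_M).le
  mem := True.intro
  separates := by
    rw [F.graphOn_eq hρ hw {c | c ≠ spine (F.N + 2)} _ (by
      ext e; exact not_congr Subtype.ext_iff)]
    exact F.separates hρ hw hs ht
  start := by
    have hs' : 0 < s := by subst hs; unfold numPairs; omega
    have hflow : ∀ k (h : (k, 0) ∈ F.cat.verts), F.node k = .leaf F.o →
        (F.cover ρ hρ w hw).wt (⟨main (k, 0), F.cat.main_mem.2 h⟩ : F.cat.Edge) = F.o := by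
      intro k h hn
      rw [wt_eq, flow_main, hn]; rfl
    refine ⟨⟨0, hs'⟩, (⟨(F.N, 0), F.low_mem⟩ : F.cat.Vert), (⟨(F.N + 1, 0), F.up_mem⟩ : F.cat.Vert),
      (⟨main (F.N, 0), F.cat.main_mem.2 F.low_mem⟩ : F.cat.Edge),
      (⟨spine F.N, F.spine_mem (by omega)⟩ : F.cat.Edge),
      (⟨spine (F.N + 1), F.spine_mem (by omega)⟩ : F.cat.Edge),
      (⟨main (F.N + 1, 0), F.cat.main_mem.2 F.up_mem⟩ : F.cat.Edge), rfl, F.src_char,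
      congrArg w (F.height_low _), congrArg w (F.height_up _),
      ⟨F.src_low_end, F.tgt_low_end, ?_⟩, ⟨F.src_low, F.tgt_low_ne _, ?_⟩,
      ⟨F.src_first, F.tgt_first, ?_⟩, ⟨F.src_up_end, F.tgt_up_end, ?_⟩, ?_⟩
    · rw [hflow _ F.low_mem F.node_low]; exact F.o_odd
    · rw [wt_eq, Int.natAbs_odd, flow_spine, s_low]; decide
    · rw [wt_eq, Int.natAbs_even, flow_spine]; exact F.s_even
    · rw [hflow _ F.up_mem F.node_up]; exact F.o_odd
    · rw [hflow _ F.up_mem F.node_up, hflow _ F.low_mem F.node_low]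
  finish := by
    subst hs ht
    refine ⟨(⟨(F.N + 2, 0), F.peak_mem⟩ : F.cat.Vert), (⟨spine (F.N + 2), F.spine_mem (by omega)⟩ : F.cat.Edge),
      (⟨spine (F.N + 3), F.spine_mem le_rfl⟩ : F.cat.Edge), F.tgt_char,
      congrArg w F.height_peak, fun h => ?_, F.tgt_char, F.tgt_last, ?_, ?_⟩
    · simpa using congrArg Subtype.val h
    · rw [wt_eq, Int.natAbs_odd, flow_spine]
      exact F.s_odd (by omega) (F.N_add_two_lt_M).le
    · rw [wt_eq, Int.natAbs_odd, flow_spine]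
      exact F.s_odd (by omega) (F.N_add_two_lt_M)

lemma isProperlyMixed {g : ℕ} {lam mu : Multiset ℕ} (hs : s = F.numPairs) (ht : t = F.numSimple)
    (hlam : F.ends 1 = lam) (hmu : F.ends (-1) = mu)
    (hg : 2 * s + t + 2 = 2 * g + lam.card + mu.card) :
    (F.cover ρ hρ w hw).IsProperlyMixed g lam mu s t w hw :=
  ⟨F.hasType hρ hw hs ht hlam hmu hg, F.isResolving hρ hw hs, F.zigzag hρ hw,
    F.isZigzagSubgraph hρ hw hs, _, F.isCharacteristicEdge hρ hw hs ht⟩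

end Config

/-! ### Rigidity: isomorphisms preserve the permutations of the layers -/

namespace Config

variable (F : Config) {ρ ρ' : ℕ → Equiv.Perm ℕ}

lemma adj_pendant {A : Set EdgeCode} {k i : ℕ} {u v : F.cat.Vert} (hu : u.1 = (k, i + 1))
    (h : (F.cat.codeGraph A).Adj u v) : v.1 = (k, i) ∨ v.1 = (k, i + 2) := by
  obtain ⟨-, e, -, h⟩ := F.cat.codeGraph_adj.1 h
  simp only [Caterpillar.near_eq_some, Caterpillar.far_eq_some, hu] at h
  obtain ⟨c, hc⟩ := e
  rcases c with (_ | j) | ⟨j, l⟩ | ⟨j, l⟩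
  · simp [Caterpillar.farCode] at h
  · simp [Caterpillar.farCode, Caterpillar.nearCode] at h
  · simp only [Caterpillar.farCode, Caterpillar.nearCode, Prod.mk.injEq, Option.some.injEq] at h
    rcases h with ⟨⟨rfl, rfl⟩, h⟩ | ⟨h, rfl, h'⟩
    · exact .inr h.symm
    · left; rw [← h]; simp; omega
  · simp only [Caterpillar.farCode, Caterpillar.nearCode, Prod.mk.injEq] at h
    split_ifs at h <;> simp only [Option.some.injEq, Prod.mk.injEq, and_false, or_self] at h
    rcases h with ⟨⟨rfl, rfl⟩, h⟩ | ⟨h, rfl, h'⟩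
    · exact .inr h.symm
    · left; rw [← h]; simp; omega

lemma adj_root {A : Set EdgeCode} {k : ℕ} {u v : F.cat.Vert} (hu : u.1 = (k, 0))
    (h : (F.cat.codeGraph A).Adj u v) :
    (v.1 = (k, 1) ∧ (main (k, 0) ∈ A)) ∨ v.1.2 = 0 ∧ (v.1.1 + 1 = k ∨ v.1.1 = k + 1) := by
  obtain ⟨-, e, he, h⟩ := F.cat.codeGraph_adj.1 h
  simp only [Caterpillar.near_eq_some, Caterpillar.far_eq_some, hu] at h
  obtain ⟨c, hc⟩ := e
  rcases c with (_ | j) | ⟨j, l⟩ | ⟨j, l⟩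
  · simp [Caterpillar.farCode] at h
  · simp only [Caterpillar.farCode, Caterpillar.nearCode, Prod.mk.injEq, Option.some.injEq,
      and_true] at h
    rcases h with ⟨rfl, h⟩ | ⟨h, rfl⟩
    · right; rw [← h]; simp
    · right; rw [← h]; simp
  · simp only [Caterpillar.farCode, Caterpillar.nearCode, Prod.mk.injEq, Option.some.injEq,
      Nat.succ_ne_zero, and_false, or_false] at h
    obtain ⟨⟨rfl, rfl⟩, h⟩ := h
    exact .inl ⟨h.symm, he⟩
  · have hs := (F.cat.sec_mem.1 hc).2
    simp only [Caterpillar.farCode, Caterpillar.nearCode, Prod.mk.injEq] at h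
    split_ifs at h <;> simp only [Option.some.injEq, Prod.mk.injEq, and_false, or_self,
      Nat.succ_ne_zero, or_false] at h
    obtain ⟨⟨rfl, rfl⟩, -⟩ := h
    rw [hasSec_eq, Node.hasSec_zero] at hs
    simp at hs

lemma adj_spine {A : Set EdgeCode} {k : ℕ} {u v : F.cat.Vert} (hu : u.1 = (k, 0)) (hv : v.1 = (k + 1, 0))
    (hA : spine (k + 1) ∈ A) : (F.cat.codeGraph A).Adj u v := by
  have h2 := v.2
  rw [hv] at h2
  have h3 := (F.mem_cat.1 h2).1
  refine F.cat.codeGraph_adj.2 ⟨fun h => ?_, ⟨spine (k + 1), ?_⟩, hA, .inr ⟨?_, ?_⟩⟩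
  · have h := congrArg Subtype.val h; rw [hu, hv] at h; simp at h
  · rw [Caterpillar.spine_mem, cat_M]; omega
  · rw [Caterpillar.near_eq_some, hv]; rfl
  · rw [Caterpillar.far_eq_some, hu]; rfl

lemma adj_main {A : Set EdgeCode} {k i : ℕ} {u v : F.cat.Vert} (hu : u.1 = (k, i)) (hv : v.1 = (k, i + 1))
    (hA : main (k, i) ∈ A) : (F.cat.codeGraph A).Adj u v := by
  have h2 := u.2
  rw [hu] at h2
  refine F.cat.codeGraph_adj.2 ⟨fun h => ?_, ⟨main (k, i), F.cat.main_mem.2 h2⟩, hA, .inl ⟨?_, ?_⟩⟩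
  · have h := congrArg Subtype.val h; rw [hu, hv] at h; simp at h
  · rw [Caterpillar.near_eq_some, hu]; rfl
  · rw [Caterpillar.far_eq_some, hv]; rfl

section Rigid

variable {F} {θ : F.cat.Vert ≃ F.cat.Vert} (hρ' : ∀ c < F.n, ρ' 0 c < F.n)
  (hθ : ∀ x, F.height ρ' (θ x).1 = F.height ρ x.1)
  (hadj : ∀ (Q : ℕ → Prop) u v, (F.cat.codeGraph {c | Q (F.cat.flow c).natAbs}).Adj u v →
    (F.cat.codeGraph {c | Q (F.cat.flow c).natAbs}).Adj (θ u) (θ v))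

include hρ' hθ in
-- The bijection takes heights for `ρ` to heights for `ρ'`, and the latter are injective, so
-- vertices whose height does not depend on the permutations stay in place.
lemma fixed_of_height {x : F.cat.Vert} (h : F.height ρ x.1 = F.height ρ' x.1) : θ x = x :=
  Subtype.ext (F.height_injOn hρ' (θ x).2 x.2 ((hθ x).trans h))

include hadj in
-- The vertex at level `i + 2` is the neighbour of the fixed vertex at level `i + 1` that is
-- different from the fixed vertex at level `i`.
lemma fixed_pendant {k : ℕ} (h0 : ∀ x : F.cat.Vert, x.1 = (k, 0) → θ x = x)
    (h1 : ∀ x : F.cat.Vert, x.1 = (k, 1) → θ x = x) (i : ℕ) :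
    ∀ x : F.cat.Vert, x.1 = (k, i) → θ x = x := by
  induction i using Nat.strong_induction_on with
  | _ i ih =>
    intro x hx
    rcases i with _ | _ | i
    · exact h0 x hx
    · exact h1 x hx
    · have hm := x.2
      rw [hx, mem_cat] at hm
      have hy : (k, i + 1) ∈ F.cat.verts := F.mem_cat.2 ⟨hm.1, by omega⟩
      have hz : (k, i) ∈ F.cat.verts := F.mem_cat.2 ⟨hm.1, by omega⟩
      have a := hadj (fun _ => True) _ _ (F.adj_main (u := ⟨(k, i + 1), hy⟩) (v := x) rfl hx trivial)
      rw [ih (i + 1) (by omega) ⟨(k, i + 1), hy⟩ rfl] at a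
      rcases F.adj_pendant rfl a with h | h
      · have h2 : θ x = ⟨(k, i), hz⟩ := Subtype.ext h
        rw [← ih i (by omega) ⟨(k, i), hz⟩ rfl] at h2
        have h3 := congrArg Subtype.val (θ.injective h2)
        rw [hx] at h3
        have h4 := (Prod.mk.inj h3).2
        omega
      · exact Subtype.ext (h.trans hx.symm)

include hρ' hθ hadj in
-- The vertices of pair 0 are fixed by their heights. Beyond them the spine is recovered along odd
-- edges (`hadj` with `Odd`): the pendant edges are even, so the next spine vertex is the odd
-- neighbour that is not the preceding one. The pendant at `N + 1` is odd, but has no further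
-- vertex.
lemma fixed_spine (k : ℕ) (hk : F.N ≤ k) : ∀ x : F.cat.Vert, x.1 = (k, 0) → θ x = x := by
  induction k using Nat.strong_induction_on with
  | _ k ih =>
    intro x hx
    rcases Nat.lt_or_ge k (F.N + 2) with h | h
    · have h' : k = F.N ∨ k = F.N + 1 := by omega
      refine fixed_of_height hρ' hθ ?_
      rcases h' with rfl | rfl
      · rw [hx, height_low, height_low]
      · rw [hx, height_up, height_up]
    · obtain ⟨k, rfl⟩ : ∃ j, k = j + 2 := ⟨k - 2, by omega⟩
      have hm := x.2
      rw [hx, mem_cat] at hm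
      have hy : (k + 1, 0) ∈ F.cat.verts := F.spine_mem_verts (by omega)
      have hz : (k, 0) ∈ F.cat.verts := F.spine_mem_verts (by omega)
      have hodd : Odd (F.s (k + 2)) := F.s_odd (by omega) hm.1.le
      have a := hadj Odd _ _ (F.adj_spine (u := ⟨(k + 1, 0), hy⟩) (v := x) rfl hx
        (Int.natAbs_odd.2 hodd))
      rw [ih (k + 1) (by omega) (by omega) ⟨(k + 1, 0), hy⟩ rfl] at a
      rcases F.adj_root rfl a with ⟨h1, h2⟩ | ⟨h1, h2⟩
      · exfalso
        have h3 := (θ x).2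
        rw [h1, mem_cat] at h3
        have h4 : Odd (F.node (k + 1)).val := Int.natAbs_odd.1 h2
        by_cases h5 : k + 1 = F.N + 1
        · rw [h5, node_up] at h3; simp [Node.p] at h3
        · exact (Int.not_odd_iff_even.2 (F.val_even (by omega) h3.1)) h4
      · rcases h2 with h2 | h2
        · have h3 : θ x = ⟨(k, 0), hz⟩ := Subtype.ext (Prod.ext (by simp only; omega) h1)
          rw [← ih k (by omega) (by omega) ⟨(k, 0), hz⟩ rfl] at h3
          have h4 := congrArg Subtype.val (θ.injective h3)
          rw [hx] at h4; simp at h4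
        · exact Subtype.ext ((Prod.ext h2 h1).trans hx.symm)

include hρ' hθ hadj in
-- Over the pairs, the heights at levels 0 and 1 do not depend on the permutations. Beyond them, a
-- vertex at level 1 is a neighbour of a fixed spine vertex and cannot move to the spine, whose
-- vertices there are already taken. In both cases `fixed_pendant` does the rest.
lemma fixed (x : F.cat.Vert) : θ x = x := by
  obtain ⟨⟨k, i⟩, hx⟩ := x
  refine fixed_pendant hadj (k := k) ?_ ?_ i _ rfl
  · intro x hx
    by_cases hk : k < F.N
    · refine fixed_of_height hρ' hθ ?_
      rw [hx, F.height_zero hk, F.height_zero hk]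
    · exact fixed_spine hρ' hθ hadj k (not_lt.1 hk) x hx
  · intro x hx
    by_cases hk : k < F.N
    · refine fixed_of_height hρ' hθ ?_
      rw [hx, F.height_one hk, F.height_one hk]
    · have hm := x.2
      rw [hx, mem_cat] at hm
      have h0 : (k, 0) ∈ F.cat.verts := F.spine_mem_verts hm.1
      have hk2 : F.N + 2 ≤ k := by
        by_contra hk2
        have h' : k = F.N ∨ k = F.N + 1 := by omega
        rcases h' with rfl | rfl
        · rw [node_low] at hm; simp [Node.p] at hm
        · rw [node_up] at hm; simp [Node.p] at hm
      have a := hadj (fun _ => True) _ _ (F.adj_main (u := ⟨(k, 0), h0⟩) (v := x) rfl hx trivial)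
      rw [fixed_spine hρ' hθ hadj k (not_lt.1 hk) ⟨(k, 0), h0⟩ rfl] at a
      rcases F.adj_root rfl a with ⟨h1, -⟩ | ⟨h1, h2⟩
      · exact Subtype.ext (h1.trans hx.symm)
      · have h3 : (θ x).1 = ((θ x).1.1, 0) := Prod.ext rfl h1
        have h4 := fixed_spine hρ' hθ hadj (θ x).1.1 (by omega) (θ x) h3
        have h5 := congrArg Subtype.val (θ.injective h4)
        rw [hx] at h5
        rw [h5] at h1
        simp at h1

end Rigid

variable (hρ : ∀ c < F.n, ρ 0 c < F.n) (hρ' : ∀ c < F.n, ρ' 0 c < F.n) {w : ℕ → ℝ} (hw : StrictMono w)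

/-- The height function is determined by the isomorphism class of the cover. -/
lemma height_eq_of_iso (f : TropicalCover.Iso (F.cover ρ hρ w hw) (F.cover ρ' hρ' w hw))
    {x : ℕ × ℕ} (hx : x ∈ F.cat.verts) : F.height ρ x = F.height ρ' x := by
  let θ : F.cat.Vert ≃ F.cat.Vert := f.onVert
  let η : F.cat.Edge ≃ F.cat.Edge := f.onEdge
  have hθ : ∀ x, F.height ρ' (θ x).1 = F.height ρ x.1 := fun x => hw.injective (f.pos_eq x)
  have hsrc : ∀ (e : F.cat.Edge) u, F.cat.src e = some u → F.cat.src (η e) = some (θ u) := by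
    intro e u h
    exact (f.src_eq e).trans (congrArg (Option.map θ) h)
  have htgt : ∀ (e : F.cat.Edge) u, F.cat.tgt e = some u → F.cat.tgt (η e) = some (θ u) := by
    intro e u h
    exact (f.tgt_eq e).trans (congrArg (Option.map θ) h)
  have hwt : ∀ e : F.cat.Edge, (F.cat.flow (η e).1).natAbs = (F.cat.flow e.1).natAbs := f.wt_eq
  have hadj : ∀ (Q : ℕ → Prop) u v, (F.cat.codeGraph {c | Q (F.cat.flow c).natAbs}).Adj u v →
      (F.cat.codeGraph {c | Q (F.cat.flow c).natAbs}).Adj (θ u) (θ v) := by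
    intro Q u v h
    rw [Caterpillar.codeGraph, SimpleGraph.fromRel_adj] at h ⊢
    refine ⟨fun h' => h.1 (θ.injective h'), h.2.imp ?_ ?_⟩
    all_goals
      rintro ⟨e, h1, h2, h3⟩
      refine ⟨η e, ?_, hsrc e _ h2, htgt e _ h3⟩
      change Q (F.cat.flow (η e).1).natAbs
      rw [hwt]; exact h1
  have h1 := hθ ⟨x, hx⟩
  rw [fixed hρ' hθ hadj ⟨x, hx⟩] at h1
  exact h1.symm

section Layers

variable {F} (h : ∀ x ∈ F.cat.verts, F.height ρ x = F.height ρ' x)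

include h

lemma births_eq {c : ℕ} (hc : c < F.n) : ρ 0 c = ρ' 0 c := by
  have hN := F.N_eq
  have hM := F.N_add_two_lt_M
  have h2 := h (F.N₀ + c, 2) (F.mem_cat.2 ⟨by omega, by rw [F.node_birth hc]; simp [Node.p]⟩)
  rw [F.height_two hc, F.height_two hc] at h2
  omega

/-- Heights reflect the order of the keys, and inside a layer keys are compared by `within`. -/
lemma within_lt_iff {x y : ℕ × ℕ} (hx : x ∈ F.upper) (hy : y ∈ F.upper) (hl : F.layer x = F.layer y) :
    F.within ρ x < F.within ρ y ↔ F.within ρ' x < F.within ρ' y := by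
  have h1 := F.height_upper_lt_iff (ρ := ρ) hx hy
  have h2 := F.height_upper_lt_iff (ρ := ρ') hx hy
  rw [h x (Finset.filter_subset _ _ hx), h y (Finset.filter_subset _ _ hy), h2] at h1
  simp only [key, Prod.Lex.toLex_lt_toLex, hl, lt_self_iff_false, true_and, false_or] at h1
  exact h1.symm

lemma outRoots_lt_iff {c d : ℕ} (hc : c < F.v) (hd : d < F.v) : ρ 1 c < ρ 1 d ↔ ρ' 1 c < ρ' 1 d := by
  have hu := F.u_eq
  have hM := F.M_eq
  have hZ := F.Z_eq
  have mem : ∀ c < F.v, (F.Z + 2 * c + 1, 0) ∈ F.upper := fun c hc =>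
    F.mem_upper.2 ⟨⟨by omega, Nat.zero_le _⟩, by omega⟩
  have := within_lt_iff h (mem c hc) (mem d hd) (by rw [layer_out, layer_out])
  simpa only [within_out] using this

lemma outForks_lt_iff {c d : ℕ} (hc : c < F.v) (hd : d < F.v) : ρ 2 c < ρ 2 d ↔ ρ' 2 c < ρ' 2 d := by
  have hu := F.u_eq
  have hM := F.M_eq
  have hZ := F.Z_eq
  have mem : ∀ c < F.v, (F.Z + 2 * c + 1, 1) ∈ F.upper := fun c hc =>
    F.mem_upper.2 ⟨⟨by omega, by rw [node_out]; simp [Node.p]⟩, by omega⟩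
  have := within_lt_iff h (mem c hc) (mem d hd) (by rw [layer_out', layer_out'])
  simpa only [within_out'] using this

lemma inTails_lt_iff {i c d : ℕ} (hc : c < F.u) (hd : d < F.u) (hic : i ≤ 2 * F.J c + 1)
    (hid : i ≤ 2 * F.J d + 1) : ρ (3 + i) c < ρ (3 + i) d ↔ ρ' (3 + i) c < ρ' (3 + i) d := by
  have hu := F.u_eq
  have hM := F.M_eq
  have hZ := F.Z_eq
  have mem : ∀ c < F.u, i ≤ 2 * F.J c + 1 → (F.Z + 2 * c, i) ∈ F.upper := fun c hc hi =>
    F.mem_upper.2 ⟨⟨by omega, by rw [node_in]; simpa [Node.p] using hi⟩, by omega⟩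
  have := within_lt_iff h (mem c hc hic) (mem d hd hid) (by rw [layer_in, layer_in])
  simpa only [within_in] using this

end Layers

end Config

/-! ### Permutations, and finiteness of the set of isomorphism classes -/

/-- The permutation of `ℕ` that extends a permutation of `Fin n`. -/
noncomputable def extPerm {n : ℕ} (σ : Equiv.Perm (Fin n)) : Equiv.Perm ℕ := σ.extendDomain Fin.equivSubtype

lemma extPerm_apply {n : ℕ} (σ : Equiv.Perm (Fin n)) (c : Fin n) : extPerm σ c = σ c := by
  have := σ.extendDomain_apply_image (Fin.equivSubtype (n := n)) c
  exact this

/-- If `σ` and `τ` order the indices in the same way, then the inverse of `σ` followed by `τ` is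
increasing, and the identity is the only increasing permutation of `Fin n`. -/
lemma eq_of_extPerm_lt_iff {n : ℕ} {σ τ : Equiv.Perm (Fin n)}
    (h : ∀ c < n, ∀ d < n, extPerm σ c < extPerm σ d ↔ extPerm τ c < extPerm τ d) : σ = τ := by
  have h' : ∀ c d : Fin n, σ c < σ d ↔ τ c < τ d := fun c d => by
    have := h c c.2 d d.2
    simpa only [extPerm_apply, Fin.val_fin_lt] using this
  have hle : ∀ a b, (σ.symm.trans τ) a ≤ (σ.symm.trans τ) b ↔ a ≤ b := fun a b => by
    have := h' (σ.symm b) (σ.symm a)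
    simp only [Equiv.apply_symm_apply] at this
    simpa using (not_congr this).symm
  have h1 : (⟨σ.symm.trans τ, hle _ _⟩ : Fin n ≃o Fin n) = OrderIso.refl _ := Subsingleton.elim _ _
  ext c
  have h2 := DFunLike.congr_fun h1 (σ c)
  have h3 : τ (σ.symm (σ c)) = σ c := h2
  rw [Equiv.symm_apply_apply] at h3
  rw [h3]

namespace TropicalCover

variable (C : TropicalCover)

lemma pos_src_lt_tgt {e : C.Edge} {u v : C.Vert} (hu : C.src e = some u) (hv : C.tgt e = some v) :
    C.pos u < C.pos v := by
  have hl := C.len_inner e (by simp [hu]) (by simp [hv])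
  have h1 : 0 < (C.len e).toReal := ENNReal.toReal_pos hl.1.ne' hl.2.ne
  have h2 : (0 : ℝ) < C.wt e := by exact_mod_cast C.wt_pos e
  rw [C.affine e u v hu hv]
  have := mul_pos h2 h1
  linarith

lemma sum_vert_filter (A : C.Vert → Prop) [DecidablePred A] (f : C.Edge → Option C.Vert) :
    ∑ v with A v, ∑ e with f e = some v, C.wt e =
      ∑ e : C.Edge, if (∃ v, f e = some v ∧ A v) then C.wt e else 0 := by
  classical
  simp only [Finset.sum_filter]
  simp only [← Finset.sum_filter (p := A)]
  rw [Finset.sum_comm]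
  refine Finset.sum_congr rfl fun e _ => ?_
  rw [Finset.sum_filter]
  cases h : f e with
  | none => simp
  | some x =>
    rw [Finset.sum_eq_single x]
    · simp
    · intro b _ hb; simp [Ne.symm hb]
    · simp

/-- By balancing, the weight of an edge is at most the sum of the weights of the inward ends. -/
lemma wt_le (e : C.Edge) : C.wt e ≤ ∑ f with C.src f = none, C.wt f := by
  classical
  rcases he : C.src e with _ | u
  · exact Finset.single_le_sum (f := C.wt) (fun _ _ => Nat.zero_le _) (by simp [he])
  -- Cut the cover just above the start `u` of `e` and add up the balancing conditions below the
  -- cut. All weight that crosses the cut, including that of `e`, is fed by inward ends; `h2` states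
  -- this edge by edge.
  have h : ∑ v with C.pos v ≤ C.pos u, ∑ e with C.tgt e = some v, C.wt e =
      ∑ v with C.pos v ≤ C.pos u, ∑ e with C.src e = some v, C.wt e :=
    Finset.sum_congr rfl fun v _ => C.balanced v
  rw [sum_vert_filter, sum_vert_filter] at h
  have h2 : ∀ f, ((if (∃ v, C.tgt f = some v ∧ C.pos v ≤ C.pos u) then C.wt f else 0) +
      (if f = e then C.wt e else 0)) ≤
      ((if C.src f = none then C.wt f else 0) +
      (if (∃ v, C.src f = some v ∧ C.pos v ≤ C.pos u) then C.wt f else 0)) := by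
    intro f
    by_cases hf : f = e
    · subst hf
      have : ¬ ∃ v, C.tgt f = some v ∧ C.pos v ≤ C.pos u := by
        rintro ⟨v, hv, hle⟩
        exact absurd (C.pos_src_lt_tgt he hv) (not_lt.2 hle)
      rw [if_neg this, if_pos rfl, if_neg (by simp [he]), if_pos ⟨u, he, le_rfl⟩]
    · rw [if_neg hf, add_zero]
      split_ifs with h1 h2 h3 h3
      · omega
      · omega
      · omega
      · obtain ⟨v, hv, hle⟩ := h1
        rcases hx : C.src f with _ | x
        · exact absurd hx h2
        · exact absurd ⟨x, hx, (C.pos_src_lt_tgt hx hv).le.trans hle⟩ h3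
      all_goals omega
  have h3 := Finset.sum_le_sum fun f (_ : f ∈ Finset.univ) => h2 f
  rw [Finset.sum_add_distrib, Finset.sum_add_distrib, h] at h3
  simp only [Finset.sum_ite_eq', Finset.mem_univ, if_true] at h3
  rw [Finset.sum_filter]
  omega

/-- The combinatorial data of a cover with given numbers of vertices, edges, and points. -/
abbrev Code (a b c d : ℕ) : Type :=
  (Fin b → Option (Fin a)) × (Fin b → Option (Fin a)) × (Fin b → Fin c) × (Fin a → Fin d)

/-- A cover with given combinatorial data. -/
def HasCode (w : ℕ → ℝ) {a b c d : ℕ} (x : Code a b c d) : Prop :=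
  ∃ (α : C.Vert ≃ Fin a) (β : C.Edge ≃ Fin b), (∀ e, (C.src e).map α = x.1 (β e)) ∧
    (∀ e, (C.tgt e).map α = x.2.1 (β e)) ∧ (∀ e, C.wt e = x.2.2.1 (β e)) ∧
    ∀ v, C.pos v = w (x.2.2.2 (α v))

variable {C}

/-- Lengths need not be recorded: on inner edges they follow from weights and heights, on ends they
are infinite. -/
lemma iso_of_hasCode {D : TropicalCover} {w : ℕ → ℝ} {a b c d : ℕ} {x : Code a b c d}
    (hC : C.HasCode w x) (hD : D.HasCode w x) : Nonempty (Iso C D) := by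
  obtain ⟨α, β, h1, h2, h3, h4⟩ := hC
  obtain ⟨α', β', h1', h2', h3', h4'⟩ := hD
  have hsrc : ∀ e, D.src (β.trans β'.symm e) = (C.src e).map (α.trans α'.symm) := by
    intro e
    have := h1' (β'.symm (β e))
    rw [Equiv.apply_symm_apply, ← h1] at this
    have h5 := congrArg (Option.map α'.symm) this
    simpa [Option.map_map, Function.comp_def] using h5
  have htgt : ∀ e, D.tgt (β.trans β'.symm e) = (C.tgt e).map (α.trans α'.symm) := by
    intro e
    have := h2' (β'.symm (β e))
    rw [Equiv.apply_symm_apply, ← h2] at this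
    have h5 := congrArg (Option.map α'.symm) this
    simpa [Option.map_map, Function.comp_def] using h5
  have hwt : ∀ e, D.wt (β.trans β'.symm e) = C.wt e := by
    intro e
    rw [h3, h3', Equiv.trans_apply, Equiv.apply_symm_apply]
  have hpos : ∀ v, D.pos (α.trans α'.symm v) = C.pos v := by
    intro v
    rw [h4, h4', Equiv.trans_apply, Equiv.apply_symm_apply]
  refine ⟨⟨α.trans α'.symm, β.trans β'.symm, hsrc, htgt, fun e => ?_, hwt, hpos⟩⟩
  rcases hu : C.src e with _ | u
  · rw [C.len_end e (.inl hu), D.len_end _ (.inl (by rw [hsrc, hu]; rfl))]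
  rcases hv : C.tgt e with _ | v
  · rw [C.len_end e (.inr hv), D.len_end _ (.inr (by rw [htgt, hv]; rfl))]
  have hu' : D.src (β.trans β'.symm e) = some (α.trans α'.symm u) := by rw [hsrc, hu]; rfl
  have hv' : D.tgt (β.trans β'.symm e) = some (α.trans α'.symm v) := by rw [htgt, hv]; rfl
  have h5 := C.affine e u v hu hv
  have h6 := D.affine _ _ _ hu' hv'
  rw [hpos, hpos, hwt, h5, add_right_inj] at h6
  have h7 : (C.wt e : ℝ) ≠ 0 := by exact_mod_cast (C.wt_pos e).ne'
  have h8 := mul_left_cancel₀ h7 h6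
  have h9 := (C.len_inner e (by simp [hu]) (by simp [hv])).2.ne
  have h10 := (D.len_inner _ (by rw [hu']; simp) (by rw [hv']; simp)).2.ne
  exact ((ENNReal.toReal_eq_toReal_iff' h9 h10).1 h8).symm

/-- Genus and numbers of ends determine the numbers of vertices and edges, `wt_le` bounds the
weights by `lam.sum`, and the vertices lie over the given points. So the type leaves finitely many
codes. -/
lemma HasType.exists_code {g : ℕ} {lam mu : Multiset ℕ} {s t : ℕ} {w : ℕ → ℝ} {hw : StrictMono w}
    (h : C.HasType g lam mu (PointDistribution.trivial s t w hw)) :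
    ∃ x : Code (2 * g + lam.card + mu.card - 2) (3 * g + 2 * lam.card + 2 * mu.card - 3)
      (lam.sum + 1) (2 * s + t), C.HasCode w x := by
  have h1 := C.three_mul_card_vert
  have h2 := C.card_edge
  have h3 := congrArg Multiset.card h.inward
  have h4 := congrArg Multiset.card h.outward
  rw [Multiset.card_map] at h3 h4
  simp only [Finset.card_val] at h3 h4
  have h5 := h.genus
  rw [Nat.card_eq_fintype_card (α := C.Vert)] at h5
  have α : C.Vert ≃ Fin (2 * g + lam.card + mu.card - 2) :=
    Fintype.equivFinOfCardEq (by omega)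
  have β : C.Edge ≃ Fin (3 * g + 2 * lam.card + 2 * mu.card - 3) :=
    Fintype.equivFinOfCardEq (by omega)
  have hwt : ∀ e, C.wt e < lam.sum + 1 := by
    intro e
    have h6 := C.wt_le e
    have h7 := congrArg Multiset.sum h.inward
    have h8 : ∑ f with C.src f = none, C.wt f = lam.sum := h7
    omega
  have hpos : ∀ v, ∃ j : Fin (2 * s + t), C.pos v = w j := by
    intro v
    have h6 : C.pos v ∈ Set.range C.pos := ⟨v, rfl⟩
    rw [h.image, PointDistribution.points_trivial] at h6
    obtain ⟨j, hj, h6⟩ := h6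
    exact ⟨⟨j, hj⟩, h6.symm⟩
  choose p hp using hpos
  refine ⟨⟨fun i => (C.src (β.symm i)).map α, fun i => (C.tgt (β.symm i)).map α,
    fun i => ⟨C.wt (β.symm i), hwt _⟩, fun i => p (α.symm i)⟩, α, β, ?_, ?_, ?_, ?_⟩
  · intro e; simp
  · intro e; simp
  · intro e; simp
  · intro v; simp [hp]

end TropicalCover

/-- An injection bounds `Nat.card` from below only if the target is finite, as an infinite type has
`Nat.card` equal to 0. Finiteness comes from the codes. -/
lemma card_le_properZigzagNumber {ι : Type*} [Finite ι] {g : ℕ} {lam mu : Multiset ℕ} {s t : ℕ} {w : ℕ → ℝ}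
    {hw : StrictMono w} (D : ι → TropicalCover) (hD : ∀ i, (D i).IsProperlyMixed g lam mu s t w hw)
    (hinj : ∀ i j, Nonempty (TropicalCover.Iso (D i) (D j)) → i = j) :
    Nat.card ι ≤ properZigzagNumber g lam mu s t w hw := by
  set r := TropicalCover.isoSetoid.comap
    (Subtype.val : {C : TropicalCover // C.IsProperlyMixed g lam mu s t w hw} → TropicalCover) with hr
  choose f hf using fun C : {C : TropicalCover // C.IsProperlyMixed g lam mu s t w hw} =>
    TropicalCover.HasType.exists_code C.2.1
  have : Finite (Quotient r) := by
    refine Finite.of_injective (fun q : Quotient r => f q.out) fun q q' h => ?_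
    rw [← Quotient.out_eq q, ← Quotient.out_eq q']
    refine Quotient.sound ?_
    have h1 := hf q.out
    simp only at h
    rw [h] at h1
    exact TropicalCover.iso_of_hasCode h1 (hf q'.out)
  refine Nat.card_le_card_of_injective (fun i => (Quotient.mk r ⟨D i, hD i⟩)) fun i j h => ?_
  exact hinj i j (Quotient.exact h)

/-! ### The product of factorials -/

namespace Config

variable (F : Config)

/-- Permutations of the layers of length `n`, `v`, `v`, of `p` layers of length `u`, and of two layers
of length `r`. -/
abbrev LayerPerms (n u v p r : ℕ) : Type :=
  Equiv.Perm (Fin n) × Equiv.Perm (Fin v) × Equiv.Perm (Fin v) × (Fin p → Equiv.Perm (Fin u)) ×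
    (Fin 2 → Equiv.Perm (Fin r))

/-- The permutations of the layers as a sequence of permutations of `ℕ`. -/
noncomputable def LayerPerms.toSeq {n u v p r : ℕ} (x : LayerPerms n u v p r) : ℕ → Equiv.Perm ℕ
  | 0 => extPerm x.1
  | 1 => extPerm x.2.1
  | 2 => extPerm x.2.2.1
  | i + 3 => if h : i < p then extPerm (x.2.2.2.1 ⟨i, h⟩)
      else if h : i - p < 2 then extPerm (x.2.2.2.2 ⟨i - p, h⟩) else 1

lemma LayerPerms.toSeq_mid {n u v p r : ℕ} (x : LayerPerms n u v p r) (i : Fin p) :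
    x.toSeq (3 + i) = extPerm (x.2.2.2.1 i) := by
  rw [add_comm]; simp [LayerPerms.toSeq]

lemma LayerPerms.toSeq_last {n u v p r : ℕ} (x : LayerPerms n u v p r) (i : Fin 2) :
    x.toSeq (3 + (p + i)) = extPerm (x.2.2.2.2 i) := by
  have hi := i.2
  rw [add_comm]; simp [LayerPerms.toSeq]; omega

lemma LayerPerms.card (n u v p r : ℕ) : Nat.card (LayerPerms n u v p r) =
    n.factorial * (v.factorial * (v.factorial * (u.factorial ^ p * r.factorial ^ 2))) := by
  simp only [LayerPerms, Nat.card_eq_fintype_card, Fintype.card_prod, Fintype.card_perm, Fintype.card_fin,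
    Fintype.card_pi, Finset.prod_const, Finset.card_univ]

/-- A configuration of prescribed genus gives many properly mixed covers. -/
lemma factorial_le {q r : ℕ} (hr : r ≤ F.u) (hJ : ∀ c < F.u, F.J c = if c < r then q + 1 else q)
    {g : ℕ} {lam mu : Multiset ℕ} {s t : ℕ} {w : ℕ → ℝ} (hw : StrictMono w)
    (hs : s = F.numPairs) (ht : t = F.numSimple)
    (hlam : F.ends 1 = lam) (hmu : F.ends (-1) = mu)
    (hg : 2 * s + t + 2 = 2 * g + lam.card + mu.card) :
    F.n.factorial * (F.v.factorial * (F.v.factorial * (F.u.factorial ^ (2 * q + 2) * r.factorial ^ 2))) ≤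
      properZigzagNumber g lam mu s t w hw := by
  rw [← LayerPerms.card]
  have hρ : ∀ x : LayerPerms F.n F.u F.v (2 * q + 2) r, ∀ c < F.n, x.toSeq 0 c < F.n := by
    intro x c hc
    have := extPerm_apply x.1 ⟨c, hc⟩
    simp only [LayerPerms.toSeq]
    rw [this]; exact Fin.is_lt _
  refine card_le_properZigzagNumber (fun x => F.cover x.toSeq (hρ x) w hw)
    (fun x => F.isProperlyMixed (hρ x) hw hs ht hlam hmu hg) ?_
  rintro x y ⟨f⟩
  have h := fun z hz => F.height_eq_of_iso (hρ x) (hρ y) hw f (x := z) hz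
  have h0 : x.1 = y.1 := eq_of_extPerm_lt_iff fun c hc d hd => by
    have h1 := births_eq h hc
    have h2 := births_eq h hd
    simp only [LayerPerms.toSeq] at h1 h2
    rw [h1, h2]
  have h1 : x.2.1 = y.2.1 := eq_of_extPerm_lt_iff fun c hc d hd => outRoots_lt_iff h hc hd
  have h2 : x.2.2.1 = y.2.2.1 := eq_of_extPerm_lt_iff fun c hc d hd => outForks_lt_iff h hc hd
  -- Every inward tail has at least `q` cycles and so reaches the levels 0 to `2 * q + 1`.
  have h3 : x.2.2.2.1 = y.2.2.2.1 := by
    ext1 i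
    refine eq_of_extPerm_lt_iff fun c hc d hd => ?_
    have hi := i.2
    have hc' := hJ c hc
    have hd' := hJ d hd
    have := inTails_lt_iff h (i := i) hc hd (by split_ifs at hc' <;> omega)
      (by split_ifs at hd' <;> omega)
    simpa only [LayerPerms.toSeq_mid] using this
  -- The levels `2 * q + 2` and `2 * q + 3` exist only in the `r` tails with an additional cycle.
  have h4 : x.2.2.2.2 = y.2.2.2.2 := by
    ext1 i
    refine eq_of_extPerm_lt_iff fun c hc d hd => ?_
    have hi := i.2
    have hc' := hJ c (by omega)
    have hd' := hJ d (by omega)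
    rw [if_pos hc] at hc'
    rw [if_pos hd] at hd'
    have := inTails_lt_iff h (i := 2 * q + 2 + i) (c := c) (d := d) (by omega) (by omega) (by omega)
      (by omega)
    simpa only [LayerPerms.toSeq_last] using this
  exact Prod.ext h0 (Prod.ext h1 (Prod.ext h2 (Prod.ext h3 h4)))

end Config

/-! ### Configurations with prescribed ends -/

lemma sum_range_getD {α A : Type*} [AddCommMonoid A] (f : α → A) (d : α) (L : List α) {k : ℕ}
    (hk : k ≤ L.length) : ∑ j ∈ Finset.range k, f (L.getD j d) = ((L.take k).map f).sum := by
  induction L generalizing k with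
  | nil => simp only [List.length_nil, Nat.le_zero] at hk; subst hk; simp
  | cons a L ih =>
    rcases k with _ | k
    · simp
    · rw [Finset.sum_range_succ']
      simp only [List.getD_cons_succ, List.getD_cons_zero, List.take_succ_cons, List.map_cons, List.sum_cons]
      rw [ih (by simpa using hk), add_comm]

lemma sum_range_length_getD {α A : Type*} [AddCommMonoid A] (f : α → A) (d : α) (L : List α) :
    ∑ j ∈ Finset.range L.length, f (L.getD j d) = (L.map f).sum := by
  rw [sum_range_getD f d L le_rfl, List.take_length]

/-- If the terms of a sequence are first nonpositive and then nonnegative, then the partial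
sums are bounded by each nonnegative bound of the whole sum. -/
lemma sum_take_append_le {A B : List ℤ} (hA : ∀ a ∈ A, a ≤ 0) (hB : ∀ b ∈ B, 0 ≤ b) {c : ℤ} (hc : 0 ≤ c)
    (h : (A ++ B).sum ≤ c) (k : ℕ) : ((A ++ B).take k).sum ≤ c := by
  have hneg : ∀ L : List ℤ, (∀ a ∈ L, a ≤ 0) → L.sum ≤ 0 := fun L hL => by
    induction L with
    | nil => simp
    | cons a L ih =>
      have h1 := hL a (by simp)
      have h2 := ih fun b hb => hL b (by simp [hb])
      rw [List.sum_cons]; omega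
  rcases le_total k A.length with hk | hk
  · rw [List.take_append_of_le_length hk]
    exact (hneg _ fun a ha => hA a (List.mem_of_mem_take ha)).trans hc
  · have h1 : ((A ++ B).take k).sum + ((A ++ B).drop k).sum = (A ++ B).sum := by
      rw [← List.sum_append, List.take_append_drop]
    have h2 : 0 ≤ ((A ++ B).drop k).sum := by
      refine List.sum_nonneg fun b hb => ?_
      rw [List.drop_append, List.drop_eq_nil_of_le hk, List.nil_append] at hb
      exact hB b (List.mem_of_mem_drop hb)
    omega

lemma sum_map_toList {α A : Type*} [AddCommMonoid A] (f : α → A) (S : Multiset α) :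
    (S.toList.map f).sum = (S.map f).sum := by
  conv_rhs => rw [← S.coe_toList]
  rw [Multiset.map_coe, Multiset.sum_coe]

namespace Config

/-- The pendants over the pairs which decrease the flow along the spine. -/
noncomputable def preLoss (O K : Multiset ℕ) (f : ℕ) : List (ℤ × ℤ) :=
  List.replicate f (-1, -1) ++ (K.toList.map (fun k : ℕ => (-(k : ℤ), -(k : ℤ))) ++
    -- An odd end shares its pendant with an end of weight 1 of the opposite direction, so that the
    -- contribution to the spine is even.
    O.toList.map (fun b : ℕ => (-(b : ℤ), 1)))

/-- The pendants over the pairs which increase the flow along the spine. -/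
noncomputable def preGain (O K : Multiset ℕ) (f : ℕ) : List (ℤ × ℤ) :=
  O.toList.map (fun a : ℕ => ((a : ℤ), -1)) ++ (K.toList.map (fun k : ℕ => ((k : ℤ), (k : ℤ))) ++
    List.replicate f (1, 1))

/-- The outward pendants between the peak and the final zigzag. -/
noncomputable def spOut (S : Multiset ℕ) (f : ℕ) : List Node :=
  S.toList.map (fun x : ℕ => Node.leaf (-(x : ℤ))) ++ List.replicate f (Node.tail (-1) 0)

/-- The inward pendants between the peak and the final zigzag. -/
noncomputable def spIn (S : Multiset ℕ) (f : ℕ) : List Node :=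
  S.toList.map (fun x : ℕ => Node.leaf (x : ℤ)) ++ List.replicate f (Node.tail 1 0)

lemma sum_preLoss {A : Type*} [AddCommMonoid A] (φ : ℤ × ℤ → A) (O K : Multiset ℕ) (f : ℕ) :
    ((preLoss O K f).map φ).sum = f • φ (-1, -1) + ((K.map fun k : ℕ => φ (-(k : ℤ), -(k : ℤ))).sum +
      (O.map fun b : ℕ => φ (-(b : ℤ), 1)).sum) := by
  simp only [preLoss, List.map_append, List.sum_append, List.map_replicate, List.sum_replicate,
    List.map_map, sum_map_toList]
  rfl

lemma sum_preGain {A : Type*} [AddCommMonoid A] (φ : ℤ × ℤ → A) (O K : Multiset ℕ) (f : ℕ) :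
    ((preGain O K f).map φ).sum = (O.map fun a : ℕ => φ ((a : ℤ), -1)).sum +
      ((K.map fun k : ℕ => φ ((k : ℤ), (k : ℤ))).sum + f • φ (1, 1)) := by
  simp only [preGain, List.map_append, List.sum_append, List.map_replicate, List.sum_replicate,
    List.map_map, sum_map_toList]
  rfl

lemma sum_spOut {A : Type*} [AddCommMonoid A] (φ : Node → A) (S : Multiset ℕ) (f : ℕ) :
    ((spOut S f).map φ).sum = (S.map fun x : ℕ => φ (.leaf (-(x : ℤ)))).sum + f • φ (.tail (-1) 0) := by
  simp only [spOut, List.map_append, List.sum_append, List.map_replicate, List.sum_replicate,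
    List.map_map, sum_map_toList]
  rfl

lemma sum_spIn {A : Type*} [AddCommMonoid A] (φ : Node → A) (S : Multiset ℕ) (f : ℕ) :
    ((spIn S f).map φ).sum = (S.map fun x : ℕ => φ (.leaf (x : ℤ))).sum + f • φ (.tail 1 0) := by
  simp only [spIn, List.map_append, List.sum_append, List.map_replicate, List.sum_replicate,
    List.map_map, sum_map_toList]
  rfl

lemma sum_map_int (f : ℕ → ℤ) (a b : ℤ) (hf : ∀ x : ℕ, f x = a * x + b) (S : Multiset ℕ) :
    (S.map f).sum = a * S.sum + b * S.card := by
  induction S using Multiset.induction_on with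
  | empty => simp
  | cons x S ih =>
    rw [Multiset.map_cons, Multiset.sum_cons, ih, hf, Multiset.sum_cons, Multiset.card_cons]
    push_cast; ring

lemma sum_map_singleton_of {f : ℕ → Multiset ℕ} {S : Multiset ℕ} {r : ℕ}
    (h : ∀ x ∈ S, f x = {x} + Multiset.replicate r 1) :
    (S.map f).sum = S + Multiset.replicate (r * S.card) 1 := by
  induction S using Multiset.induction_on with
  | empty => simp
  | cons x S ih =>
    rw [Multiset.map_cons, Multiset.sum_cons, ih fun y hy => h y (by simp [hy]), h x (by simp),
      Multiset.card_cons, mul_add, mul_one, Multiset.replicate_add, ← Multiset.singleton_add x S]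
    abel

lemma sum_map_ones_of {f : ℕ → Multiset ℕ} {S : Multiset ℕ} {r : ℕ}
    (h : ∀ x ∈ S, f x = Multiset.replicate r 1) :
    (S.map f).sum = Multiset.replicate (r * S.card) 1 := by
  rw [Multiset.map_congr rfl h, Multiset.map_const', Multiset.sum_replicate, Multiset.nsmul_replicate,
    mul_comm]

lemma sum_map_double_of {f : ℕ → Multiset ℕ} {S : Multiset ℕ} (h : ∀ x ∈ S, f x = {x} + {x}) :
    (S.map f).sum = S + S := by
  rw [Multiset.map_congr rfl h, Multiset.sum_map_add, Multiset.sum_map_singleton]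

variable {E₁ O₁ K₁ E₂ O₂ K₂ : Multiset ℕ} {n n₁ n₂ f₁ f₂ u v o e Jmax : ℕ} {J : ℕ → ℕ}

section Existence

variable (hE₁ : ∀ x ∈ E₁, Even x ∧ x ≠ 0) (hO₁ : ∀ x ∈ O₁, Odd x ∧ x ≠ 1) (hK₁ : ∀ x ∈ K₁, x ≠ 0)
  (hE₂ : ∀ x ∈ E₂, Even x ∧ x ≠ 0) (hO₂ : ∀ x ∈ O₂, Odd x ∧ x ≠ 1) (hK₂ : ∀ x ∈ K₂, x ≠ 0)

include hO₁ hK₁ hO₂ hK₂ in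
lemma pre_mem_ok {p : ℤ × ℤ} (hp : p ∈ preLoss O₂ K₂ f₂ ++ preGain O₁ K₁ f₁) :
    (p.1 = p.2 ∧ p.1 ≠ 0) ∨ (Odd p.1 ∧ Odd p.2 ∧ p.1 * p.2 < 0 ∧ p.1 + p.2 ≠ 0) := by
  simp only [preLoss, preGain, List.mem_append, List.mem_replicate, List.mem_map, Multiset.mem_toList] at hp
  rcases hp with (⟨-, rfl⟩ | ⟨k, hk, rfl⟩ | ⟨b, hb, rfl⟩) | ⟨a, ha, rfl⟩ | ⟨k, hk, rfl⟩ | ⟨-, rfl⟩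
  · left; simp
  · left; simpa using hK₂ k hk
  · right
    obtain ⟨h1, h2⟩ := hO₂ b hb
    have := h1.pos
    refine ⟨by simpa using h1, odd_one, by simp only; omega, by simp only; omega⟩
  · right
    obtain ⟨h1, h2⟩ := hO₁ a ha
    have := h1.pos
    refine ⟨by simpa using h1, ⟨-1, rfl⟩, by simp only; omega, by simp only; omega⟩
  · left; simpa using hK₁ k hk
  · left; simp

include hO₂ in
lemma preLoss_nonpos {p : ℤ × ℤ} (hp : p ∈ preLoss O₂ K₂ f₂) : p.1 + p.2 ≤ 0 := by
  simp only [preLoss, List.mem_append, List.mem_replicate, List.mem_map, Multiset.mem_toList] at hp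
  rcases hp with ⟨-, rfl⟩ | ⟨k, hk, rfl⟩ | ⟨b, hb, rfl⟩
  · decide
  · simp only; omega
  · have := (hO₂ b hb).1.pos
    simp only; omega

include hO₁ in
lemma preGain_nonneg {p : ℤ × ℤ} (hp : p ∈ preGain O₁ K₁ f₁) : 0 ≤ p.1 + p.2 := by
  simp only [preGain, List.mem_append, List.mem_replicate, List.mem_map, Multiset.mem_toList] at hp
  rcases hp with ⟨a, ha, rfl⟩ | ⟨k, hk, rfl⟩ | ⟨-, rfl⟩
  · have := (hO₁ a ha).1.pos
    simp only; omega
  · simp only; omega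
  · decide

include hE₁ hE₂ in
lemma sp_mem_ok {N : Node} (hN : N ∈ spOut E₂ n₁ ++ spIn E₁ n₂) :
    (∃ x, N = .leaf x ∧ Even x ∧ x ≠ 0) ∨ N = .tail 1 0 ∨ N = .tail (-1) 0 := by
  simp only [spOut, spIn, List.mem_append, List.mem_replicate, List.mem_map, Multiset.mem_toList] at hN
  rcases hN with (⟨x, hx, rfl⟩ | ⟨-, rfl⟩) | ⟨x, hx, rfl⟩ | ⟨-, rfl⟩
  · exact .inl ⟨_, rfl, by simpa using (hE₂ x hx).1, by simpa using (hE₂ x hx).2⟩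
  · exact .inr (.inr rfl)
  · exact .inl ⟨_, rfl, by simpa using (hE₁ x hx).1, by simpa using (hE₁ x hx).2⟩
  · exact .inr (.inl rfl)

lemma spOut_nonpos {N : Node} (hN : N ∈ spOut E₂ n₁) : N.val ≤ 0 := by
  simp only [spOut, List.mem_append, List.mem_replicate, List.mem_map, Multiset.mem_toList] at hN
  rcases hN with ⟨x, hx, rfl⟩ | ⟨-, rfl⟩
  · simp [Node.val, Node.fm]
  · decide

lemma spIn_nonneg {N : Node} (hN : N ∈ spIn E₁ n₂) : 0 ≤ N.val := by
  simp only [spIn, List.mem_append, List.mem_replicate, List.mem_map, Multiset.mem_toList] at hN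
  rcases hN with ⟨x, hx, rfl⟩ | ⟨-, rfl⟩
  · simp [Node.val, Node.fm]
  · decide

variable (hu : u = v ∨ u = v + 1) (hJ : ∀ c, J c ≤ Jmax) (ho : Odd o) (ho1 : o ≠ 1) (he : Even e)
  (hoe : 2 * o ≤ e)
  (hflow : (O₁.sum : ℤ) - O₁.card + 2 * K₁.sum + 2 * f₁ + 2 * n =
    O₂.sum - O₂.card + 2 * K₂.sum + 2 * f₂)
  (hflow' : E₁.sum + 2 * n₂ + 2 * o = E₂.sum + e + 2 * n₁)

include hflow in
lemma sum_pre : ((preLoss O₂ K₂ f₂ ++ preGain O₁ K₁ f₁).map fun p => p.1 + p.2).sum = -2 * n := by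
  rw [List.map_append, List.sum_append, sum_preLoss, sum_preGain,
    sum_map_int _ (-2) 0 (fun x => by ring), sum_map_int _ (-1) 1 (fun x => by ring),
    sum_map_int _ 1 (-1) (fun x => by ring), sum_map_int _ 2 0 (fun x => by ring)]
  simp only [nsmul_eq_mul]
  linarith

include hflow' in
lemma sum_sp : 2 * (o : ℤ) - 1 - e + ((spOut E₂ n₁ ++ spIn E₁ n₂).map Node.val).sum = -1 := by
  rw [List.map_append, List.sum_append, sum_spOut, sum_spIn,
    sum_map_int _ (-1) 0 (fun x => by simp [Node.val, Node.fm]),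
    sum_map_int _ 1 0 (fun x => by simp [Node.val, Node.fm])]
  simp only [Node.val, Node.fm, nsmul_eq_mul]
  zify at hflow'
  simp
  linarith

/-- The configuration with given ends. -/
noncomputable def ofEnds : Config where
  N₀ := (preLoss O₂ K₂ f₂ ++ preGain O₁ K₁ f₁).length
  n := n
  K := (spOut E₂ n₁ ++ spIn E₁ n₂).length
  u := u
  v := v
  o := o
  e := e
  Jmax := Jmax
  pre k := (preLoss O₂ K₂ f₂ ++ preGain O₁ K₁ f₁).getD k 0
  sp k := (spOut E₂ n₁ ++ spIn E₁ n₂).getD k .birth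
  J := J
  u_eq := hu
  J_le := hJ
  o_odd := ho
  o_ne := ho1
  e_even := he
  le_e := hoe
  pre_ok k hk := by
    rw [List.getD_eq_getElem _ _ hk]
    exact pre_mem_ok hO₁ hK₁ hO₂ hK₂ (List.getElem_mem hk)
  pre_nonpos k hk := by
    rw [sum_range_getD (fun p : ℤ × ℤ => p.1 + p.2) 0 _ hk, List.map_take, List.map_append]
    -- Losses precede gains and the total is `-2 * n`, so partial sums never become positive and the
    -- spine flow stays negative.
    refine sum_take_append_le ?_ ?_ le_rfl ?_ k
    · intro a ha
      obtain ⟨p, hp, rfl⟩ := List.mem_map.1 ha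
      exact preLoss_nonpos hO₂ hp
    · intro a ha
      obtain ⟨p, hp, rfl⟩ := List.mem_map.1 ha
      exact preGain_nonneg hO₁ hp
    · rw [← List.map_append, sum_pre hflow]; omega
  pre_sum := by
    rw [sum_range_length_getD (fun p : ℤ × ℤ => p.1 + p.2) 0, sum_pre hflow]
  sp_ok k hk := by
    rw [List.getD_eq_getElem _ _ hk]
    exact sp_mem_ok hE₁ hE₂ (List.getElem_mem hk)
  sp_neg k hk := by
    rw [sum_range_getD Node.val .birth _ hk, List.map_take, List.map_append]
    have h1 := sum_sp hflow'
    rw [List.map_append] at h1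
    -- The bound `e - 2 * o` is nonnegative by the hypothesis on `e`. It is what keeps the flow at
    -- most -1 from the peak to the zigzag.
    have h2 := sum_take_append_le (A := (spOut E₂ n₁).map Node.val) (B := (spIn E₁ n₂).map Node.val)
      (c := e - 2 * o) ?_ ?_ (by omega) (by omega) k
    · omega
    · intro a ha
      obtain ⟨p, hp, rfl⟩ := List.mem_map.1 ha
      exact spOut_nonpos hp
    · intro a ha
      obtain ⟨p, hp, rfl⟩ := List.mem_map.1 ha
      exact spIn_nonneg hp
  sp_sum := by
    rw [sum_range_length_getD Node.val .birth, sum_sp hflow']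

include hE₁ hO₁ hK₁ hE₂ hO₂ hK₂ hu hJ ho ho1 he hoe hflow hflow' in
/-- A configuration with given ends exists if the sums of the weights of the inward and of the outward
ends match. -/
lemma exists_config : ∃ F : Config, F.n = n ∧ F.u = u ∧ F.v = v ∧ F.J = J ∧
    F.numPairs = 1 + 2 * n + f₁ + f₂ + K₁.card + K₂.card + O₁.card + O₂.card ∧
    F.numSimple = 1 + E₁.card + E₂.card + 2 * n₁ + 2 * n₂ + ∑ c ∈ Finset.range u, (2 * J c + 2) + 2 * v ∧
    F.ends 1 = E₁ + {o, o} + O₁ + K₁ + K₁ +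
      Multiset.replicate ((if u = v then 1 else 0) + O₂.card + 2 * f₁ + 3 * n + 2 * n₂ + 2 * u) 1 ∧
    F.ends (-1) = E₂ + {e} + O₂ + K₂ + K₂ +
      Multiset.replicate (1 + (if u = v then 0 else 1) + O₁.card + 2 * f₂ + n + 2 * n₁ + 2 * v) 1 := by
  have ho0 := ho.pos
  refine ⟨ofEnds hE₁ hO₁ hK₁ hE₂ hO₂ hK₂ hu hJ ho ho1 he hoe hflow hflow', rfl, rfl, rfl, rfl, ?_, ?_, ?_, ?_⟩
  · simp only [numPairs, N, ofEnds, preLoss, preGain, List.length_append, List.length_replicate,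
      List.length_map, Multiset.length_toList]
    ring
  · rw [numSimple_eq]
    simp only [ofEnds]
    rw [sum_range_length_getD (fun N : Node => N.p + 1) .birth, List.map_append, List.sum_append, sum_spOut,
      sum_spIn]
    simp only [Node.p]
    simp
    ring
  · rw [ends, sum_node]
    simp only [ofEnds]
    rw [sum_range_length_getD (fun p : ℤ × ℤ => (Node.exch p.1 p.2).ends 1) 0,
      sum_range_length_getD (Node.ends 1) .birth, List.map_append, List.sum_append, List.map_append,
      List.sum_append, sum_spOut, sum_spIn, sum_preLoss, sum_preGain]
    have h1 : (K₂.map fun k : ℕ => (Node.exch (-(k : ℤ)) (-(k : ℤ))).ends 1).sum = Multiset.replicate 0 1 := by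
      rw [sum_map_ones_of (r := 0) fun x hx => ?_, zero_mul]
      rw [Node.ends_exch, if_neg (by omega)]; rfl
    have h2 : (O₂.map fun k : ℕ => (Node.exch (-(k : ℤ)) 1).ends 1).sum = Multiset.replicate O₂.card 1 := by
      rw [sum_map_ones_of (r := 1) fun x hx => ?_, one_mul]
      rw [Node.ends_exch, if_neg (by omega), if_pos (by omega)]; rfl
    have h3 : (O₁.map fun k : ℕ => (Node.exch (k : ℤ) (-1)).ends 1).sum = O₁ := by
      rw [sum_map_singleton_of (r := 0) fun x hx => ?_, zero_mul]
      · simp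
      · have := (hO₁ x hx).1.pos
        rw [Node.ends_exch, if_pos (by omega), if_neg (by omega)]; rfl
    have h4 : (K₁.map fun k : ℕ => (Node.exch (k : ℤ) (k : ℤ)).ends 1).sum = K₁ + K₁ := by
      refine sum_map_double_of fun x hx => ?_
      have := hK₁ x hx
      rw [Node.ends_exch, if_pos (by omega)]; rfl
    have h5 : (E₂.map fun k : ℕ => (Node.leaf (-(k : ℤ))).ends 1).sum = Multiset.replicate 0 1 := by
      rw [sum_map_ones_of (r := 0) fun x hx => ?_, zero_mul]
      rw [Node.ends_leaf, if_neg (by omega)]; rfl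
    have h6 : (E₁.map fun k : ℕ => (Node.leaf (k : ℤ)).ends 1).sum = E₁ := by
      rw [sum_map_singleton_of (r := 0) fun x hx => ?_, zero_mul]
      · simp
      · have := (hE₁ x hx).2
        rw [Node.ends_leaf, if_pos (by omega)]; rfl
    rw [h1, h2, h3, h4, h5, h6]
    simp only [Node.ends_exch, Node.ends_leaf, Node.ends_tail, Node.ends_birth_in, spineEnds]
    rw [if_pos (by omega : (0 : ℤ) < 1 * o), if_neg (by omega : ¬ (0 : ℤ) < 1 * -e)]
    simp only [← Multiset.nsmul_singleton, Finset.sum_const, Finset.card_range]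
    -- The last spine edge flows in if `u = v` and out otherwise, while the first one always flows
    -- out.
    by_cases huv : u = v <;>
      simp [huv, Multiset.insert_eq_cons, ← Multiset.singleton_add] <;> module
  · rw [ends, sum_node]
    simp only [ofEnds]
    rw [sum_range_length_getD (fun p : ℤ × ℤ => (Node.exch p.1 p.2).ends (-1)) 0,
      sum_range_length_getD (Node.ends (-1)) .birth, List.map_append, List.sum_append, List.map_append,
      List.sum_append, sum_spOut, sum_spIn, sum_preLoss, sum_preGain]
    have h1 : (K₂.map fun k : ℕ => (Node.exch (-(k : ℤ)) (-(k : ℤ))).ends (-1)).sum = K₂ + K₂ := by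
      refine sum_map_double_of fun x hx => ?_
      have := hK₂ x hx
      rw [Node.ends_exch, if_pos (by omega), Int.natAbs_neg]; rfl
    have h2 : (O₂.map fun k : ℕ => (Node.exch (-(k : ℤ)) 1).ends (-1)).sum = O₂ := by
      rw [sum_map_singleton_of (r := 0) fun x hx => ?_, zero_mul]
      · simp
      · have := (hO₂ x hx).1.pos
        rw [Node.ends_exch, if_pos (by omega), if_neg (by omega), Int.natAbs_neg]; rfl
    have h3 : (O₁.map fun k : ℕ => (Node.exch (k : ℤ) (-1)).ends (-1)).sum =
        Multiset.replicate O₁.card 1 := by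
      rw [sum_map_ones_of (r := 1) fun x hx => ?_, one_mul]
      rw [Node.ends_exch, if_neg (by omega), if_pos (by omega)]; rfl
    have h4 : (K₁.map fun k : ℕ => (Node.exch (k : ℤ) (k : ℤ)).ends (-1)).sum = Multiset.replicate 0 1 := by
      rw [sum_map_ones_of (r := 0) fun x hx => ?_, zero_mul]
      rw [Node.ends_exch, if_neg (by omega)]; rfl
    have h5 : (E₂.map fun k : ℕ => (Node.leaf (-(k : ℤ))).ends (-1)).sum = E₂ := by
      rw [sum_map_singleton_of (r := 0) fun x hx => ?_, zero_mul]
      · simp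
      · have := (hE₂ x hx).2
        rw [Node.ends_leaf, if_pos (by omega), Int.natAbs_neg]; rfl
    have h6 : (E₁.map fun k : ℕ => (Node.leaf (k : ℤ)).ends (-1)).sum = Multiset.replicate 0 1 := by
      rw [sum_map_ones_of (r := 0) fun x hx => ?_, zero_mul]
      rw [Node.ends_leaf, if_neg (by omega)]; rfl
    rw [h1, h2, h3, h4, h5, h6]
    simp only [Node.ends_exch, Node.ends_leaf, Node.ends_tail, Node.ends_birth_out, spineEnds]
    rw [if_neg (by omega : ¬ (0 : ℤ) < -1 * o), if_pos (by omega : (0 : ℤ) < -1 * -e)]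
    simp only [← Multiset.nsmul_singleton, Finset.sum_const, Finset.card_range]
    by_cases huv : u = v <;> simp [huv, -Multiset.singleton_add] <;> module

end Existence

end Config

/-! ### Decomposing the partitions and choosing the parameters -/

/-- A multiset in which even numbers have even multiplicity consists of a double multiset, odd numbers
different from 1, and ones. -/
lemma Multiset.exists_split (S : Multiset ℕ) (h : ∀ a, Even a → Even (S.count a)) :
    ∃ K O : Multiset ℕ, ∃ z : ℕ, S = K + K + O + Multiset.replicate z 1 ∧ (∀ x ∈ O, Odd x ∧ x ≠ 1) ∧
      ∀ x ∈ K, x ∈ S := by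
  set K : Multiset ℕ := (S.filter Even).toFinset.sum fun a => Multiset.replicate (S.count a / 2) a with hK
  have hcount : ∀ a, K.count a = if Even a then S.count a / 2 else 0 := by
    intro a
    rw [hK, Multiset.count_sum']
    simp only [Multiset.count_replicate]
    rw [Finset.sum_ite_eq']
    by_cases ha : Even a <;> simp [ha]
    intro h; simp [Multiset.count_eq_zero_of_notMem h]
  refine ⟨K, S.filter fun a => Odd a ∧ a ≠ 1, S.count 1, ?_, ?_, ?_⟩
  · ext a
    simp only [Multiset.count_add, hcount, Multiset.count_filter, Multiset.count_replicate]
    by_cases ha : Even a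
    · have h1 : ¬ Odd a := Nat.not_odd_iff_even.2 ha
      have h2 : 1 ≠ a := by rintro rfl; exact absurd ha (by decide)
      obtain ⟨k, hk⟩ := h a ha
      simp [ha, h1, h2]; omega
    · have h1 : Odd a := Nat.not_even_iff_odd.1 ha
      by_cases h2 : a = 1
      · subst h2; simp
      · simp [ha, h1, h2, Ne.symm h2]
  · intro x hx
    exact (Multiset.mem_filter.1 hx).2
  · intro x hx
    rw [← Multiset.count_pos, hcount] at hx
    rw [← Multiset.count_pos]
    split_ifs at hx <;> omega

lemma count_tailEven (p : Multiset ℕ) (a : ℕ) :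
    (tailEven p).count a = if Even a ∧ Odd (p.count a) then 1 else 0 := by
  rw [tailEven, Multiset.count_eq_of_nodup (Finset.nodup _)]
  refine if_congr ?_ rfl rfl
  simp only [Finset.mem_val, Finset.mem_filter, Multiset.mem_toFinset, and_iff_right_iff_imp]
  rintro ⟨-, h⟩
  exact Multiset.count_pos.1 h.pos

lemma mem_tailEven {p : Multiset ℕ} {a : ℕ} : a ∈ tailEven p ↔ Even a ∧ Odd (p.count a) := by
  rw [← Multiset.count_pos, count_tailEven]; split_ifs <;> simp_all

lemma mem_of_mem_tailEven {p : Multiset ℕ} {a : ℕ} (h : a ∈ tailEven p) : a ∈ p :=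
  Multiset.count_pos.1 (mem_tailEven.1 h).2.pos

lemma tailEven_le (p : Multiset ℕ) : tailEven p ≤ p := by
  rw [Multiset.le_iff_count]
  intro a
  rw [count_tailEven]
  split_ifs with h
  · exact h.2.pos
  · exact Nat.zero_le _

lemma even_count_sub_tailEven (p : Multiset ℕ) {a : ℕ} (ha : Even a) : Even ((p - tailEven p).count a) := by
  rw [Multiset.count_sub, count_tailEven]
  split_ifs with h
  · obtain ⟨k, hk⟩ := h.2
    exact ⟨k, by omega⟩
  · rw [not_and, Nat.not_odd_iff_even] at h
    simpa using h ha

/-- The decomposition of a partition with two parts equal to `o`. -/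
lemma exists_lam_split {lam : Multiset ℕ} (h0 : ∀ x ∈ lam, x ≠ 0) {o : ℕ} (ho : Odd o)
    (ho2 : 2 ≤ lam.count o) : ∃ K O : Multiset ℕ, ∃ z : ℕ,
    lam = tailEven lam + {o, o} + K + K + O + Multiset.replicate z 1 ∧
    (lamPrime lam o).card = 2 * K.card + O.card + z ∧ (∀ x ∈ O, Odd x ∧ x ≠ 1) ∧ ∀ x ∈ K, x ≠ 0 := by
  have hle : tailEven lam + {o, o} ≤ lam := by
    rw [Multiset.le_iff_count]
    intro a
    rw [Multiset.count_add, count_tailEven]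
    by_cases ha : a = o
    · subst ha
      rw [if_neg (fun h => Nat.not_even_iff_odd.2 ho h.1)]
      simpa using ho2
    · have : Multiset.count a {o, o} = 0 := by simp [ha]
      rw [this, add_zero, ← count_tailEven]
      exact Multiset.le_iff_count.1 (tailEven_le lam) a
  have hlam : lamPrime lam o ≤ lam := Multiset.sub_le_self _ _
  obtain ⟨K, O, z, h1, h2, h3⟩ := (lamPrime lam o).exists_split fun a ha => by
    have hao : a ≠ o := by rintro rfl; exact Nat.not_even_iff_odd.2 ho ha
    have h4 : Multiset.count a {o, o} = 0 := by simp [hao]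
    have := even_count_sub_tailEven lam ha
    rw [lamPrime, Multiset.count_sub, Multiset.count_add, h4, add_zero, ← Multiset.count_sub]
    exact this
  refine ⟨K, O, z, ?_, ?_, h2, fun x hx => h0 x (Multiset.mem_of_le hlam (h3 x hx))⟩
  · have h4 : lam = tailEven lam + {o, o} + lamPrime lam o := (add_tsub_cancel_of_le hle).symm
    rw [h1] at h4
    conv_lhs => rw [h4]
    abel
  · rw [h1]; simp; ring

/-- The decomposition of a partition with an even part `e`. -/
lemma exists_mu_split {mu : Multiset ℕ} (h0 : ∀ x ∈ mu, x ≠ 0) {e : ℕ} (he : Even e) (hemu : e ∈ mu) :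
    ∃ E K O : Multiset ℕ, ∃ z j : ℕ, j ≤ 1 ∧
    mu = E + {e} + K + K + O + Multiset.replicate z 1 ∧ E.card + 1 = (tailEven mu).card + 2 * j ∧
    E.sum + e = (tailEven mu).sum + 2 * (j * e) ∧
    (muPrime mu).card = 2 * K.card + O.card + z + 2 * j ∧ (∀ x ∈ E, Even x ∧ x ≠ 0) ∧
    (∀ x ∈ O, Odd x ∧ x ≠ 1) ∧ ∀ x ∈ K, x ≠ 0 := by
  obtain ⟨K, O, z, h1, h2, h3⟩ := (muPrime mu).exists_split fun a ha => even_count_sub_tailEven mu ha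
  have hmu : muPrime mu ≤ mu := Multiset.sub_le_self _ _
  have h4 : mu = tailEven mu + muPrime mu := (add_tsub_cancel_of_le (tailEven_le mu)).symm
  have h5 : ∀ x ∈ K, x ≠ 0 := fun x hx => h0 x (Multiset.mem_of_le hmu (h3 x hx))
  have h6 : ∀ x ∈ tailEven mu, Even x ∧ x ≠ 0 := fun x hx =>
    ⟨(mem_tailEven.1 hx).1, h0 x (mem_of_mem_tailEven hx)⟩
  -- If `e` occurs an odd number of times in `mu`, its copy in `tailEven mu` goes to the peak.
  -- Otherwise a pair of copies is broken up: one goes to the peak, the other becomes a further even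
  -- end, and `j = 1` records this.
  by_cases hE : e ∈ tailEven mu
  · obtain ⟨E, hE'⟩ := Multiset.exists_cons_of_mem hE
    refine ⟨E, K, O, z, 0, by omega, ?_, ?_, ?_, ?_, ?_, h2, h5⟩
    · rw [h1, hE', ← Multiset.singleton_add] at h4
      conv_lhs => rw [h4]
      abel
    · rw [hE']; simp
    · rw [hE']; simp; ring
    · rw [h1]; simp; ring
    · intro x hx; exact h6 x (by rw [hE']; exact Multiset.mem_cons_of_mem hx)
  · have h7 : e ∈ K := by
      have h8 : e ∈ muPrime mu := by
        rw [h4, Multiset.mem_add] at hemu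
        tauto
      rw [h1] at h8
      simp only [Multiset.mem_add, Multiset.mem_replicate] at h8
      rcases h8 with ((h8 | h8) | h8) | h8
      · exact h8
      · exact h8
      · exact absurd he (Nat.not_even_iff_odd.2 (h2 e h8).1)
      · rw [h8.2] at he; exact absurd he (by decide)
    obtain ⟨K', hK'⟩ := Multiset.exists_cons_of_mem h7
    refine ⟨tailEven mu + {e}, K', O, z, 1, le_rfl, ?_, ?_, ?_, ?_, ?_, h2, ?_⟩
    · rw [h1, hK', ← Multiset.singleton_add] at h4
      conv_lhs => rw [h4]
      abel
    · simp
    · simp; ring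
    · rw [h1, hK']; simp; ring
    · intro x hx
      rw [Multiset.mem_add, Multiset.mem_singleton] at hx
      rcases hx with hx | rfl
      · exact h6 x hx
      · exact ⟨he, h0 x hemu⟩
    · intro x hx; exact h5 x (by rw [hK']; exact Multiset.mem_cons_of_mem hx)

lemma odd_sum_card {O : Multiset ℕ} (h : ∀ x ∈ O, Odd x) : Even (O.sum + O.card) := by
  induction O using Multiset.induction_on with
  | empty => simp
  | cons x S ih =>
    rw [Multiset.sum_cons, Multiset.card_cons]
    have h1 := ih fun y hy => h y (by simp [hy])
    have h2 := (h x (by simp)).add_odd odd_one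
    have := h1.add h2
    rwa [show S.sum + S.card + (x + 1) = x + S.sum + (S.card + 1) by ring] at this

lemma even_sum {E : Multiset ℕ} (h : ∀ x ∈ E, Even x) : Even E.sum :=
  even_iff_two_dvd.2 (Multiset.dvd_sum fun x hx => even_iff_two_dvd.1 (h x hx))

/-- In the application, `A` and `B` are the halves of `|λ_e| + 2o` and of `|μ_e|`, `e = 2 * E`, and
`z` and `l` count the parts equal to 1 and the odd parts different from 1, without the two copies of
`o`. The four equations express that the flow is -1 at the zigzag, that the number of simple points
is right, and that the inward and the outward ends of weight 1 are used up. The final inequalities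
carry the asymptotics. -/
lemma exists_parameters {z₁ z₂ l₁ l₂ A B E j c : ℕ} (hj : j ≤ 1) (hc : c = ((A : ℤ) - B).natAbs)
    (hpar : Even (z₁ + l₁ + (z₂ + l₂))) : ∃ C : ℕ, ∀ h m, C ≤ h → C ≤ m → ∃ n n₁ n₂ u v f₁ f₂ : ℕ,
    (u = v ∨ u = v + 1) ∧ A + n₂ = B + j * (2 * E) + n₁ ∧ n₁ + n₂ + u + v + 1 + j = c + 2 * m ∧
    (if u = v then 1 else 0) + l₂ + 2 * f₁ + 3 * n + 2 * n₂ + 2 * u = z₁ + (2 * c + h + 2 * m - 1) ∧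
    1 + (if u = v then 0 else 1) + l₁ + 2 * f₂ + n + 2 * n₁ + 2 * v = z₂ + (2 * c + h + 2 * m - 1) ∧
    h ≤ 3 * n + C ∧ m ≤ v + C ∧ v ≤ u ∧ 0 < u := by
  obtain ⟨p, hp⟩ := hpar
  -- A generous constant: it dominates all offsets, so that the subtractions of natural numbers
  -- below are exact.
  refine ⟨20 * (z₁ + z₂ + l₁ + l₂ + A + B + E) + 20, fun h m hh hm => ?_⟩
  -- All but at most four of the `X` available inward ends of weight 1 go to births, three to each;
  -- the rest form forks.
  have hX : ∀ X, 3 ≤ X → ∃ n f, 3 * n + 2 * f = X ∧ f ≤ 2 := by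
    intro X hX
    by_cases h1 : X % 3 = 1
    · exact ⟨X / 3 - 1, 2, by omega, le_rfl⟩
    · exact ⟨X / 3, (X % 3) / 2, by omega, by omega⟩
  have hj' : j = 0 ∨ j = 1 := by omega
  rcases hj' with rfl | rfl
  · obtain ⟨n₁, n₂, h1, h2⟩ : ∃ n₁ n₂ : ℕ, A + n₂ = B + n₁ ∧ n₁ + n₂ = c :=
      ⟨((A : ℤ) - B).toNat, ((B : ℤ) - A).toNat, by omega, by omega⟩
    obtain ⟨n, f, h3, h4⟩ := hX (z₁ + (2 * c + h + 2 * m - 1) - l₂ - 2 * n₂ - 2 * m) (by omega)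
    -- The outward ends of weight 1 that are left form forks; by the parity hypothesis their number
    -- is even.
    refine ⟨n, n₁, n₂, m, m - 1, f,
      (z₂ + (2 * c + h + 2 * m - 1) - 2 - l₁ - n - 2 * n₁ - 2 * (m - 1)) / 2, ?_⟩
    rw [if_neg (by omega), if_neg (by omega)]
    omega
  · obtain ⟨n₁, n₂, h1, h2⟩ : ∃ n₁ n₂ : ℕ, A + n₂ = B + 2 * E + n₁ ∧
        n₁ + n₂ = ((A : ℤ) - B - 2 * E).natAbs :=
      ⟨((A : ℤ) - B - 2 * E).toNat, ((B : ℤ) + 2 * E - A).toNat, by omega, by omega⟩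
    -- Halving is exact, because `n₁ + n₂ = |A - B - 2E|` has the same parity as `c`.
    obtain ⟨u, hu⟩ : ∃ u, n₁ + n₂ + u + u + 2 = c + 2 * m := ⟨(c + 2 * m - 2 - n₁ - n₂) / 2, by omega⟩
    obtain ⟨n, f, h3, h4⟩ := hX (z₁ + (2 * c + h + 2 * m - 1) - l₂ - 2 * n₂ - 2 * u - 1) (by omega)
    refine ⟨n, n₁, n₂, u, u, f,
      (z₂ + (2 * c + h + 2 * m - 1) - 1 - l₁ - n - 2 * n₁ - 2 * u) / 2, ?_⟩
    rw [if_pos rfl, if_pos rfl]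
    omega

/-- The sum is the number of vertices in the inward tails when `g` cycles are shared out evenly and
the remainder goes to the first `g % u` tails. -/
lemma sum_quotient (g : ℕ) {u : ℕ} (hu : 0 < u) :
    ∑ c ∈ Finset.range u, (2 * (if c < g % u then g / u + 1 else g / u) + 2) = 2 * g + 2 * u := by
  have h1 : ∀ c, 2 * (if c < g % u then g / u + 1 else g / u) + 2 =
      (2 * (g / u) + 2) + if c < g % u then 2 else 0 := by
    intro c; split_ifs <;> ring
  have hlt := Nat.mod_lt g hu
  have h2 : (Finset.range u).filter (fun c => c < g % u) = Finset.range (g % u) := by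
    ext c; simp only [Finset.mem_filter, Finset.mem_range]; omega
  rw [Finset.sum_congr rfl fun c _ => h1 c, Finset.sum_add_distrib, ← Finset.sum_filter, h2]
  simp only [Finset.sum_const, Finset.card_range, smul_eq_mul]
  have h3 := Nat.div_add_mod g u
  linear_combination 2 * h3

/-- A lower bound for the numbers `z_{λ,μ}(g,h,m)` by products of factorials. -/
lemma exists_factorial_le_zigzagZ {lam mu : Multiset ℕ} (h0 : ∀ x ∈ lam, x ≠ 0) (h0' : ∀ x ∈ mu, x ≠ 0)
    (hsum : lam.sum = mu.sum) {o e : ℕ} (ho : Odd o) (ho1 : o ≠ 1) (ho2 : 2 ≤ lam.count o)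
    (he : Even e) (he2 : 2 * o ≤ e) (hemu : e ∈ mu) :
    ∃ C : ℕ, ∀ g h m, C ≤ h → C ≤ m → ∃ n u v : ℕ, h ≤ 3 * n + C ∧ m ≤ v + C ∧ v ≤ u ∧ 0 < u ∧
      ∀ (w : ℕ → ℝ) (hw : StrictMono w), n.factorial * (v.factorial * (v.factorial *
        (u.factorial ^ (2 * (g / u) + 2) * (g % u).factorial ^ 2))) ≤ zigzagZ lam mu o g h m w hw := by
  obtain ⟨K₁, O₁, z₁, hlam, hlam', hO₁, hK₁⟩ := exists_lam_split h0 ho ho2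
  obtain ⟨E₂, K₂, O₂, z₂, j, hj, hmu, hE₂c, hE₂s, hmu', hE₂, hO₂, hK₂⟩ := exists_mu_split h0' he hemu
  have hE₁ : ∀ x ∈ tailEven lam, Even x ∧ x ≠ 0 := fun x hx =>
    ⟨(mem_tailEven.1 hx).1, h0 x (mem_of_mem_tailEven hx)⟩
  have hE₃ : ∀ x ∈ tailEven mu, Even x := fun x hx => (mem_tailEven.1 hx).1
  obtain ⟨A, hA⟩ : ∃ A, (tailEven lam).sum + 2 * o = 2 * A := by
    obtain ⟨k, hk⟩ := even_sum fun x hx => (hE₁ x hx).1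
    exact ⟨k + o, by omega⟩
  obtain ⟨B, hB⟩ : ∃ B, (tailEven mu).sum = 2 * B := by
    obtain ⟨k, hk⟩ := even_sum hE₃
    exact ⟨k, by omega⟩
  obtain ⟨E, rfl⟩ : ∃ E, e = 2 * E := ⟨e / 2, by obtain ⟨k, hk⟩ := he; omega⟩
  have hc : zigzagC lam mu o = ((A : ℤ) - B).natAbs := by unfold zigzagC; omega
  have hsum1 : lam.sum = (tailEven lam).sum + 2 * o + 2 * K₁.sum + O₁.sum + z₁ := by
    conv_lhs => rw [hlam]
    simp; ring
  have hsum2 : mu.sum = E₂.sum + 2 * E + 2 * K₂.sum + O₂.sum + z₂ := by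
    conv_lhs => rw [hmu]
    simp; ring
  have hcard1 : lam.card = (tailEven lam).card + 2 + 2 * K₁.card + O₁.card + z₁ := by
    conv_lhs => rw [hlam]
    simp; ring
  have hcard2 : mu.card = E₂.card + 1 + 2 * K₂.card + O₂.card + z₂ := by
    conv_lhs => rw [hmu]
    simp; ring
  obtain ⟨p₁, hp₁⟩ := odd_sum_card fun x hx => (hO₁ x hx).1
  obtain ⟨p₂, hp₂⟩ := odd_sum_card fun x hx => (hO₂ x hx).1
  -- Modulo 2, the sum of a partition is the number of its odd parts, and the two sums agree.
  have hpar : Even (z₁ + O₁.card + (z₂ + O₂.card)) := by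
    generalize j * (2 * E) = jE at hE₂s
    rw [Nat.even_iff]; omega
  obtain ⟨C, hC⟩ := exists_parameters (E := E) hj hc hpar
  refine ⟨C + 1, fun g h m hh hm => ?_⟩
  obtain ⟨n, n₁, n₂, u, v, f₁, f₂, hu, h1, h2, h3, h4, h5, h6, h7, h8⟩ :=
    hC h m (Nat.le_of_succ_le hh) (Nat.le_of_succ_le hm)
  refine ⟨n, u, v, Nat.le_succ_of_le h5, Nat.le_succ_of_le h6, h7, h8, fun w hw => ?_⟩
  have hflow' : (tailEven lam).sum + 2 * n₂ + 2 * o = E₂.sum + 2 * E + 2 * n₁ := by omega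
  have hflow : (O₁.sum : ℤ) - O₁.card + 2 * K₁.sum + 2 * f₁ + 2 * n =
      O₂.sum - O₂.card + 2 * K₂.sum + 2 * f₂ := by
    clear hE₂s
    rcases hu with rfl | rfl
    · rw [if_pos rfl] at h3 h4; omega
    · rw [if_neg (by omega)] at h3 h4; omega
  obtain ⟨F, rfl, rfl, rfl, hFJ, hP, hS, hin, hout⟩ := Config.exists_config (n := n) (n₁ := n₁) (n₂ := n₂)
    (f₁ := f₁) (f₂ := f₂) (J := fun c => if c < g % u then g / u + 1 else g / u) (Jmax := g / u + 1)
    hE₁ hO₁ hK₁ hE₂ hO₂ hK₂ hu (fun c => by split_ifs <;> omega) ho ho1 he he2 hflow hflow'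
  rw [sum_quotient g h8] at hS
  have hlt := Nat.mod_lt g h8
  obtain ⟨R, hR, hR1⟩ : ∃ R, 2 * zigzagC lam mu o + h + 2 * m - 1 = R ∧
    R + 1 = 2 * zigzagC lam mu o + h + 2 * m := ⟨_, rfl, by clear hE₂s h1 h2 h3 h4 hC; omega⟩
  rw [hR] at h3 h4
  have hε : (if F.u = F.v then 1 else 0) + (if F.u = F.v then 0 else 1) = 1 := by split_ifs <;> rfl
  have hs' : (lamPrime lam o).card + (muPrime mu).card + 2 * (zigzagC lam mu o + h) = 2 * F.numPairs := by
    rw [hlam', hmu', hP]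
    linarith only [h2, h3, h4, hR1, hε]
  have hs : zigzagS lam mu o h = F.numPairs := by
    rw [zigzagS]
    generalize (lamPrime lam o).card + (muPrime mu).card = a at hs' ⊢
    clear hE₂s h1 h2 h3 h4
    omega
  have ht' : F.numSimple + 2 = (tailEven lam).card + (tailEven mu).card + 2 * g + 4 * m +
      2 * zigzagC lam mu o := by
    rw [hS]
    linarith only [h2, hE₂c]
  have ht : zigzagT lam mu o g m = F.numSimple := by
    rw [zigzagT, ← ht', Nat.add_sub_cancel]
  refine F.factorial_le hlt.le (fun c _ => by rw [hFJ]) hw hs ht ?_ ?_ ?_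
  · rw [hR, hin, h3, Multiset.replicate_add]
    conv_rhs => rw [hlam]
    abel
  · rw [hR, hout, h4, Multiset.replicate_add]
    conv_rhs => rw [hmu]
    abel
  · rw [Multiset.card_add, Multiset.card_add, Multiset.card_replicate, hs, ht, hR,
      ← hs', add_assoc, ht', hlam', hmu', hcard1, hcard2]
    linarith only [hR1, hE₂c]

/-! ### Asymptotics -/

/-- The single term `k ^ k / k!` of the exponential series is at most `exp k`. -/
lemma mul_log_sub_le_log_factorial (k : ℕ) : k * Real.log k - k ≤ Real.log k.factorial := by
  rcases Nat.eq_zero_or_pos k with rfl | hk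
  · simp
  have hk' : (0 : ℝ) < k := by exact_mod_cast hk
  have hf : (0 : ℝ) < k.factorial := by exact_mod_cast k.factorial_pos
  have h := Real.log_le_log (by positivity) (Real.pow_div_factorial_le_exp (k : ℝ) hk'.le k)
  rw [Real.log_exp, Real.log_div (by positivity) hf.ne', Real.log_pow] at h
  linarith

/-- The inequality `log x ≤ x - 1` at `x = u / r`. It replaces `log r` by `log u` in the
contribution of the remainder, at a cost of `u` that does not depend on `g`. -/
lemma mul_log_sub_le {r u : ℕ} (hu : 0 < u) : r * Real.log u - u ≤ r * Real.log r := by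
  have hu' : (0 : ℝ) < u := by exact_mod_cast hu
  rcases Nat.eq_zero_or_pos r with rfl | hr
  · simp
  have hr' : (0 : ℝ) < r := by exact_mod_cast hr
  have h := Real.log_le_sub_one_of_pos (div_pos hu' hr')
  rw [Real.log_div hu'.ne' hr'.ne'] at h
  have h2 := mul_le_mul_of_nonneg_left h hr'.le
  have h3 : (r : ℝ) * (u / r - 1) = u - r := by field_simp
  rw [h3] at h2
  nlinarith

/-- With `g = q * u + r`, the factors `u! ^ (2 * q + 2) * r! ^ 2` contribute at least `2 * g * (log
u - 1) + 2 * u * (log u - 2)`: the two layers beyond the `2 * q` absorb the loss from the remainder.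
As `u ≥ v`, the two factors `v!` then complete the coefficient 4. -/
lemma log_factorials_ge {n v u g : ℕ} (hu : 0 < u) (hvu : v ≤ u) (hv : 2 ≤ Real.log v) :
    (n * (Real.log n - 2)) + 2 * g * (Real.log v - 2) + 4 * (v * (Real.log v - 2)) ≤
      Real.log ((n.factorial * (v.factorial * (v.factorial *
        (u.factorial ^ (2 * (g / u) + 2) * (g % u).factorial ^ 2))) : ℕ) : ℝ) := by
  have hpos : ∀ k : ℕ, ((k.factorial : ℕ) : ℝ) ≠ 0 := fun k => by exact_mod_cast k.factorial_ne_zero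
  have hv0 : 0 < v := by
    rcases Nat.eq_zero_or_pos v with rfl | h
    · simp at hv; linarith
    · exact h
  push_cast
  rw [Real.log_mul (hpos _) (by simp [hpos]), Real.log_mul (hpos _) (by simp [hpos]),
    Real.log_mul (hpos _) (by simp [hpos]), Real.log_mul (by simp [hpos]) (by simp [hpos]),
    Real.log_pow, Real.log_pow]
  have h1 := mul_log_sub_le_log_factorial n
  have h2 := mul_log_sub_le_log_factorial v
  have h3 := mul_log_sub_le_log_factorial u
  have h4 := mul_log_sub_le_log_factorial (g % u)
  have h5 := mul_log_sub_le (r := g % u) hu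
  have h6 : (u : ℝ) * (g / u : ℕ) + (g % u : ℕ) = g := by exact_mod_cast Nat.div_add_mod g u
  have hv' : (0 : ℝ) < v := by exact_mod_cast hv0
  have hvu' : (v : ℝ) ≤ u := by exact_mod_cast hvu
  have hlog : Real.log v ≤ Real.log u := Real.log_le_log hv' hvu'
  generalize (g / u : ℕ) = q at *
  generalize (g % u : ℕ) = r at *
  have hq : (0 : ℝ) ≤ q := Nat.cast_nonneg q
  have hr : (0 : ℝ) ≤ r := Nat.cast_nonneg r
  have hn : (0 : ℝ) ≤ n := Nat.cast_nonneg n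
  have h7 : (2 * q + 2) * (u * Real.log u - u) ≤ (2 * q + 2) * Real.log u.factorial :=
    mul_le_mul_of_nonneg_left h3 (by positivity)
  have h8 : (v : ℝ) * (Real.log v - 2) ≤ u * (Real.log u - 2) :=
    mul_le_mul hvu' (by linarith) (by linarith) (by linarith)
  have h9 : (g : ℝ) * (Real.log v - 2) ≤ g * (Real.log u - 1) :=
    mul_le_mul_of_nonneg_left (by linarith) (Nat.cast_nonneg g)
  have h10 : (g : ℝ) * (Real.log u - 1) = q * (u * Real.log u - u) + r * (Real.log u - 1) := by
    rw [← h6]; ring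
  push_cast
  nlinarith

/-- Subtracting `C` from `a * x`, and passing from `log x` to `log y - 2`, each cost at most a
factor `1 - ε / 2` for large `x`, and the square of this factor is at least `1 - ε`. -/
lemma eventually_log_ge {a C ε : ℝ} (ha : 0 < a) (hε : 0 < ε) (hε1 : ε < 1) :
    ∀ᶠ x : ℝ in atTop, ∀ y, a * x - C ≤ y →
      2 ≤ Real.log y ∧ 0 ≤ Real.log x ∧ (1 - ε) * Real.log x ≤ Real.log y - 2 ∧
      (1 - ε) * (a * x * Real.log x) ≤ y * (Real.log y - 2) := by
  have h1 : ∀ᶠ x : ℝ in atTop, 2 * C ≤ ε * a * x := by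
    have : Tendsto (fun x : ℝ => ε * a * x) atTop atTop := tendsto_id.const_mul_atTop (by positivity)
    exact this.eventually_ge_atTop _
  have h2 : ∀ᶠ x : ℝ in atTop, 2 - Real.log (a / 2) ≤ ε / 2 * Real.log x := by
    have : Tendsto (fun x : ℝ => ε / 2 * Real.log x) atTop atTop :=
      Real.tendsto_log_atTop.const_mul_atTop (by positivity)
    exact this.eventually_ge_atTop _
  filter_upwards [h1, h2, eventually_ge_atTop (1 : ℝ)] with x h1 h2 h3 y hy
  have hx : 0 < x := by linarith
  have hlog : 0 ≤ Real.log x := Real.log_nonneg h3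
  have hax : 0 < a * x := mul_pos ha hx
  have hy1 : (1 - ε / 2) * (a * x) ≤ y := by nlinarith
  have hy2 : a / 2 * x ≤ y := by nlinarith
  have hl : Real.log (a / 2) + Real.log x ≤ Real.log y := by
    rw [← Real.log_mul (by positivity) hx.ne']
    exact Real.log_le_log (by positivity) hy2
  have hl2 : (1 - ε / 2) * Real.log x ≤ Real.log y - 2 := by linarith
  have hnn : 0 ≤ (1 - ε / 2) * Real.log x := mul_nonneg (by linarith) hlog
  refine ⟨by linarith, hlog, by nlinarith, ?_⟩
  calc (1 - ε) * (a * x * Real.log x) ≤ (1 - ε / 2) * (a * x) * ((1 - ε / 2) * Real.log x) := by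
        have : 0 ≤ a * x * Real.log x := mul_nonneg hax.le hlog
        nlinarith [mul_nonneg (sq_nonneg (ε / 2)) this]
    _ ≤ y * (Real.log y - 2) :=
        mul_le_mul hy1 hl2 hnn (by nlinarith)

theorem theorem1p1 {d : ℕ} (lam mu : Nat.Partition d) (o e : ℕ)
    (ho : Odd o) (ho1 : o ≠ 1) (ho2 : 2 ≤ lam.parts.count o)
    (he : Even e) (he2 : 2 * o ≤ e) (hemu : e ∈ mu.parts)
    (w : ℕ × ℕ × ℕ → ℕ → ℝ) (hw : ∀ p, StrictMono (w p)) :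
    (1 : EReal) ≤ liminf
      (fun p : ℕ × ℕ × ℕ =>
        ((Real.log (zigzagZ lam.parts mu.parts o p.1 p.2.1 p.2.2 (w p) (hw p) : ℝ) /
          ((p.2.1 : ℝ) / 3 * Real.log p.2.1 + 2 * (p.1 : ℝ) * Real.log p.2.2
            + 4 * (p.2.2 : ℝ) * Real.log p.2.2) : ℝ) : EReal))
      atTop := by
  obtain ⟨C, hC⟩ := exists_factorial_le_zigzagZ (fun x hx => (lam.parts_pos hx).ne')
    (fun x hx => (mu.parts_pos hx).ne') (lam.parts_sum.trans mu.parts_sum.symm) ho ho1 ho2 he he2 hemu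
  -- It suffices that for every real `c < 1` the quotient is eventually at least `c`.
  refine le_of_forall_lt fun b hb => ?_
  obtain ⟨c, hbc, hc1⟩ := EReal.lt_iff_exists_real_btwn.1 hb
  refine hbc.trans_le ?_
  have hc1' : c < 1 := by exact_mod_cast hc1
  obtain ⟨ε, hε, hε1, hεc⟩ : ∃ ε : ℝ, 0 < ε ∧ ε < 1 ∧ c ≤ 1 - ε :=
    ⟨min (1 - c) (1 / 2), lt_min (by linarith) (by norm_num),
      (min_le_right _ _).trans_lt (by norm_num), by linarith [min_le_left (1 - c) (1 / 2)]⟩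
  obtain ⟨H, hH⟩ := eventually_atTop.1 ((tendsto_natCast_atTop_atTop (R := ℝ)).eventually
    (eventually_log_ge (a := 1 / 3) (C := C) (by norm_num) hε hε1))
  obtain ⟨M, hM⟩ := eventually_atTop.1 ((tendsto_natCast_atTop_atTop (R := ℝ)).eventually
    (eventually_log_ge (a := 1) (C := C) one_pos hε hε1))
  -- The estimate is uniform in `g`, so `g` needs no lower bound; `h ≥ 2` makes the denominator
  -- positive.
  refine le_liminf_of_le (by isBoundedDefault) (eventually_atTop.2
    ⟨(0, max (max C H) 2, max C M), fun p hp => ?_⟩)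
  obtain ⟨g, h, m⟩ := p
  obtain ⟨-, hp1, hp2⟩ : 0 ≤ g ∧ max (max C H) 2 ≤ h ∧ max C M ≤ m := hp
  simp only [max_le_iff] at hp1 hp2
  obtain ⟨n, u, v, hn, hv, hvu, hu, hZ⟩ := hC g h m hp1.1.1 hp2.1
  have hZ' := hZ (w (g, h, m)) (hw (g, h, m))
  have hn' : (1 / 3 : ℝ) * h - C ≤ n := by
    have h1 : (h : ℝ) ≤ 3 * n + C := by exact_mod_cast hn
    have h2 : (0 : ℝ) ≤ C := Nat.cast_nonneg C
    linarith
  have hv' : (1 : ℝ) * m - C ≤ v := by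
    have h1 : (m : ℝ) ≤ v + C := by exact_mod_cast hv
    linarith
  obtain ⟨-, hlh, -, hb1⟩ := hH h hp1.1.2 n hn'
  obtain ⟨hv2, hlm, hb2, hb3⟩ := hM m hp2.2 v hv'
  have hlog := log_factorials_ge (n := n) (g := g) hu hvu hv2
  have hle : Real.log ((n.factorial * (v.factorial * (v.factorial *
        (u.factorial ^ (2 * (g / u) + 2) * (g % u).factorial ^ 2))) : ℕ) : ℝ) ≤
      Real.log (zigzagZ lam.parts mu.parts o g h m (w (g, h, m)) (hw (g, h, m)) : ℝ) := by
    refine Real.log_le_log ?_ (by exact_mod_cast hZ')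
    have : 0 < n.factorial * (v.factorial * (v.factorial *
        (u.factorial ^ (2 * (g / u) + 2) * (g % u).factorial ^ 2))) := by positivity
    exact_mod_cast this
  have hD : 0 < (h : ℝ) / 3 * Real.log h + 2 * (g : ℝ) * Real.log m + 4 * (m : ℝ) * Real.log m := by
    have h1 : (1 : ℝ) < h := by exact_mod_cast hp1.2
    have h2 := Real.log_pos h1
    positivity
  have hfin : c * ((h : ℝ) / 3 * Real.log h + 2 * (g : ℝ) * Real.log m + 4 * (m : ℝ) * Real.log m) ≤
      Real.log (zigzagZ lam.parts mu.parts o g h m (w (g, h, m)) (hw (g, h, m)) : ℝ) := by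
    refine le_trans (mul_le_mul_of_nonneg_right hεc hD.le) (le_trans ?_ (hlog.trans hle))
    have h1 := mul_le_mul_of_nonneg_left hb2 (show (0 : ℝ) ≤ 2 * g by positivity)
    linarith
  exact_mod_cast (le_div_iff₀ hD).2 hfin
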